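/- All gradings are decompositions of a Lie algebra $L$ into a direct sum of nonzero subspaces $L_j$ such that for all $j,k$ there is $l$ with $[L_j,L_k]\subseteq L_l$. A grading is fine if it has no proper refinement (a refinement is a grading each of whose subspaces splits those of the given one). It is a group grading if its subspaces can be indexed by distinct elements of an abelian group so that $[L_j,L_k]\neq 0$ implies $[L_j,L_k]\subseteq L_{jk}$, and a fine group grading if it is a group grading with no proper refinement that is a group grading. Two gradings are equivalent if an automorphism of $L$ carries one onto the other. A MAD-group is a maximal set of pairwise commuting diagonalizable automorphisms of $L$, i.e. one that contains every diagonalizable automorphism commuting with all its elements; $\operatorname{Gr}(\mathcal G)$ is the decomposition of $L$ into the nonzero simultaneous eigenspaces of $\mathcal G$, and $\operatorname{Diag}(\Gamma)$ is the set of automorphisms acting as a scalar on each subspace of $\Gamma$. The Lie algebra $sl(2,\mathbb C)$ has the Cartan grading, into the lines spanned by $\begin{pmatrix}1&0\\0&-1\end{pmatrix},\begin{pmatrix}0&1\\0&0\end{pmatrix},\begin{pmatrix}0&0\\1&0\end{pmatrix}$, and the Pauli grading, into the lines spanned by $\begin{pmatrix}1&0\\0&-1\end{pmatrix},\begin{pmatrix}0&1\\1&0\end{pmatrix},\begin{pmatrix}0&1\\-1&0\end{pmatrix}$.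 A grading of $o(4,\mathbb C)$ is composed of two gradings of $sl(2,\mathbb C)$ if some Lie algebra isomorphism $sl(2,\mathbb C)\oplus sl(2,\mathbb C)\to o(4,\mathbb C)$ carries the direct sum of these two gradings onto it. Theorem. The complex Lie algebra $o(4,\mathbb C)$ has, up to conjugacy in $\operatorname{Aut} o(4,\mathbb C)$, exactly six MAD-groups $\mathcal G_1,\dots,\mathcal G_6$ (pairwise non-conjugate) and, up to equivalence, exactly six fine group gradings $\Gamma_1,\dots,\Gamma_6$ (pairwise non-equivalent). They can be chosen and numbered so that $\operatorname{Gr}(\mathcal G_i)=\Gamma_i$ and $\operatorname{Diag}(\Gamma_i)=\mathcal G_i$ for all $i$, and (a) $\Gamma_1$ consists of one 2-dimensional and four 1-dimensional subspaces, and each of $\Gamma_2,\dots,\Gamma_6$ consists of six 1-dimensional subspaces. (b) $\Gamma_1$ is the Cartan grading, i.e. the decomposition of $o(4,\mathbb C)$ into the root spaces of a Cartan subalgebra (with the Cartan subalgebra itself as zero root space). It is a fine group grading but not a fine grading: it has a refinement that is a fine grading but not a group grading, and that is composed of two Cartan gradings of $sl(2,\mathbb C)$. The gradings $\Gamma_2,\dots,\Gamma_6$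 are fine gradings. (c) $\Gamma_2$ is composed of the Cartan grading and the Pauli grading of $sl(2,\mathbb C)$, $\Gamma_3$ is composed of two Pauli gradings of $sl(2,\mathbb C)$, and none of $\Gamma_4,\Gamma_5,\Gamma_6$ is composed of two fine group gradings of $sl(2,\mathbb C)$. -/

import Mathlib

/-! A decomposition of a Lie algebra `L` is recorded as the set `P : Set (Submodule K L)` of its
(automatically pairwise distinct) nonzero summands. -/

section GradingsOfLieAlgebras

universe v u

variable {K : Type v} {L : Type u} [Field K] [LieRing L] [LieAlgebra K L]

/-- `P` is (the set of grading subspaces of) a grading of `L`: the members of `P` are nonzero,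
`L` is their direct sum, and for all `A, B ∈ P` there is `C ∈ P` with `[A, B] ⊆ C`. -/
structure IsLieGrading (P : Set (Submodule K L)) : Prop where
  ne_bot : ∀ A ∈ P, A ≠ ⊥
  indep : sSupIndep P
  sSup_eq_top : sSup P = ⊤
  lie_mem : ∀ A ∈ P, ∀ B ∈ P, ∃ C ∈ P, ∀ a ∈ A, ∀ b ∈ B, ⁅a, b⁆ ∈ C

/-- `Q` is a refinement of `P`: every member of `P` is the sum of some members of `Q`. -/
def Refines (Q P : Set (Submodule K L)) : Prop :=
  ∀ A ∈ P, ∃ S ⊆ Q, sSup S = A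

/-- A fine grading: a grading without proper refinement. -/
def IsFineGrading (P : Set (Submodule K L)) : Prop :=
  IsLieGrading P ∧ ∀ Q : Set (Submodule K L), IsLieGrading Q → Refines Q P → Q = P

/-- A group grading: a grading whose subspaces can be indexed by (distinct) elements of an abelian
group `G` such that `[L_j, L_k] ≠ 0` implies `[L_j, L_k] ⊆ L_{j * k}` (in particular, that
`j * k` is an index). -/
def IsGroupGrading (P : Set (Submodule K L)) : Prop :=
  IsLieGrading P ∧
    ∃ (G : Type u) (_ : CommGroup G) (d : P → G), Function.Injective d ∧
      ∀ A B : P, (∃ a ∈ A.1, ∃ b ∈ B.1, ⁅a, b⁆ ≠ 0) →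
        ∃ C : P, d C = d A * d B ∧ ∀ a ∈ A.1, ∀ b ∈ B.1, ⁅a, b⁆ ∈ C.1

/-- A fine group grading: a group grading without proper group refinement. -/
def IsFineGroupGrading (P : Set (Submodule K L)) : Prop :=
  IsGroupGrading P ∧ ∀ Q : Set (Submodule K L), IsGroupGrading Q → Refines Q P → Q = P

/-- Equivalence of gradings: some automorphism of `L` carries the one onto the other. -/
def GradingEquivalent (P Q : Set (Submodule K L)) : Prop :=
  ∃ h : L ≃ₗ⁅K⁆ L, Q = (fun A : Submodule K L => A.map (h : L →ₗ[K] L)) '' P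

/-- An automorphism of `L` is diagonalizable when `L` is the sum of its eigenspaces. -/
def IsDiagonalizableAut (g : L ≃ₗ⁅K⁆ L) : Prop :=
  ⨆ μ : K, Module.End.eigenspace (g : L →ₗ[K] L) μ = ⊤

/-- Two automorphisms of `L` commute. -/
def CommuteAut (f g : L ≃ₗ⁅K⁆ L) : Prop :=
  ∀ x : L, f (g x) = g (f x)

/-- A MAD-group in `Aut L`: a maximal abelian group of diagonalizable automorphisms. -/
structure IsMADGroup (G : Set (L ≃ₗ⁅K⁆ L)) : Prop where
  diagonalizable : ∀ g ∈ G, IsDiagonalizableAut g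
  commute : ∀ f ∈ G, ∀ g ∈ G, CommuteAut f g
  maximal : ∀ h : L ≃ₗ⁅K⁆ L, IsDiagonalizableAut h → (∀ g ∈ G, CommuteAut h g) → h ∈ G

/-- Conjugacy of subsets of `Aut L`: `G₂ = h G₁ h⁻¹` for some `h ∈ Aut L`. -/
def ConjugateAutSets (G₁ G₂ : Set (L ≃ₗ⁅K⁆ L)) : Prop :=
  ∃ h : L ≃ₗ⁅K⁆ L, G₂ = (fun g : L ≃ₗ⁅K⁆ L => (h.symm.trans g).trans h) '' G₁

/-- `Diag P`: the automorphisms acting as a scalar on every member of `P`. -/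
def gradingDiag (P : Set (Submodule K L)) : Set (L ≃ₗ⁅K⁆ L) :=
  {g | ∀ A ∈ P, ∃ α : K, ∀ x ∈ A, g x = α • x}

/-- `Gr G`: the nonzero simultaneous eigenspaces of the automorphisms in `G`. -/
def autGrading (G : Set (L ≃ₗ⁅K⁆ L)) : Set (Submodule K L) :=
  {A | A ≠ ⊥ ∧
    ∃ χ : G → K, A = ⨅ g : G, Module.End.eigenspace (g.1 : L →ₗ[K] L) (χ g)}

/-- A Cartan grading: the decomposition of `L` into the (nonzero) root spaces, including the zero
root space, of a Cartan subalgebra. -/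
def IsCartanGrading (P : Set (Submodule K L)) : Prop :=
  ∃ (H : LieSubalgebra K L) (_ : H.IsCartanSubalgebra),
    P = {A | A ≠ ⊥ ∧ ∃ χ : H → K, A = (LieAlgebra.rootSpace H χ).toSubmodule}

end GradingsOfLieAlgebras

/-- The Lie algebra `o(4, ℂ)` of skew-symmetric complex `4 × 4` matrices. -/
abbrev O4C : Type := LieAlgebra.Orthogonal.so (Fin 4) ℂ

/-- The Lie algebra `sl(2, ℂ)` of traceless complex `2 × 2` matrices. -/
abbrev Sl2C : Type := LieAlgebra.SpecialLinear.sl (Fin 2) ℂ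

/-- The line spanned by a matrix `M`, as a subspace of `sl(2, ℂ)` (for traceless `M`). -/
noncomputable def sl2Line (M : Matrix (Fin 2) (Fin 2) ℂ) : Submodule ℂ Sl2C :=
  Submodule.span ℂ {X : Sl2C | X.1 = M}

/-- The Cartan grading of `sl(2, ℂ)`. -/
noncomputable def sl2Cartan : Set (Submodule ℂ Sl2C) :=
  {sl2Line !![1, 0; 0, -1], sl2Line !![0, 1; 0, 0], sl2Line !![0, 0; 1, 0]}

/-- The Pauli grading of `sl(2, ℂ)`. -/
noncomputable def sl2Pauli : Set (Submodule ℂ Sl2C) :=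
  {sl2Line !![1, 0; 0, -1], sl2Line !![0, 1; 1, 0], sl2Line !![0, 1; -1, 0]}

/-- The decomposition `P` of `o(4, ℂ)` is composed of the decompositions `P₁` and `P₂` of
`sl(2, ℂ)`: under some isomorphism `sl(2, ℂ) ⊕ sl(2, ℂ) ≃ o(4, ℂ)` its members are the images of
`A ⊕ 0` with `A ∈ P₁` and of `0 ⊕ B` with `B ∈ P₂`. -/
def IsComposedOf (P : Set (Submodule ℂ O4C)) (P₁ P₂ : Set (Submodule ℂ Sl2C)) : Prop :=
  ∃ φ : (Sl2C × Sl2C) ≃ₗ⁅ℂ⁆ O4C,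
    P = (fun A : Submodule ℂ Sl2C =>
          (A.prod (⊥ : Submodule ℂ Sl2C)).map (φ : (Sl2C × Sl2C) →ₗ[ℂ] O4C)) '' P₁ ∪
        (fun B : Submodule ℂ Sl2C =>
          ((⊥ : Submodule ℂ Sl2C).prod B).map (φ : (Sl2C × Sl2C) →ₗ[ℂ] O4C)) '' P₂

/-! Two mechanisms carry the theorem: over `ℂ`, group gradings are the same thing as eigenspace
decompositions, and commuting diagonalizable automorphisms of `sl(2, ℂ) ⊕ sl(2, ℂ)`, which is
isomorphic to `o(4, ℂ)`, can be classified by hand.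

If the members of `P` are indexed by an abelian group, each complex character of that group acts on
`L` by scalars on the members, and this action is an automorphism. Characters separate group
elements, so `P` is recovered as `Gr (Diag P)` (`IsGroupGrading.isSeparated`,
`IsSeparated.autGrading_gradingDiag`). Conversely, the joint eigenspaces of commuting diagonalizable
automorphisms form a group grading. An inclusion of diagonal groups gives a refinement in the
opposite direction. Hence once every commuting diagonalizable set is conjugate into one of six
diagonal groups, maximality identifies the MAD-groups and fineness identifies the fine group
gradings.

On `sl(2, ℂ)`, such a set is conjugate into the torus, which is diagonal in the Cartan basis, or
into the Klein four-group, which is diagonal in the Pauli basis; the first case occurs when some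
element does not square to 1 (`exists_conjAut_subset`). An automorphism of the direct sum preserves
or swaps the two ideals. If all elements of the set preserve them, each factor is Cartan or Pauli,
giving three types up to a swap. If some element swaps them, conjugation brings it to `(x, y) ↦ (a
y, x)`. Everything commuting with it is then `(q, q)`, possibly times this swap, where `q` and `a`
lie in one commuting diagonalizable set. In the torus, `a` has a square root and conjugates to 1; in
the Klein group, either `a = 1` or `a` is one of three involutions that a rotation permutes. This
gives three more types, with eigenvectors `(±μ b, b)`, where `μ²` is the eigenvalue of `a` on `b`.

The six types are told apart by the number of subspaces, the presence of homogeneous vectors in a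
simple ideal, and the exponent of the diagonal group. The Cartan grading is special: an automorphism
acting by scalars on the root vectors fixes the Cartan plane pointwise. No group grading can
therefore split this plane, although a mere grading can. -/

section Lattice

/-! ### Independent families of subspaces. -/

variable {K V : Type*} [Field K] [AddCommGroup V] [Module K V]

/-- Since the `A j` span, `B i` lies in `A i` plus the sum of the other `B j`. Intersecting with `B
i`, the modular law leaves only `A i`, because independence kills the other term. -/
theorem Submodule.eq_of_le_of_iSupIndep {ι : Type*} {A B : ι → Submodule K V} (hB : iSupIndep B)
    (hle : ∀ i, A i ≤ B i) (htop : ⨆ i, A i = ⊤) : A = B := by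
  funext i
  refine le_antisymm (hle i) ?_
  have h1 : B i ≤ A i ⊔ ⨆ (j) (_ : j ≠ i), B j := by
    refine le_top.trans (htop.ge.trans (iSup_le fun j => ?_))
    by_cases hj : j = i
    · subst hj; exact le_sup_left
    · exact (hle j).trans (le_sup_of_le_right (le_iSup₂_of_le j hj le_rfl))
  calc B i = (A i ⊔ ⨆ (j) (_ : j ≠ i), B j) ⊓ B i := (inf_eq_right.mpr h1).symm
    _ = A i ⊔ (⨆ (j) (_ : j ≠ i), B j) ⊓ B i := sup_inf_assoc_of_le _ (hle i)
    _ ≤ A i := by rw [inf_comm, (hB i).eq_bot, sup_bot_eq]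

/-- A spanning set of nonzero subspaces that lie in different members of an independent family
consists of the nonzero members of that family. -/
theorem Submodule.setOf_ne_bot_eq_of_iSupIndep {X : Type*} {B : X → Submodule K V}
    (hB : iSupIndep B) {P : Set (Submodule K V)} (hne : ∀ A ∈ P, A ≠ ⊥) (htop : sSup P = ⊤)
    {c : Submodule K V → X} (hc : ∀ A ∈ P, A ≤ B (c A)) (hinj : Set.InjOn c P) :
    {A | A ≠ ⊥ ∧ ∃ x, A = B x} = P := by
  -- Grouping the members of `P` by label gives a spanning family below `B`, hence `B` itself.
  -- Injectivity of the labels then leaves at most one member in each group.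
  have key : (fun x => ⨆ (A : Submodule K V) (_ : A ∈ P ∧ c A = x), A) = B := by
    refine Submodule.eq_of_le_of_iSupIndep hB ?_ ?_
    · rintro x
      refine iSup₂_le ?_
      rintro A ⟨hA, rfl⟩
      exact hc A hA
    · rw [eq_top_iff, ← htop]
      exact sSup_le fun A hA => le_iSup_of_le (c A) (le_iSup₂_of_le A ⟨hA, rfl⟩ le_rfl)
  have key2 : ∀ A ∈ P, B (c A) = A := by
    intro A hA
    rw [← key]
    refine le_antisymm (iSup₂_le ?_) (le_iSup₂_of_le A ⟨hA, rfl⟩ le_rfl)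
    rintro A' ⟨hA', h⟩
    exact (hinj hA' hA h).le
  ext A
  constructor
  · rintro ⟨hA, x, rfl⟩
    by_cases h : ∃ A ∈ P, c A = x
    · obtain ⟨A, hA', rfl⟩ := h
      rwa [key2 A hA']
    · refine absurd ?_ hA
      rw [← key]
      simp only [iSup_eq_bot]
      rintro A ⟨hA, h'⟩
      exact absurd ⟨A, hA, h'⟩ h
  · intro hA
    exact ⟨hne A hA, c A, (key2 A hA).symm⟩

/-- A member of `Q` outside `P` would be disjoint from the sum of the others, and that sum is
already everything. -/
theorem eq_of_subset_of_sSupIndep {P Q : Set (Submodule K V)} (hQ : sSupIndep Q)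
    (hne : ∀ A ∈ Q, A ≠ ⊥) (htop : sSup P = ⊤) (h : P ⊆ Q) : Q = P := by
  refine Set.Subset.antisymm (fun A hA => ?_) h
  by_contra hAP
  refine hne A hA ?_
  have h1 : sSup (Q \ {A}) = ⊤ := eq_top_iff.mpr (htop ▸ sSup_le_sSup fun B hB =>
    ⟨h hB, fun hBA => hAP (hBA ▸ hB)⟩)
  have := hQ hA
  rwa [h1, disjoint_top] at this

/-- The members of `Q` below a given `A` sum to something inside `A`. These sums still span
together, so each of them fills its `A`. -/
theorem refines_of_forall_le {P Q : Set (Submodule K V)} (hP : sSupIndep P)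
    (hQ : sSup Q = ⊤) (h : ∀ B ∈ Q, ∃ A ∈ P, B ≤ A) : ∀ A ∈ P, ∃ S ⊆ Q, sSup S = A := by
  have key : (fun A : P => sSup {B ∈ Q | B ≤ A.1}) = fun A : P => A.1 := by
    refine Submodule.eq_of_le_of_iSupIndep ((sSupIndep_iff P).mp hP)
      (fun A => sSup_le fun B hB => hB.2) ?_
    rw [eq_top_iff, ← hQ]
    refine sSup_le fun B hB => ?_
    obtain ⟨A, hA, hBA⟩ := h B hB
    exact le_iSup_of_le ⟨A, hA⟩ (le_sSup ⟨hB, hBA⟩)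
  exact fun A hA => ⟨_, fun B hB => hB.1, congrFun key ⟨A, hA⟩⟩

end Lattice

/-! ### Commuting diagonalizable automorphisms and the correspondence between `Gr` and `Diag`. -/

section Automorphisms

variable {K L L' : Type*} [Field K] [LieRing L] [LieAlgebra K L] [LieRing L'] [LieAlgebra K L']

/-- A commuting set of diagonalizable automorphisms. -/
structure IsCommDiag (G : Set (L ≃ₗ⁅K⁆ L)) : Prop where
  diagonalizable : ∀ g ∈ G, IsDiagonalizableAut g
  commute : ∀ f ∈ G, ∀ g ∈ G, CommuteAut f g

theorem IsMADGroup.isCommDiag {G : Set (L ≃ₗ⁅K⁆ L)} (h : IsMADGroup G) : IsCommDiag G :=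
  ⟨h.1, h.2⟩

/-- The joint eigenspaces of a set of automorphisms. -/
def jointEigenspace (G : Set (L ≃ₗ⁅K⁆ L)) (χ : G → K) : Submodule K L :=
  ⨅ g : G, Module.End.eigenspace (g.1 : L →ₗ[K] L) (χ g)

theorem mem_jointEigenspace {G : Set (L ≃ₗ⁅K⁆ L)} {χ : G → K} {x : L} :
    x ∈ jointEigenspace G χ ↔ ∀ g : G, g.1 x = χ g • x := by
  simp [jointEigenspace, Submodule.mem_iInf]

theorem isDiagonalizableAut_of_sSup {P : Set (Submodule K L)} (hP : sSup P = ⊤)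
    {g : L ≃ₗ⁅K⁆ L} (h : ∀ A ∈ P, ∃ α : K, ∀ x ∈ A, g x = α • x) : IsDiagonalizableAut g := by
  rw [IsDiagonalizableAut, eq_top_iff, ← hP]
  refine sSup_le fun A hA => ?_
  obtain ⟨α, hα⟩ := h A hA
  exact le_iSup_of_le α fun x hx => Module.End.mem_eigenspace_iff.mpr (hα x hx)

theorem IsDiagonalizableAut.induction {g : L ≃ₗ⁅K⁆ L} (hg : IsDiagonalizableAut g)
    {p : L → Prop} (h : ∀ (μ : K) (x : L), g x = μ • x → p x) (h0 : p 0)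
    (hadd : ∀ x y, p x → p y → p (x + y)) (x : L) : p x := by
  have hx : x ∈ ⨆ μ : K, Module.End.eigenspace (g : L →ₗ[K] L) μ := hg ▸ Submodule.mem_top
  induction hx using Submodule.iSup_induction' with
  | mem μ x hx => exact h μ x (Module.End.mem_eigenspace_iff.mp hx)
  | zero => exact h0
  | add x y _ _ hx hy => exact hadd x y hx hy

theorem mapsTo_maxGenEigenspace_of_commuteAut {f g : L ≃ₗ⁅K⁆ L} (h : CommuteAut f g) (μ : K) :
    Set.MapsTo (f : L →ₗ[K] L) (Module.End.maxGenEigenspace (g : L →ₗ[K] L) μ)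
      (Module.End.maxGenEigenspace (g : L →ₗ[K] L) μ) :=
  Module.End.mapsTo_maxGenEigenspace_of_comm (LinearMap.ext fun x => (h x).symm) μ

theorem eigenspace_le_maxGenEigenspace (f : Module.End K L) (μ : K) :
    f.eigenspace μ ≤ f.maxGenEigenspace μ :=
  (Module.End.genEigenspace f μ).monotone le_top

/-- Independence is inherited from the larger joint generalized eigenspaces. Spanning is not, which
is why `IsDiagonalizableAut.eigenspace_eq` is needed for `IsCommDiag.iSup_eq_top`. -/
theorem IsCommDiag.iSupIndep {G : Set (L ≃ₗ⁅K⁆ L)} (hG : IsCommDiag G) :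
    iSupIndep (jointEigenspace G) :=
  (Module.End.independent_iInf_maxGenEigenspace_of_forall_mapsTo
    (fun g : G => (g.1 : L →ₗ[K] L)) fun f g μ =>
      mapsTo_maxGenEigenspace_of_commuteAut (hG.commute f f.2 g g.2) μ).mono
    fun _ => iInf_mono fun _ => eigenspace_le_maxGenEigenspace _ _

/-- The eigenspaces already span and lie below the independent generalized eigenspaces, so there is
no room for a difference. -/
theorem IsDiagonalizableAut.eigenspace_eq {g : L ≃ₗ⁅K⁆ L} (hg : IsDiagonalizableAut g) (μ : K) :
    Module.End.eigenspace (g : L →ₗ[K] L) μ = Module.End.maxGenEigenspace (g : L →ₗ[K] L) μ :=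
  congrFun (Submodule.eq_of_le_of_iSupIndep (Module.End.independent_genEigenspace _ _)
    (eigenspace_le_maxGenEigenspace _) hg) μ

theorem IsCommDiag.iSup_eq_top [FiniteDimensional K L] {G : Set (L ≃ₗ⁅K⁆ L)}
    (hG : IsCommDiag G) : ⨆ χ, jointEigenspace G χ = ⊤ := by
  have := Module.End.iSup_iInf_maxGenEigenspace_eq_top_of_forall_mapsTo
    (fun g : G => (g.1 : L →ₗ[K] L)) (fun f g μ =>
      mapsTo_maxGenEigenspace_of_commuteAut (hG.commute f f.2 g g.2) μ) (fun g => by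
        rw [← (hG.diagonalizable g g.2 : _ = ⊤)]
        exact iSup_congr fun μ => ((hG.diagonalizable g g.2).eigenspace_eq μ).symm)
  rw [← this]
  exact iSup_congr fun χ => iInf_congr fun g => (hG.diagonalizable g g.2).eigenspace_eq _

theorem IsCommDiag.isDiagonalizableAut [FiniteDimensional K L] {G : Set (L ≃ₗ⁅K⁆ L)}
    (hG : IsCommDiag G) {h : L ≃ₗ⁅K⁆ L}
    (H : ∀ χ : G → K, ∃ α : K, ∀ x, (∀ g : G, g.1 x = χ g • x) → h x = α • x) :
    IsDiagonalizableAut h := by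
  refine isDiagonalizableAut_of_sSup (P := Set.range (jointEigenspace G)) ?_ ?_
  · rw [sSup_range, hG.iSup_eq_top]
  · rintro _ ⟨χ, rfl⟩
    obtain ⟨α, hα⟩ := H χ
    exact ⟨α, fun x hx => hα x (mem_jointEigenspace.mp hx)⟩

theorem IsCommDiag.trans [FiniteDimensional K L] {G : Set (L ≃ₗ⁅K⁆ L)}
    (hG : IsCommDiag G) {f g : L ≃ₗ⁅K⁆ L} (hf : f ∈ G) (hg : g ∈ G) :
    IsDiagonalizableAut (f.trans g) :=
  hG.isDiagonalizableAut fun χ => ⟨χ ⟨f, hf⟩ * χ ⟨g, hg⟩, fun x hx => by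
    rw [LieEquiv.trans_apply, hx ⟨f, hf⟩, map_smul, hx ⟨g, hg⟩, smul_smul]⟩

theorem eigenvalue_ne_zero {g : L ≃ₗ⁅K⁆ L} {x : L} (hx : x ≠ 0) {α : K} (h : g x = α • x) :
    α ≠ 0 := by
  rintro rfl
  rw [zero_smul] at h
  exact hx (g.injective (h.trans (map_zero g).symm))

theorem symm_apply_eq_inv_smul {g : L ≃ₗ⁅K⁆ L} {x : L} {α : K} (h : g x = α • x) :
    g.symm x = α⁻¹ • x := by
  rcases eq_or_ne x 0 with rfl | hx
  · simp
  · have hα := eigenvalue_ne_zero hx h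
    apply g.injective
    refine (g.apply_symm_apply x).trans ?_
    change x = g (α⁻¹ • x)
    rw [map_smul, h, smul_smul, inv_mul_cancel₀ hα, one_smul]

theorem IsDiagonalizableAut.symm {g : L ≃ₗ⁅K⁆ L} (hg : IsDiagonalizableAut g) :
    IsDiagonalizableAut g.symm := by
  refine isDiagonalizableAut_of_sSup
    (P := Set.range (Module.End.eigenspace (g : L →ₗ[K] L))) (by rw [sSup_range]; exact hg) ?_
  rintro _ ⟨μ, rfl⟩
  exact ⟨μ⁻¹, fun x hx => symm_apply_eq_inv_smul (Module.End.mem_eigenspace_iff.mp hx)⟩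

/-- Transport of a set of automorphisms along an isomorphism. -/
def conjAut (e : L ≃ₗ⁅K⁆ L') (G : Set (L ≃ₗ⁅K⁆ L)) : Set (L' ≃ₗ⁅K⁆ L') :=
  (fun g : L ≃ₗ⁅K⁆ L => (e.symm.trans g).trans e) '' G

/-- Transport of a set of subspaces along an isomorphism. -/
def mapGrading (e : L ≃ₗ⁅K⁆ L') (P : Set (Submodule K L)) : Set (Submodule K L') :=
  (fun A : Submodule K L => A.map (e : L →ₗ[K] L')) '' P

theorem conjAut_trans {L'' : Type*} [LieRing L''] [LieAlgebra K L''] (e : L ≃ₗ⁅K⁆ L')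
    (e' : L' ≃ₗ⁅K⁆ L'') (G : Set (L ≃ₗ⁅K⁆ L)) :
    conjAut (e.trans e') G = conjAut e' (conjAut e G) := by
  simp only [conjAut, Set.image_image]; rfl

theorem conjAut_symm (e : L ≃ₗ⁅K⁆ L') (G : Set (L ≃ₗ⁅K⁆ L)) :
    conjAut e.symm (conjAut e G) = G := by
  simp only [conjAut, Set.image_image]
  convert! Set.image_id G using 2
  ext g
  simp

theorem conjAut_mono (e : L ≃ₗ⁅K⁆ L') {G H : Set (L ≃ₗ⁅K⁆ L)} (h : G ⊆ H) :
    conjAut e G ⊆ conjAut e H := Set.image_mono h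

theorem mapGrading_symm (e : L ≃ₗ⁅K⁆ L') (P : Set (Submodule K L)) :
    mapGrading e.symm (mapGrading e P) = P := by
  simp only [mapGrading, Set.image_image]
  convert! Set.image_id P using 2
  rename_i A _
  refine Submodule.ext fun x => ?_
  simp only [Submodule.mem_map, id]
  constructor
  · rintro ⟨_, ⟨y, hy, rfl⟩, rfl⟩
    simpa using hy
  · exact fun hx => ⟨e x, ⟨x, hx, rfl⟩, by simp⟩

theorem mapGrading_symm' (e : L ≃ₗ⁅K⁆ L') (P : Set (Submodule K L')) :
    mapGrading e (mapGrading e.symm P) = P :=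
  mapGrading_symm e.symm P

theorem isDiagonalizableAut_conj (e : L ≃ₗ⁅K⁆ L') {g : L ≃ₗ⁅K⁆ L} (hg : IsDiagonalizableAut g) :
    IsDiagonalizableAut ((e.symm.trans g).trans e) := by
  refine isDiagonalizableAut_of_sSup (P := Set.range fun μ =>
    (Module.End.eigenspace (g : L →ₗ[K] L) μ).map (e : L →ₗ[K] L')) ?_ ?_
  · rw [sSup_range, ← Submodule.map_iSup, (hg : _ = ⊤), Submodule.map_top, LinearMap.range_eq_top]
    exact e.surjective
  · rintro _ ⟨μ, rfl⟩
    refine ⟨μ, ?_⟩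
    rintro _ ⟨x, hx, rfl⟩
    have : g x = μ • x := Module.End.mem_eigenspace_iff.mp hx
    simp [this]

theorem IsCommDiag.conjAut (e : L ≃ₗ⁅K⁆ L') {G : Set (L ≃ₗ⁅K⁆ L)} (hG : IsCommDiag G) :
    IsCommDiag (conjAut e G) := by
  refine ⟨?_, ?_⟩
  · rintro _ ⟨g, hg, rfl⟩
    exact isDiagonalizableAut_conj e (hG.1 g hg)
  · rintro _ ⟨f, hf, rfl⟩ _ ⟨g, hg, rfl⟩ x
    simp [hG.2 f hf g hg (e.symm x)]

theorem IsMADGroup.eq_of_subset {G H : Set (L ≃ₗ⁅K⁆ L)} (hG : IsMADGroup G) (hH : IsCommDiag H)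
    (h : G ⊆ H) : G = H :=
  h.antisymm fun g hg => hG.maximal g (hH.1 g hg) fun f hf => hH.2 g hg f (h hf)

theorem conj_mem_gradingDiag (e : L ≃ₗ⁅K⁆ L') {P : Set (Submodule K L)} {g : L ≃ₗ⁅K⁆ L}
    (hg : g ∈ gradingDiag P) : (e.symm.trans g).trans e ∈ gradingDiag (mapGrading e P) := by
  rintro _ ⟨A, hA, rfl⟩
  obtain ⟨α, hα⟩ := hg A hA
  refine ⟨α, ?_⟩
  rintro _ ⟨x, hx, rfl⟩
  simp [hα x hx]

theorem gradingDiag_mapGrading (e : L ≃ₗ⁅K⁆ L') (P : Set (Submodule K L)) :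
    gradingDiag (mapGrading e P) = conjAut e (gradingDiag P) := by
  refine Set.Subset.antisymm (fun g hg => ?_) ?_
  · have := conj_mem_gradingDiag e.symm hg
    rw [mapGrading_symm] at this
    refine ⟨_, this, ?_⟩
    ext x
    simp
  · rintro _ ⟨g, hg, rfl⟩
    exact conj_mem_gradingDiag e hg

theorem isCommDiag_gradingDiag {P : Set (Submodule K L)} (hP : sSup P = ⊤) :
    IsCommDiag (gradingDiag P) := by
  refine ⟨fun g hg => isDiagonalizableAut_of_sSup hP hg, fun f hf g hg x => ?_⟩
  have hx : x ∈ ⨆ A : P, A.1 := by rw [← sSup_eq_iSup', hP]; trivial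
  induction hx using Submodule.iSup_induction' with
  | mem A x hx =>
    obtain ⟨α, hα⟩ := hf A A.2
    obtain ⟨β, hβ⟩ := hg A A.2
    rw [hα x hx, hβ x hx, map_smul, map_smul, hα x hx, hβ x hx, smul_comm]
  | zero => simp
  | add x y _ _ hx hy => simp [hx, hy]

/-- `P` consists of nonzero subspaces that span `L` and are told apart by the automorphisms that
act as scalars on all of them. -/
structure IsSeparated (P : Set (Submodule K L)) : Prop where
  ne_bot : ∀ A ∈ P, A ≠ ⊥
  sSup_eq_top : sSup P = ⊤
  separates : ∀ A ∈ P, ∀ B ∈ P, A ≠ B → ∃ g ∈ gradingDiag P, ∃ α β : K, α ≠ β ∧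
    (∀ x ∈ A, g x = α • x) ∧ ∀ x ∈ B, g x = β • x

theorem IsSeparated.mapGrading (e : L ≃ₗ⁅K⁆ L') {P : Set (Submodule K L)} (hP : IsSeparated P) :
    IsSeparated (mapGrading e P) := by
  refine ⟨?_, ?_, ?_⟩
  · rintro _ ⟨A, hA, rfl⟩ h
    exact hP.1 A hA (Submodule.map_injective_of_injective e.injective (h.trans (Submodule.map_bot _).symm))
  · rw [_root_.mapGrading, sSup_image, ← iSup_subtype'', ← Submodule.map_iSup,
      ← sSup_eq_iSup', hP.2, Submodule.map_top, LinearMap.range_eq_top]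
    exact e.surjective
  · rintro _ ⟨A, hA, rfl⟩ _ ⟨B, hB, rfl⟩ hAB
    obtain ⟨g, hg, α, β, hαβ, hα, hβ⟩ := hP.3 A hA B hB fun h => hAB (by rw [h])
    refine ⟨_, conj_mem_gradingDiag e hg, α, β, hαβ, ?_, ?_⟩
    · rintro _ ⟨x, hx, rfl⟩
      simp [hα x hx]
    · rintro _ ⟨x, hx, rfl⟩
      simp [hβ x hx]

theorem scalar_unique {A : Submodule K L} (hA : A ≠ ⊥) {g : L ≃ₗ⁅K⁆ L} {α β : K}
    (hα : ∀ x ∈ A, g x = α • x) (hβ : ∀ x ∈ A, g x = β • x) : α = β := by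
  obtain ⟨x, hx, h0⟩ := A.ne_bot_iff.mp hA
  exact smul_left_injective K h0 ((hα x hx).symm.trans (hβ x hx))

/-- Each member lies in the joint eigenspace given by its own scalars, and separation makes these
scalar functions distinct. Independence of the joint eigenspaces then forces equality. -/
theorem IsSeparated.autGrading_gradingDiag {P : Set (Submodule K L)} (hP : IsSeparated P) :
    autGrading (gradingDiag P) = P := by
  classical
  -- The value 0 outside `P` is arbitrary: only the labels of members of `P` matter.
  let c : Submodule K L → gradingDiag P → K := fun A g =>
    if hA : A ∈ P then (g.2 A hA).choose else 0
  have hc : ∀ A ∈ P, ∀ g : gradingDiag P, ∀ x ∈ A, g.1 x = c A g • x := by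
    intro A hA g
    simp only [c, dif_pos hA]
    exact (g.2 A hA).choose_spec
  refine Submodule.setOf_ne_bot_eq_of_iSupIndep (isCommDiag_gradingDiag hP.2).iSupIndep
    hP.1 hP.2 (c := c) (fun A hA x hx => mem_jointEigenspace.mpr fun g => hc A hA g x hx) ?_
  intro A hA B hB h
  by_contra hAB
  obtain ⟨g, hg, α, β, hαβ, hα, hβ⟩ := hP.3 A hA B hB hAB
  apply hαβ
  rw [scalar_unique (hP.1 A hA) hα (hc A hA ⟨g, hg⟩), scalar_unique (hP.1 B hB) hβ (hc B hB ⟨g, hg⟩),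
    h]

/-- An automorphism commuting with `Diag P` preserves every joint eigenspace of it, that is, every
member of `P`. What remains to check is that preserving the members implies acting on them by
scalars. -/
theorem IsSeparated.isMADGroup {P : Set (Submodule K L)} (hP : IsSeparated P)
    (h : ∀ g : L ≃ₗ⁅K⁆ L, (∀ A ∈ P, ∀ x ∈ A, g x ∈ A) → g ∈ gradingDiag P) :
    IsMADGroup (gradingDiag P) := by
  have hD := isCommDiag_gradingDiag hP.2
  refine ⟨hD.1, hD.2, fun g _ hg => h g ?_⟩
  intro A hA
  have hA' := hA
  rw [← hP.autGrading_gradingDiag] at hA'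
  obtain ⟨-, χ, rfl⟩ := hA'
  intro x hx
  change x ∈ jointEigenspace _ χ at hx
  change g x ∈ jointEigenspace _ χ
  rw [mem_jointEigenspace] at hx ⊢
  intro f
  rw [← hg f f.2, hx f, map_smul]

/-- `Diag P` acts by scalars on each `B` in `Q`, so `B` lies in a joint eigenspace of `Diag P`. This
eigenspace is nonzero, hence a member of `P`. -/
theorem IsSeparated.refines {P Q : Set (Submodule K L)} (hP : IsSeparated P)
    (hQ : sSup Q = ⊤) (hne : ∀ B ∈ Q, B ≠ ⊥) (h : gradingDiag P ⊆ gradingDiag Q) :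
    Refines Q P := by
  have hD := isCommDiag_gradingDiag hP.2
  have hi : sSupIndep P := by
    rw [← hP.autGrading_gradingDiag]
    refine hD.iSupIndep.sSupIndep_range.mono ?_
    rintro _ ⟨-, χ, rfl⟩
    exact ⟨χ, rfl⟩
  refine refines_of_forall_le hi hQ fun B hB => ?_
  let χ : gradingDiag P → K := fun g => (h g.2 B hB).choose
  have hχ : B ≤ jointEigenspace _ χ := fun x hx =>
    mem_jointEigenspace.mpr fun g => (h g.2 B hB).choose_spec x hx
  refine ⟨_, ?_, hχ⟩
  refine hP.autGrading_gradingDiag.subset ?_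
  exact ⟨fun h0 => hne B hB (le_bot_iff.mp (hχ.trans h0.le)), χ, rfl⟩

end Automorphisms

/-! ### Group gradings over the complex numbers and their characters. -/

section GroupGradings

/-- The complex characters of an abelian group separate its elements. -/
theorem exists_complex_character_ne_one {G : Type*} [CommGroup G] {a : G} (ha : a ≠ 1) :
    ∃ χ : G → ℂ, (∀ g h, χ (g * h) = χ g * χ h) ∧ (∀ g, χ g ≠ 0) ∧ χ a ≠ 1 := by
  obtain ⟨c, hc⟩ := CharacterModule.exists_character_apply_ne_zero_of_ne_zero
    (A := Additive G) (a := Additive.ofMul a) (by simpa using ha)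
  -- The character `c` takes values in `ℚ / ℤ`, which embeds in `ℂˣ` by `q ↦ exp (2πiq)`.
  let e : ℚ →+ Additive ℂˣ :=
    { toFun := fun q => Additive.ofMul
        (Units.mk0 (Complex.exp (2 * Real.pi * Complex.I * q)) (Complex.exp_ne_zero _))
      map_zero' := by
        apply Additive.toMul.injective; ext; simp
      map_add' := fun x y => by
        apply Additive.toMul.injective; ext
        simp [mul_add, Complex.exp_add] }
  have he : ∀ q : ℚ, ((Additive.toMul (e q) : ℂˣ) : ℂ) =
      Complex.exp (2 * Real.pi * Complex.I * q) := fun q => rfl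
  have hle : AddSubgroup.zmultiples (1 : ℚ) ≤ e.ker := by
    rw [AddSubgroup.zmultiples_le, AddMonoidHom.mem_ker]
    apply Additive.toMul.injective
    ext
    rw [he]
    simp
  let f : AddCircle (1 : ℚ) →+ Additive ℂˣ := QuotientAddGroup.lift _ e hle
  refine ⟨fun g => ((Additive.toMul (f (c (Additive.ofMul g))) : ℂˣ) : ℂ), ?_, ?_, ?_⟩
  · intro g h
    beta_reduce
    rw [ofMul_mul, map_add, map_add, toMul_add, Units.val_mul]
  · exact fun g => Units.ne_zero _
  · intro h1
    obtain ⟨q, hq⟩ := QuotientAddGroup.mk_surjective (c (Additive.ofMul a))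
    beta_reduce at h1
    rw [← hq] at h1 hc
    have h2 : Complex.exp (2 * Real.pi * Complex.I * q) = 1 := h1
    rw [Complex.exp_eq_one_iff] at h2
    obtain ⟨n, hn⟩ := h2
    apply hc
    rw [QuotientAddGroup.eq_zero_iff, AddSubgroup.mem_zmultiples_iff]
    refine ⟨n, ?_⟩
    have : (q : ℂ) = n := by
      have h3 : (2 * Real.pi * Complex.I : ℂ) ≠ 0 := Complex.two_pi_I_ne_zero
      apply mul_left_cancel₀ h3
      rw [hn, mul_comm]
    have h4 : q = n := by exact_mod_cast this
    rw [h4]; simp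

variable {L L' : Type} [LieRing L] [LieAlgebra ℂ L] [LieRing L'] [LieAlgebra ℂ L']

/-- Brackets multiply eigenvalue functions. Eigenvalues of automorphisms on nonzero vectors are
nonzero, so these functions lie in the abelian group `G → ℂˣ`, which serves as the index group. -/
theorem IsCommDiag.isGroupGrading [FiniteDimensional ℂ L] {G : Set (L ≃ₗ⁅ℂ⁆ L)}
    (hG : IsCommDiag G) : IsGroupGrading (autGrading G) := by
  have hmul : ∀ {χ χ' : G → ℂ} {a b : L}, a ∈ jointEigenspace G χ → b ∈ jointEigenspace G χ' →
      ⁅a, b⁆ ∈ jointEigenspace G (χ * χ') := by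
    intro χ χ' a b ha hb
    rw [mem_jointEigenspace] at *
    intro g
    rw [LieEquiv.map_lie, ha g, hb g, smul_lie, lie_smul, smul_smul, Pi.mul_apply]
  refine ⟨⟨fun A hA => hA.1, ?_, ?_, ?_⟩, ?_⟩
  · refine hG.iSupIndep.sSupIndep_range.mono ?_
    rintro _ ⟨-, χ, rfl⟩
    exact ⟨χ, rfl⟩
  · rw [eq_top_iff, ← hG.iSup_eq_top]
    refine iSup_le fun χ => ?_
    by_cases h : jointEigenspace G χ = ⊥
    · rw [h]; exact bot_le
    · exact le_sSup ⟨h, χ, rfl⟩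
  · intro A hA B hB
    obtain ⟨-, χ, hχ⟩ := id hA
    obtain ⟨-, χ', hχ'⟩ := hB
    by_cases h : jointEigenspace G (χ * χ') = ⊥
    -- All brackets vanish here, so any member of the grading will do as target.
    · refine ⟨A, hA, fun a ha b hb => ?_⟩
      rw [hχ] at ha
      rw [hχ'] at hb
      have := hmul ha hb
      rw [h, Submodule.mem_bot] at this
      rw [this]
      exact zero_mem _
    · refine ⟨_, ⟨h, _, rfl⟩, fun a ha b hb => ?_⟩
      rw [hχ] at ha
      rw [hχ'] at hb
      exact hmul ha hb
  · have hex : ∀ A : autGrading G, ∃ χ : G → ℂˣ, A.1 = jointEigenspace G fun g => (χ g : ℂ) := by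
      rintro ⟨A, h0, χ, hχ⟩
      obtain ⟨x, hx, hx0⟩ := A.ne_bot_iff.mp h0
      rw [hχ] at hx
      exact ⟨fun g => Units.mk0 (χ g) (eigenvalue_ne_zero hx0 (mem_jointEigenspace.mp hx g)), hχ⟩
    choose d hd using hex
    refine ⟨G → ℂˣ, inferInstance, d, fun A B hAB => Subtype.ext (by rw [hd A, hd B, hAB]), ?_⟩
    rintro A B ⟨a, ha, b, hb, hab⟩
    have hm : ∀ a ∈ A.1, ∀ b ∈ B.1, ⁅a, b⁆ ∈ jointEigenspace G fun g => ((d A * d B) g : ℂ) := by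
      intro a ha b hb
      rw [hd A] at ha
      rw [hd B] at hb
      exact hmul ha hb
    have hne : jointEigenspace G (fun g => ((d A * d B) g : ℂ)) ≠ ⊥ := by
      intro h0
      have := hm a ha b hb
      rw [h0, Submodule.mem_bot] at this
      exact hab this
    refine ⟨⟨_, hne, _, rfl⟩, ?_, hm⟩
    -- The index of this subspace was picked by choice. It equals `d A * d B` because a nonzero
    -- vector determines its eigenvalues.
    have h1 := hd ⟨jointEigenspace G fun g => ((d A * d B) g : ℂ), hne, _, rfl⟩
    simp only at h1
    obtain ⟨x, hx, hx0⟩ := Submodule.ne_bot_iff _ |>.mp hne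
    have hx2 := hx
    rw [h1] at hx2
    rw [mem_jointEigenspace] at hx hx2
    funext g
    exact Units.ext (smul_left_injective ℂ hx0 ((hx2 g).symm.trans (hx g)))

theorem IsSeparated.isGroupGrading [FiniteDimensional ℂ L] {P : Set (Submodule ℂ L)}
    (hP : IsSeparated P) : IsGroupGrading P := by
  rw [← hP.autGrading_gradingDiag]
  exact (isCommDiag_gradingDiag hP.2).isGroupGrading

/-- A linear map acting by prescribed scalars on the members of an independent spanning set. -/
theorem exists_linearMap_smul {P : Set (Submodule ℂ L)} (hi : sSupIndep P) (ht : sSup P = ⊤)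
    (c : P → ℂ) : ∃ f : L →ₗ[ℂ] L, ∀ A : P, ∀ x ∈ A.1, f x = c A • x := by
  classical
  have hint : DirectSum.IsInternal (fun A : P => A.1) :=
    DirectSum.isInternal_submodule_of_iSupIndep_of_iSup_eq_top ((sSupIndep_iff P).mp hi)
      (by rw [← sSup_eq_iSup', ht])
  let e := LinearEquiv.ofBijective (DirectSum.coeLinearMap fun A : P => A.1) hint
  refine ⟨(DirectSum.toModule ℂ P L fun A => c A • A.1.subtype) ∘ₗ e.symm.toLinearMap, ?_⟩
  intro A x hx
  have : e.symm x = DirectSum.lof ℂ P (fun A => A.1) A ⟨x, hx⟩ := by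
    rw [LinearEquiv.symm_apply_eq]
    exact (DirectSum.coeLinearMap_lof (fun A : P => A.1) A ⟨x, hx⟩).symm
  simp [this]

theorem sSup_induction {P : Set (Submodule ℂ L)} (ht : sSup P = ⊤) {p : L → Prop}
    (h : ∀ A : P, ∀ x ∈ A.1, p x) (h0 : p 0) (hadd : ∀ x y, p x → p y → p (x + y)) (x : L) :
    p x := by
  have hx : x ∈ ⨆ A : P, A.1 := by rw [← sSup_eq_iSup', ht]; trivial
  induction hx using Submodule.iSup_induction' with
  | mem A x hx => exact h A x hx
  | zero => exact h0
  | add x y _ _ hx hy => exact hadd x y hx hy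

/-- A character `χ` of the index group acts on the member `A` by `χ (d A)`, with inverse given by
the inverse scalars, and multiplicativity makes this an automorphism. A character nontrivial on `d A
/ d B` separates `A` from `B`. -/
theorem IsGroupGrading.isSeparated {P : Set (Submodule ℂ L)} (hP : IsGroupGrading P) :
    IsSeparated P := by
  obtain ⟨hP, G, _, d, hd, hmul⟩ := hP
  have ht := hP.sSup_eq_top
  refine ⟨hP.1, ht, fun A hA B hB hAB => ?_⟩
  have hne : d ⟨A, hA⟩ / d ⟨B, hB⟩ ≠ 1 := fun h =>
    hAB (congrArg Subtype.val (hd (div_eq_one.mp h)))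
  obtain ⟨χ, hχ, h0, h1⟩ := exists_complex_character_ne_one hne
  obtain ⟨f, hf⟩ := exists_linearMap_smul hP.indep ht fun A => χ (d A)
  obtain ⟨f', hf'⟩ := exists_linearMap_smul hP.indep ht fun A => (χ (d A))⁻¹
  have hlie : ∀ x y, f ⁅x, y⁆ = ⁅f x, f y⁆ := by
    intro x y
    refine sSup_induction ht (p := fun x => f ⁅x, y⁆ = ⁅f x, f y⁆) (fun A x hx => ?_) (by simp)
      (fun x x' hx hx' => by simp only [add_lie, map_add, hx, hx']) x
    refine sSup_induction ht (p := fun y => f ⁅x, y⁆ = ⁅f x, f y⁆) (fun B y hy => ?_) (by simp)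
      (fun y y' hy hy' => by simp only [lie_add, map_add, hy, hy']) y
    rw [hf A x hx, hf B y hy, smul_lie, lie_smul, smul_smul]
    by_cases hxy : ⁅x, y⁆ = 0
    · rw [hxy, map_zero, smul_zero]
    · obtain ⟨C, hC, hC'⟩ := hmul A B ⟨x, hx, y, hy, hxy⟩
      rw [hf C _ (hC' x hx y hy), hC, hχ]
  have h12 : ∀ x, f' (f x) = x := sSup_induction ht (fun A x hx => by
      rw [hf A x hx, map_smul, hf' A x hx, smul_smul, mul_inv_cancel₀ (h0 _), one_smul])
    (by simp) (fun x y hx hy => by simp [hx, hy])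
  have h21 : ∀ x, f (f' x) = x := sSup_induction ht (fun A x hx => by
      rw [hf' A x hx, map_smul, hf A x hx, smul_smul, inv_mul_cancel₀ (h0 _), one_smul])
    (by simp) (fun x y hx hy => by simp [hx, hy])
  let g : L ≃ₗ⁅ℂ⁆ L :=
    { f with
      map_lie' := fun {x y} => hlie x y
      invFun := f'
      left_inv := h12
      right_inv := h21 }
  refine ⟨g, fun A hA => ⟨_, hf ⟨A, hA⟩⟩, _, _, ?_, hf ⟨A, hA⟩, hf ⟨B, hB⟩⟩
  intro h
  apply h1
  have := hχ (d ⟨A, hA⟩ / d ⟨B, hB⟩) (d ⟨B, hB⟩)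
  rw [div_mul_cancel, h] at this
  exact mul_right_cancel₀ (h0 _) (this.symm.trans (one_mul _).symm)

theorem Refines.map {P Q : Set (Submodule ℂ L)} (e : L ≃ₗ⁅ℂ⁆ L') (h : Refines Q P) :
    Refines (mapGrading e Q) (mapGrading e P) := by
  rintro _ ⟨A, hA, rfl⟩
  obtain ⟨S, hS, rfl⟩ := h A hA
  refine ⟨mapGrading e S, Set.image_mono hS, ?_⟩
  beta_reduce
  rw [mapGrading, sSup_image, sSup_eq_iSup, Submodule.map_iSup]
  exact iSup_congr fun A => (Submodule.map_iSup _ _).symm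

theorem IsFineGroupGrading.map [FiniteDimensional ℂ L] [FiniteDimensional ℂ L']
    {P : Set (Submodule ℂ L)} (e : L ≃ₗ⁅ℂ⁆ L') (h : IsFineGroupGrading P) :
    IsFineGroupGrading (mapGrading e P) := by
  refine ⟨(h.1.isSeparated.mapGrading e).isGroupGrading, fun Q hQ hQP => ?_⟩
  have h1 := hQP.map e.symm
  rw [mapGrading_symm] at h1
  have h2 := h.2 _ (hQ.isSeparated.mapGrading e.symm).isGroupGrading h1
  rw [← h2, mapGrading_symm']

/-- A nonzero subspace of a line is the line, so every refinement contains all the lines. They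
already span, which leaves no room for further members. -/
theorem IsLieGrading.isFineGrading {P : Set (Submodule ℂ L)} (hP : IsLieGrading P)
    (h : ∀ A ∈ P, Module.finrank ℂ A = 1) : IsFineGrading P := by
  refine ⟨hP, fun Q hQ hQP => ?_⟩
  refine eq_of_subset_of_sSupIndep hQ.indep hQ.ne_bot hP.sSup_eq_top fun A hA => ?_
  obtain ⟨S, hS, rfl⟩ := hQP A hA
  obtain ⟨B, hB, hB0⟩ : ∃ B ∈ S, B ≠ ⊥ := by
    by_contra! hne
    exact hP.ne_bot _ hA (sSup_eq_bot.mpr hne)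
  have hle : B ≤ sSup S := le_sSup hB
  have h1 := h _ hA
  have : FiniteDimensional ℂ (sSup S : Submodule ℂ L) :=
    Module.finite_of_finrank_pos (by omega)
  have : FiniteDimensional ℂ B := Submodule.finiteDimensional_of_le hle
  have hBpos : 0 < Module.finrank ℂ B := Nat.pos_of_ne_zero fun h0 => hB0 (Submodule.finrank_eq_zero.mp h0)
  rw [← Submodule.eq_of_le_of_finrank_le hle (by omega)]
  exact hS hB

theorem IsFineGrading.isFineGroupGrading {P : Set (Submodule ℂ L)} (hP : IsFineGrading P)
    (h : IsGroupGrading P) : IsFineGroupGrading P :=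
  ⟨h, fun Q hQ => hP.2 Q hQ.1⟩

/-- A fine group grading equals every separated grading whose diagonal group contains its own. -/
theorem IsFineGroupGrading.eq_of_gradingDiag_subset [FiniteDimensional ℂ L]
    {P Q : Set (Submodule ℂ L)} (hP : IsFineGroupGrading P) (hQ : IsSeparated Q)
    (h : gradingDiag P ⊆ gradingDiag Q) : Q = P :=
  hP.2 Q hQ.isGroupGrading (hP.1.isSeparated.refines hQ.2 hQ.1 h)

end GroupGradings

/-! ### The Lie algebra `sl(2, ℂ)` and its commuting diagonalizable automorphisms. -/

section Sl2

/-- The matrix `!![a, b; c, -a]` as an element of `sl(2, ℂ)`. -/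
def sl2Mk (a b c : ℂ) : Sl2C :=
  ⟨!![a, b; c, -a], by
    change _ ∈ LinearMap.ker _
    simp [Matrix.trace_fin_two]⟩

theorem exists_eq_sl2Mk (x : Sl2C) : ∃ a b c, x = sl2Mk a b c := by
  have h : x.1 ∈ LinearMap.ker (Matrix.traceLinearMap (Fin 2) ℂ ℂ) := x.2
  rw [LinearMap.mem_ker, Matrix.traceLinearMap_apply, Matrix.trace_fin_two] at h
  refine ⟨x.1 0 0, x.1 0 1, x.1 1 0, Subtype.ext ?_⟩
  ext i j
  fin_cases i <;> fin_cases j <;> simp [sl2Mk]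
  linear_combination h

theorem sl2Mk_inj {a b c a' b' c' : ℂ} :
    sl2Mk a b c = sl2Mk a' b' c' ↔ a = a' ∧ b = b' ∧ c = c' := by
  constructor
  · intro h
    have h' := congrArg Subtype.val h
    have h1 := congrFun (congrFun h' 0) 0
    have h2 := congrFun (congrFun h' 0) 1
    have h3 := congrFun (congrFun h' 1) 0
    simp [sl2Mk] at h1 h2 h3
    exact ⟨h1, h2, h3⟩
  · rintro ⟨rfl, rfl, rfl⟩; rfl

theorem sl2Mk_zero : sl2Mk 0 0 0 = 0 := by
  apply Subtype.ext
  ext i j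
  fin_cases i <;> fin_cases j <;> simp [sl2Mk]

theorem sl2Mk_eq_zero {a b c : ℂ} : sl2Mk a b c = 0 ↔ a = 0 ∧ b = 0 ∧ c = 0 := by
  rw [← sl2Mk_zero, sl2Mk_inj]

theorem sl2Mk_add (a b c a' b' c' : ℂ) :
    sl2Mk a b c + sl2Mk a' b' c' = sl2Mk (a + a') (b + b') (c + c') := by
  apply Subtype.ext
  ext i j
  fin_cases i <;> fin_cases j <;> simp [sl2Mk]
  ring

theorem sl2Mk_smul (t a b c : ℂ) : t • sl2Mk a b c = sl2Mk (t * a) (t * b) (t * c) := by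
  apply Subtype.ext
  ext i j
  fin_cases i <;> fin_cases j <;> simp [sl2Mk]

theorem sl2Mk_neg (a b c : ℂ) : -sl2Mk a b c = sl2Mk (-a) (-b) (-c) := by
  rw [← neg_one_smul ℂ, sl2Mk_smul]; simp

theorem sl2Mk_sub (a b c a' b' c' : ℂ) :
    sl2Mk a b c - sl2Mk a' b' c' = sl2Mk (a - a') (b - b') (c - c') := by
  rw [sub_eq_add_neg, sl2Mk_neg, sl2Mk_add]; rfl

theorem sl2Mk_lie (a b c a' b' c' : ℂ) : ⁅sl2Mk a b c, sl2Mk a' b' c'⁆ =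
    sl2Mk (b * c' - c * b') (2 * (a * b' - b * a')) (2 * (c * a' - a * c')) := by
  apply Subtype.ext
  rw [LieAlgebra.SpecialLinear.sl_bracket]
  ext i j
  fin_cases i <;> fin_cases j <;> simp [sl2Mk] <;> ring

theorem sl2_add_apply (x y : Sl2C) (i j : Fin 2) : (x + y).1 i j = x.1 i j + y.1 i j := rfl

theorem sl2_smul_apply (t : ℂ) (x : Sl2C) (i j : Fin 2) : (t • x).1 i j = t * x.1 i j := rfl

theorem sl2Mk_eq_sum (a b c : ℂ) :
    sl2Mk a b c = a • sl2Mk 1 0 0 + b • sl2Mk 0 1 0 + c • sl2Mk 0 0 1 := by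
  simp [sl2Mk_smul, sl2Mk_add]

/-- A Lie algebra endomorphism of `sl(2, ℂ)` is zero or injective. -/
theorem sl2_hom_eq_zero_or_injective (φ : Sl2C →ₗ⁅ℂ⁆ Sl2C) :
    (∀ x, φ x = 0) ∨ Function.Injective φ := by
  by_cases hinj : ∀ x, φ x = 0 → x = 0
  · exact Or.inr ((injective_iff_map_eq_zero φ).mpr hinj)
  left
  push Not at hinj
  obtain ⟨x, hx, hx0⟩ := hinj
  obtain ⟨a, b, c, rfl⟩ := exists_eq_sl2Mk x
  have hl : ∀ y z : Sl2C, φ z = 0 → φ ⁅y, z⁆ = 0 := fun y z hz => by rw [LieHom.map_lie, hz, lie_zero]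
  have hr : ∀ y z : Sl2C, φ z = 0 → φ ⁅z, y⁆ = 0 := fun y z hz => by rw [LieHom.map_lie, hz, zero_lie]
  have hs : ∀ (t : ℂ) (z : Sl2C), t ≠ 0 → φ (t • z) = 0 → φ z = 0 := fun t z ht h => by
    rw [map_smul] at h
    exact (smul_eq_zero.mp h).resolve_left ht
  have hall : φ (sl2Mk 1 0 0) = 0 → ∀ x, φ x = 0 := by
    intro h
    have he : φ (sl2Mk 0 1 0) = 0 := hs 2 _ two_ne_zero (by
      have := hr (sl2Mk 0 1 0) _ h
      simp only [sl2Mk_lie] at this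
      simp only [sl2Mk_smul]
      ring_nf at this ⊢
      exact this)
    have hf : φ (sl2Mk 0 0 1) = 0 := hs (-2) _ (by norm_num) (by
      have := hr (sl2Mk 0 0 1) _ h
      simp only [sl2Mk_lie] at this
      simp only [sl2Mk_smul]
      ring_nf at this ⊢
      exact this)
    intro x
    obtain ⟨a, b, c, rfl⟩ := exists_eq_sl2Mk x
    rw [sl2Mk_eq_sum]
    simp only [map_add, map_smul, h, he, hf]
    simp
  -- The kernel is an ideal. Bracketing `x` twice with the raising matrix and once with the lowering
  -- one isolates `c`, up to a factor 2, on the diagonal; exchanging the two matrices isolates `b`.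
  -- Hence the kernel contains the diagonal generator, and with it everything.
  by_cases hc : c = 0
  · by_cases hb : b = 0
    · subst hc hb
      have ha : a ≠ 0 := by rintro rfl; exact hx0 sl2Mk_zero
      exact hall (hs a _ ha (by simpa [sl2Mk_smul] using hx))
    · refine hall (hs (2 * b) _ (by simpa) ?_)
      have := hl (sl2Mk 0 1 0) _ (hl (sl2Mk 0 0 1) _ (hl (sl2Mk 0 0 1) _ hx))
      have h2 := hs (-1) (sl2Mk (2 * b) 0 0) (by norm_num)
      simp only [sl2Mk_lie, sl2Mk_smul] at this h2 ⊢
      ring_nf at this h2 ⊢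
      exact h2 this
  · refine hall (hs (2 * c) _ (by simpa) ?_)
    have := hl (sl2Mk 0 0 1) _ (hl (sl2Mk 0 1 0) _ (hl (sl2Mk 0 1 0) _ hx))
    simp only [sl2Mk_lie, sl2Mk_smul] at this ⊢
    ring_nf at this ⊢
    exact this

theorem sl2_center {x : Sl2C} (h : ∀ y : Sl2C, ⁅y, x⁆ = 0) : x = 0 := by
  obtain ⟨a, b, c, rfl⟩ := exists_eq_sl2Mk x
  have h1 := h (sl2Mk 1 0 0)
  have h2 := h (sl2Mk 0 1 0)
  simp [sl2Mk_lie, sl2Mk_eq_zero] at h1 h2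
  rw [sl2Mk_eq_zero]
  exact ⟨h2.2, h1.1, h1.2⟩

/-- Every Lie algebra endomorphism of `sl(2, ℂ)` that is injective is an automorphism. -/
theorem exists_lieEquiv_of_injective (φ : Sl2C →ₗ⁅ℂ⁆ Sl2C) (h : Function.Injective φ) :
    ∃ e : Sl2C ≃ₗ⁅ℂ⁆ Sl2C, ∀ x, e x = φ x :=
  ⟨LieEquiv.ofBijective φ ⟨h, (LinearMap.injective_iff_surjective (f := (φ : Sl2C →ₗ[ℂ] Sl2C))).mp h⟩,
    fun _ => rfl⟩

/-- The automorphism of `sl(2, ℂ)` determined by a standard triple. -/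
theorem exists_lieEquiv_of_triple {h e f : Sl2C} (h0 : h ≠ 0) (hef : ⁅e, f⁆ = h)
    (hhe : ⁅h, e⁆ = (2 : ℂ) • e) (hhf : ⁅h, f⁆ = (-2 : ℂ) • f) :
    ∃ c : Sl2C ≃ₗ⁅ℂ⁆ Sl2C, ∀ r s t, c (sl2Mk r s t) = r • h + s • e + t • f := by
  have hfe : ⁅f, e⁆ = -h := by rw [← hef, lie_skew]
  have heh : ⁅e, h⁆ = (-2 : ℂ) • e := by rw [← lie_skew, hhe, neg_smul]
  have hfh : ⁅f, h⁆ = (2 : ℂ) • f := by rw [← lie_skew, hhf, neg_smul, neg_neg]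
  let φ : Sl2C →ₗ⁅ℂ⁆ Sl2C :=
    { toFun := fun x => x.1 0 0 • h + x.1 0 1 • e + x.1 1 0 • f
      map_add' := fun x y => by
        simp only [sl2_add_apply, add_smul]; abel
      map_smul' := fun a x => by
        simp only [sl2_smul_apply, mul_smul, smul_add,
          RingHom.id_apply]
      map_lie' := fun {x y} => by
        obtain ⟨a, b, c, rfl⟩ := exists_eq_sl2Mk x
        obtain ⟨a', b', c', rfl⟩ := exists_eq_sl2Mk y
        rw [sl2Mk_lie]
        simp only [sl2Mk, Matrix.of_apply, Matrix.cons_val', Matrix.cons_val_zero,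
          Matrix.cons_val_one, add_lie, lie_add, smul_lie, lie_smul, lie_self, hef, hhe, hhf, hfe,
          heh, hfh, Matrix.cons_val_fin_one]
        module }
  have hφ : ∀ r s t, φ (sl2Mk r s t) = r • h + s • e + t • f := fun r s t => by
    change (sl2Mk r s t).1 0 0 • h + (sl2Mk r s t).1 0 1 • e + (sl2Mk r s t).1 1 0 • f = _
    simp [sl2Mk]
  -- Simplicity replaces a check that the triple is linearly independent: `h ≠ 0` suffices.
  have hinj : Function.Injective φ := by
    refine (sl2_hom_eq_zero_or_injective φ).resolve_left fun h' => h0 ?_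
    have := h' (sl2Mk 1 0 0)
    rw [hφ] at this
    simpa using this
  obtain ⟨c, hc⟩ := exists_lieEquiv_of_injective φ hinj
  exact ⟨c, fun r s t => (hc _).trans (hφ r s t)⟩

/-- The trace form of `sl(2, ℂ)`. -/
noncomputable def sl2Form : LinearMap.BilinForm ℂ Sl2C :=
  LinearMap.mk₂ ℂ (fun x y => 2 * (x.1 0 0 * y.1 0 0) + x.1 0 1 * y.1 1 0 + x.1 1 0 * y.1 0 1)
    (fun x x' y => by simp only [sl2_add_apply]; ring)
    (fun t x y => by
      simp only [sl2_smul_apply, smul_eq_mul]; ring)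
    (fun x y y' => by simp only [sl2_add_apply]; ring)
    (fun t x y => by
      simp only [sl2_smul_apply, smul_eq_mul]; ring)

theorem sl2Form_mk (a b c a' b' c' : ℂ) :
    sl2Form (sl2Mk a b c) (sl2Mk a' b' c') = 2 * (a * a') + b * c' + c * b' := by
  simp [sl2Form, sl2Mk]

theorem sl2Form_comm (x y : Sl2C) : sl2Form x y = sl2Form y x := by
  obtain ⟨a, b, c, rfl⟩ := exists_eq_sl2Mk x
  obtain ⟨a', b', c', rfl⟩ := exists_eq_sl2Mk y
  simp only [sl2Form_mk]; ring

/-- This is the double cross product formula. It expresses the form through the bracket, which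
yields invariance of the form under automorphisms and the relations of the triples constructed
below. -/
theorem sl2_lie_lie (x y : Sl2C) :
    ⁅x, ⁅x, y⁆⁆ = (2 * sl2Form x x) • y - (2 * sl2Form x y) • x := by
  obtain ⟨a, b, c, rfl⟩ := exists_eq_sl2Mk x
  obtain ⟨a', b', c', rfl⟩ := exists_eq_sl2Mk y
  simp only [sl2Form_mk, sl2Mk_lie, sl2Mk_smul, sl2Mk_sub, sl2Mk_inj]
  refine ⟨?_, ?_, ?_⟩ <;> ring

theorem sl2Form_eq_zero {x : Sl2C} (h : ∀ y, sl2Form x y = 0) : x = 0 := by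
  obtain ⟨a, b, c, rfl⟩ := exists_eq_sl2Mk x
  have h1 := h (sl2Mk 1 0 0)
  have h2 := h (sl2Mk 0 1 0)
  have h3 := h (sl2Mk 0 0 1)
  simp [sl2Form_mk] at h1 h2 h3
  simp [h1, h2, h3, sl2Mk_zero]

/-- Automorphisms preserve the trace form. -/
theorem sl2Form_map (g : Sl2C ≃ₗ⁅ℂ⁆ Sl2C) (x y : Sl2C) : sl2Form (g x) (g y) = sl2Form x y := by
  have hdiag : ∀ x, sl2Form (g x) (g x) = sl2Form x x := by
    intro x
    by_cases hx : x = 0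
    · simp [hx]
    -- With `y` not proportional to `x`, the coefficient of `y` in the double bracket formula is
    -- well defined and can be compared before and after applying `g`.
    obtain ⟨y, hy⟩ : ∃ y, ∀ s t : ℂ, s • y = t • x → s = 0 := by
      obtain ⟨a, b, c, rfl⟩ := exists_eq_sl2Mk x
      rw [sl2Mk_eq_zero] at hx
      by_cases ha : a = 0
      · refine ⟨sl2Mk 1 0 0, fun s t h => ?_⟩
        simp only [sl2Mk_smul, sl2Mk_inj] at h
        simpa [ha] using h.1
      · refine ⟨sl2Mk 0 1 0, fun s t h => ?_⟩
        simp only [sl2Mk_smul, sl2Mk_inj] at h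
        have ht : t = 0 := by simpa [ha] using h.1
        simpa [ht] using h.2.1
    have h1 := congrArg g (sl2_lie_lie x y)
    rw [LieEquiv.map_lie, LieEquiv.map_lie, sl2_lie_lie, map_sub, map_smul, map_smul] at h1
    have h2 : g ((sl2Form (g x) (g x) - sl2Form x x) • y) =
        g ((sl2Form (g x) (g y) - sl2Form x y) • x) := by
      rw [map_smul, map_smul]
      have h3 := congrArg (fun z => (1 / 2 : ℂ) • z) h1
      simp only [smul_sub, smul_smul, ← mul_assoc] at h3
      norm_num at h3
      rw [sub_smul, sub_smul, sub_eq_sub_iff_add_eq_add]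
      rw [sub_eq_sub_iff_add_eq_add] at h3
      rw [h3]; abel
    exact sub_eq_zero.mp (hy _ _ (g.injective h2))
  -- Polarization.
  have h := hdiag (x + y)
  simp only [map_add, LinearMap.add_apply, hdiag] at h
  rw [sl2Form_comm (g y), sl2Form_comm y x] at h
  linear_combination h / 2

/-- The basis of `sl(2, ℂ)` underlying the Cartan grading. -/
def cartanVec : Fin 3 → Sl2C := ![sl2Mk 1 0 0, sl2Mk 0 1 0, sl2Mk 0 0 1]

/-- The basis of `sl(2, ℂ)` underlying the Pauli grading. -/
def pauliVec : Fin 3 → Sl2C := ![sl2Mk 1 0 0, sl2Mk 0 1 1, sl2Mk 0 1 (-1)]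

/-- The automorphisms that act diagonally on a family of vectors. -/
def diagAut (b : Fin 3 → Sl2C) : Set (Sl2C ≃ₗ⁅ℂ⁆ Sl2C) :=
  {g | ∀ k, ∃ α : ℂ, g (b k) = α • b k}

theorem conjAut_symm_subset_diagAut {b : Fin 3 → Sl2C} {H : Set (Sl2C ≃ₗ⁅ℂ⁆ Sl2C)}
    {c : Sl2C ≃ₗ⁅ℂ⁆ Sl2C} (h : ∀ g ∈ H, ∀ k, ∃ α : ℂ, g (c (b k)) = α • c (b k)) :
    conjAut c.symm H ⊆ diagAut b := by
  rintro _ ⟨g, hg, rfl⟩ k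
  obtain ⟨α, hα⟩ := h g hg k
  refine ⟨α, ?_⟩
  change c.symm (g (c (b k))) = _
  rw [hα, map_smul, LieEquiv.symm_apply_apply]

/-- By invariance of the form, an eigenvector `x` of `m` with `μ² ≠ 1` is isotropic, and an
eigenvector `y` not orthogonal to it has eigenvalue `μ⁻¹` and is isotropic too. After rescaling,
`x`, `y` and `⁅x, y⁆` form a standard triple on which `m` has the distinct eigenvalues `μ`, `μ⁻¹`
and 1. Everything commuting with `m` preserves these three eigenlines. -/
theorem exists_conjAut_subset_cartan {H : Set (Sl2C ≃ₗ⁅ℂ⁆ Sl2C)} (hH : IsCommDiag H)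
    {m : Sl2C ≃ₗ⁅ℂ⁆ Sl2C} (hm : m ∈ H) {x : Sl2C} (hx : m (m x) ≠ x) :
    ∃ c : Sl2C ≃ₗ⁅ℂ⁆ Sl2C, conjAut c H ⊆ diagAut cartanVec := by
  have hmd := hH.1 m hm
  obtain ⟨μ, x, hμ, hx⟩ : ∃ (μ : ℂ) (x : Sl2C), m x = μ • x ∧ m (m x) ≠ x := by
    by_contra! h
    exact hx (hmd.induction h (by simp) (fun x y hx hy => by simp [hx, hy]) x)
  have hμ2 : μ * μ ≠ 1 := by
    intro h
    apply hx
    rw [hμ, map_smul, hμ, smul_smul, h, one_smul]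
  have hx0 : x ≠ 0 := by rintro rfl; simp at hx
  have hμ0 : μ ≠ 0 := eigenvalue_ne_zero hx0 hμ
  have hxx : sl2Form x x = 0 := by
    have := sl2Form_map m x x
    simp only [hμ, map_smul, LinearMap.smul_apply, smul_eq_mul] at this
    have h2 : (μ * μ - 1) * sl2Form x x = 0 := by linear_combination this
    exact (mul_eq_zero.mp h2).resolve_left (sub_ne_zero.mpr hμ2)
  obtain ⟨ν, y, hν, hxy⟩ : ∃ (ν : ℂ) (y : Sl2C), m y = ν • y ∧ sl2Form x y ≠ 0 := by
    by_contra! h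
    exact hx0 (sl2Form_eq_zero (hmd.induction h (by simp) fun y z hy hz => by simp [hy, hz]))
  have hμν : μ * ν = 1 := by
    have := sl2Form_map m x y
    simp only [hμ, hν, map_smul, LinearMap.smul_apply, smul_eq_mul] at this
    have h2 : (μ * ν - 1) * sl2Form x y = 0 := by linear_combination this
    exact sub_eq_zero.mp ((mul_eq_zero.mp h2).resolve_right hxy)
  have hyy : sl2Form y y = 0 := by
    have := sl2Form_map m y y
    simp only [hν, map_smul, LinearMap.smul_apply, smul_eq_mul] at this
    have h2 : (ν * ν - 1) * sl2Form y y = 0 := by linear_combination this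
    refine (mul_eq_zero.mp h2).resolve_left fun h3 => hμ2 ?_
    linear_combination (1 + μ * ν) * hμν - μ * μ * h3
  obtain ⟨y, hν, hxy, hyy⟩ : ∃ y, m y = ν • y ∧ sl2Form x y = 1 ∧ sl2Form y y = 0 :=
    ⟨(sl2Form x y)⁻¹ • y, by rw [map_smul, hν, smul_comm], by simp [hxy], by simp [hyy]⟩
  have hhe : ⁅⁅x, y⁆, x⁆ = (2 : ℂ) • x := by
    rw [← lie_skew, sl2_lie_lie, hxx, hxy]; module
  have hhf : ⁅⁅x, y⁆, y⁆ = (-2 : ℂ) • y := by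
    rw [← lie_skew, ← lie_skew x y, lie_neg, neg_neg, sl2_lie_lie, hyy, sl2Form_comm, hxy]; module
  obtain ⟨c, hc⟩ := exists_lieEquiv_of_triple (h := ⁅x, y⁆) (e := x) (f := y) (by
    intro h
    rw [h, zero_lie] at hhe
    exact hx0 ((smul_eq_zero.mp hhe.symm).resolve_left two_ne_zero)) rfl hhe hhf
  have hmc : ∀ r s t, m (c (sl2Mk r s t)) = c (sl2Mk r (μ * s) (ν * t)) := by
    intro r s t
    rw [hc, hc]
    simp only [map_add, map_smul, LieEquiv.map_lie, hμ, hν, smul_lie, lie_smul, smul_smul]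
    rw [mul_comm ν μ, hμν, mul_one, mul_comm s, mul_comm t]
  have hμ1 : μ ≠ 1 := by rintro rfl; simp at hμ2
  have hν1 : ν ≠ 1 := by rintro rfl; exact hμ1 (by simpa using hμν)
  have hμν' : μ ≠ ν := by rintro rfl; exact hμ2 hμν
  refine ⟨c.symm, conjAut_symm_subset_diagAut fun g hg => ?_⟩
  have key : ∀ k : Fin 3, ∀ lam : ℂ, m (c (cartanVec k)) = lam • c (cartanVec k) →
      (∀ r s t, sl2Mk r (μ * s) (ν * t) = lam • sl2Mk r s t → ∃ α : ℂ, sl2Mk r s t = α • cartanVec k) →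
      ∃ α : ℂ, g (c (cartanVec k)) = α • c (cartanVec k) := by
    intro k lam h1 h2
    obtain ⟨r, s, t, h⟩ := exists_eq_sl2Mk (c.symm (g (c (cartanVec k))))
    have h' : g (c (cartanVec k)) = c (sl2Mk r s t) := by rw [← h, LieEquiv.apply_symm_apply]
    have h3 : m (g (c (cartanVec k))) = lam • g (c (cartanVec k)) := by
      rw [hH.2 m hm g hg, h1, map_smul]
    rw [h', hmc, ← map_smul] at h3
    obtain ⟨α, hα⟩ := h2 r s t (c.injective h3)
    exact ⟨α, by rw [h', hα, map_smul]⟩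
  intro k
  fin_cases k
  · refine key 0 1 (by simp [cartanVec, hmc]) fun r s t h => ⟨r, ?_⟩
    simp only [sl2Mk_smul, sl2Mk_inj] at h
    have hs : s = 0 := by
      have : (μ - 1) * s = 0 := by linear_combination h.2.1
      exact (mul_eq_zero.mp this).resolve_left (sub_ne_zero.mpr hμ1)
    have ht : t = 0 := by
      have : (ν - 1) * t = 0 := by linear_combination h.2.2
      exact (mul_eq_zero.mp this).resolve_left (sub_ne_zero.mpr hν1)
    simp [cartanVec, sl2Mk_smul, hs, ht]
  · refine key 1 μ (by simp [cartanVec, hmc, ← map_smul, sl2Mk_smul]) fun r s t h => ⟨s, ?_⟩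
    simp only [sl2Mk_smul, sl2Mk_inj] at h
    have hr : r = 0 := by
      have : (μ - 1) * r = 0 := by linear_combination -h.1
      exact (mul_eq_zero.mp this).resolve_left (sub_ne_zero.mpr hμ1)
    have ht : t = 0 := by
      have : (μ - ν) * t = 0 := by linear_combination -h.2.2
      exact (mul_eq_zero.mp this).resolve_left (sub_ne_zero.mpr hμν')
    simp [cartanVec, sl2Mk_smul, hr, ht]
  · refine key 2 ν (by simp [cartanVec, hmc, ← map_smul, sl2Mk_smul]) fun r s t h => ⟨t, ?_⟩
    simp only [sl2Mk_smul, sl2Mk_inj] at h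
    have hr : r = 0 := by
      have : (ν - 1) * r = 0 := by linear_combination -h.1
      exact (mul_eq_zero.mp this).resolve_left (sub_ne_zero.mpr hν1)
    have hs : s = 0 := by
      have : (μ - ν) * s = 0 := by linear_combination h.2.1
      exact (mul_eq_zero.mp this).resolve_left (sub_ne_zero.mpr hμν')
    simp [cartanVec, sl2Mk_smul, hr, hs]

/-- Invariance gives `χ χ' = 1`, and the eigenvalues of involutions are signs. So different joint
eigenspaces are orthogonal. -/
theorem eq_of_sl2Form_ne_zero {H : Set (Sl2C ≃ₗ⁅ℂ⁆ Sl2C)} (hsq : ∀ m ∈ H, ∀ x, m (m x) = x)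
    {χ χ' : H → ℂ} {x y : Sl2C} (hx : x ∈ jointEigenspace H χ) (hy : y ∈ jointEigenspace H χ')
    (hxy : sl2Form x y ≠ 0) : χ = χ' := by
  rw [mem_jointEigenspace] at hx hy
  funext g
  have h1 := sl2Form_map g.1 x y
  simp only [hx g, hy g, map_smul, LinearMap.smul_apply, smul_eq_mul] at h1
  have h2 : χ g * χ' g = 1 := by
    have : (χ g * χ' g - 1) * sl2Form x y = 0 := by linear_combination h1
    exact sub_eq_zero.mp ((mul_eq_zero.mp this).resolve_right hxy)
  have hy0 : y ≠ 0 := by rintro rfl; simp at hxy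
  have h3 : χ' g * χ' g = 1 := by
    have h4 := hsq g.1 g.2 y
    rw [hy g, map_smul, hy g, smul_smul] at h4
    exact smul_left_injective ℂ hy0 (h4.trans (one_smul ℂ y).symm)
  linear_combination χ' g * h2 - χ g * h3

/-- In the orthogonal complement of a joint eigenvector `u` of a commuting set of involutions that
is zero or not isotropic, there is a joint eigenvector that is not isotropic. -/
theorem exists_jointEigenvector {H : Set (Sl2C ≃ₗ⁅ℂ⁆ Sl2C)} (hH : IsCommDiag H)
    (hsq : ∀ m ∈ H, ∀ x, m (m x) = x) {χ : H → ℂ} {u : Sl2C} (hu : u ∈ jointEigenspace H χ)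
    (hu0 : u = 0 ∨ sl2Form u u ≠ 0) :
    ∃ (χ' : H → ℂ) (v : Sl2C), v ∈ jointEigenspace H χ' ∧ sl2Form u v = 0 ∧ sl2Form v v ≠ 0 := by
  by_contra! hcon
  -- The orthogonal projection onto the complement of `u`. Since `0⁻¹ = 0`, it is the identity when
  -- `u = 0`, so both cases run together.
  let π : Sl2C →ₗ[ℂ] Sl2C := LinearMap.id - ((sl2Form u u)⁻¹ • (sl2Form u)).smulRight u
  have hπ : ∀ x, π x = x - ((sl2Form u u)⁻¹ * sl2Form u x) • u := fun x => by simp [π]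
  have hπu : ∀ x, sl2Form u (π x) = 0 := by
    intro x
    rw [hπ]
    rcases hu0 with rfl | h
    · simp
    · simp [h, mul_right_comm]
  have hπm : ∀ (χ' : H → ℂ) (x : Sl2C), x ∈ jointEigenspace H χ' → π x ∈ jointEigenspace H χ' := by
    intro χ' x hx
    rw [hπ]
    by_cases h : sl2Form u x = 0
    · simpa [h] using hx
    · have := eq_of_sl2Form_ne_zero hsq hu hx h
      subst this
      exact sub_mem hx (Submodule.smul_mem _ _ hu)
  -- Projections with different characters are orthogonal. Within one joint eigenspace every
  -- projected vector is isotropic by assumption, and polarization finishes.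
  have h0 : ∀ (χ₁ χ₂ : H → ℂ) (x y : Sl2C), x ∈ jointEigenspace H χ₁ → y ∈ jointEigenspace H χ₂ →
      sl2Form (π x) (π y) = 0 := by
    intro χ₁ χ₂ x y hx hy
    by_contra hne
    have := eq_of_sl2Form_ne_zero hsq (hπm _ _ hx) (hπm _ _ hy) hne
    subst this
    have h1 := hcon _ _ (hπm _ _ hx) (hπu x)
    have h2 := hcon _ _ (hπm _ _ hy) (hπu y)
    have h3 := hcon _ _ (hπm _ _ (add_mem hx hy)) (hπu _)
    simp only [map_add, LinearMap.add_apply, h1, h2, sl2Form_comm (π y) (π x)] at h3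
    apply hne
    linear_combination h3 / 2
  have h1 : ∀ x y, sl2Form (π x) (π y) = 0 := by
    intro x y
    have htop := hH.iSup_eq_top
    have hx : x ∈ ⨆ χ, jointEigenspace H χ := htop ▸ Submodule.mem_top
    have hy : y ∈ ⨆ χ, jointEigenspace H χ := htop ▸ Submodule.mem_top
    induction hx using Submodule.iSup_induction' with
    | mem χ₁ x hx =>
      induction hy using Submodule.iSup_induction' with
      | mem χ₂ y hy => exact h0 _ _ _ _ hx hy
      | zero => simp
      | add y y' _ _ hy hy' => simp [hy, hy']
    | zero => simp
    | add x x' _ _ hx hx' => simp [hx, hx']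
  -- The form vanishes on the image of `π`. For `u = 0` the form itself would vanish; otherwise it
  -- would have rank one, which the two nilpotent basis matrices refute.
  rcases hu0 with rfl | hu0
  · have := h1 (sl2Mk 1 0 0) (sl2Mk 1 0 0)
    simp [hπ, sl2Form_mk] at this
  · have h2 : ∀ x y, sl2Form x y * sl2Form u u = sl2Form u x * sl2Form u y := by
      intro x y
      have := h1 x y
      have h3 := hπu x
      rw [hπ y, map_sub, map_smul, sl2Form_comm (π x) u, h3, smul_zero, sub_zero, hπ x, map_sub,
        LinearMap.sub_apply, map_smul, LinearMap.smul_apply, smul_eq_mul] at this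
      field_simp at this
      linear_combination this
    obtain ⟨a, b, c, rfl⟩ := exists_eq_sl2Mk u
    have h3 := h2 (sl2Mk 0 1 0) (sl2Mk 0 1 0)
    have h4 := h2 (sl2Mk 0 0 1) (sl2Mk 0 0 1)
    have h5 := h2 (sl2Mk 0 1 0) (sl2Mk 0 0 1)
    simp [sl2Form_mk] at h3 h4 h5 hu0
    simp_all

theorem exists_smul_sl2Form_eq_two {x : Sl2C} (hx : sl2Form x x ≠ 0) :
    ∃ t : ℂ, sl2Form (t • x) (t • x) = 2 := by
  obtain ⟨t, ht⟩ := IsAlgClosed.exists_eq_mul_self (2 / sl2Form x x)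
  refine ⟨t, ?_⟩
  simp only [map_smul, LinearMap.smul_apply, smul_eq_mul, ← mul_assoc, ← ht]
  field_simp

/-- Two orthogonal non-isotropic joint eigenvectors `u`, `v` exist, and `⁅u, v⁆` is then a third
joint eigenvector. Scaled to norm 2, they play the roles of the first two Pauli vectors, and half
their bracket plays that of the third. -/
theorem exists_conjAut_subset_pauli {H : Set (Sl2C ≃ₗ⁅ℂ⁆ Sl2C)} (hH : IsCommDiag H)
    (hsq : ∀ m ∈ H, ∀ x, m (m x) = x) :
    ∃ c : Sl2C ≃ₗ⁅ℂ⁆ Sl2C, conjAut c H ⊆ diagAut pauliVec := by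
  obtain ⟨χ, u, hu, -, huu⟩ := exists_jointEigenvector hH hsq (χ := 0) (u := 0) (zero_mem _)
    (Or.inl rfl)
  obtain ⟨χ', v, hv, huv, hvv⟩ := exists_jointEigenvector hH hsq hu (Or.inr huu)
  obtain ⟨s, hs⟩ := exists_smul_sl2Form_eq_two huu
  obtain ⟨t, ht⟩ := exists_smul_sl2Form_eq_two hvv
  replace hu := (jointEigenspace H χ).smul_mem s hu
  replace hv := (jointEigenspace H χ').smul_mem t hv
  replace huv : sl2Form (s • u) (t • v) = 0 := by simp [huv]
  generalize s • u = u at *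
  generalize t • v = v at *
  have h1 : ⁅u, ⁅u, v⁆⁆ = (4 : ℂ) • v := by rw [sl2_lie_lie, hs, huv]; module
  have h2 : ⁅v, ⁅u, v⁆⁆ = (-4 : ℂ) • u := by
    rw [← lie_skew u v, lie_neg, sl2_lie_lie, ht, sl2Form_comm, huv]; module
  have h3 : ⁅⁅u, v⁆, v⁆ = (4 : ℂ) • u := by rw [← lie_skew, h2]; module
  -- The coefficients solve `e + f = v` and `e - f = ⁅u, v⁆ / 2`, as the Pauli vectors require.
  obtain ⟨c, hc⟩ := exists_lieEquiv_of_triple (h := u)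
    (e := (1 / 2 : ℂ) • v + (1 / 4 : ℂ) • ⁅u, v⁆) (f := (1 / 2 : ℂ) • v - (1 / 4 : ℂ) • ⁅u, v⁆)
    (by rintro rfl; simp at hs)
    (by
      simp only [add_lie, lie_sub, smul_lie, lie_smul, lie_self, h2, h3]
      module)
    (by simp only [lie_add, lie_smul, h1]; module)
    (by simp only [lie_sub, lie_smul, h1]; module)
  refine ⟨c.symm, conjAut_symm_subset_diagAut fun g hg => ?_⟩
  have hgu := mem_jointEigenspace.mp hu ⟨g, hg⟩
  have hgv := mem_jointEigenspace.mp hv ⟨g, hg⟩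
  simp only at hgu hgv
  generalize χ ⟨g, hg⟩ = α at hgu
  generalize χ' ⟨g, hg⟩ = β at hgv
  intro k
  fin_cases k
  · refine ⟨α, ?_⟩
    change g (c (sl2Mk 1 0 0)) = α • c (sl2Mk 1 0 0)
    rw [hc]; simp [hgu]
  · refine ⟨β, ?_⟩
    change g (c (sl2Mk 0 1 1)) = β • c (sl2Mk 0 1 1)
    have : c (sl2Mk 0 1 1) = v := by rw [hc]; module
    rw [this, hgv]
  · refine ⟨α * β, ?_⟩
    change g (c (sl2Mk 0 1 (-1))) = (α * β) • c (sl2Mk 0 1 (-1))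
    have : c (sl2Mk 0 1 (-1)) = (1 / 2 : ℂ) • ⁅u, v⁆ := by rw [hc]; module
    rw [this, map_smul, LieEquiv.map_lie, hgu, hgv, smul_lie, lie_smul]; module

/-- A commuting set of diagonalizable automorphisms of `sl(2, ℂ)` is diagonal in the Cartan basis
or in the Pauli basis, up to conjugacy. -/
theorem exists_conjAut_subset {H : Set (Sl2C ≃ₗ⁅ℂ⁆ Sl2C)} (hH : IsCommDiag H) :
    ∃ c : Sl2C ≃ₗ⁅ℂ⁆ Sl2C,
      conjAut c H ⊆ diagAut cartanVec ∨ conjAut c H ⊆ diagAut pauliVec := by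
  by_cases h : ∀ m ∈ H, ∀ x, m (m x) = x
  · obtain ⟨c, hc⟩ := exists_conjAut_subset_pauli hH h
    exact ⟨c, Or.inr hc⟩
  · push Not at h
    obtain ⟨m, hm, x, hx⟩ := h
    obtain ⟨c, hc⟩ := exists_conjAut_subset_cartan hH hm hx
    exact ⟨c, Or.inl hc⟩

end Sl2

/-! ### Gradings into lines. -/

section LineGradings

variable {L L' : Type} [LieRing L] [LieAlgebra ℂ L] [LieRing L'] [LieAlgebra ℂ L'] {ι : Type}

/-- The set of lines spanned by a family of vectors. -/
def lineGrading (v : ι → L) : Set (Submodule ℂ L) := Set.range fun i => Submodule.span ℂ {v i}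

theorem smul_of_mem_span_singleton {g : L ≃ₗ⁅ℂ⁆ L} {v x : L} {α : ℂ} (h : g v = α • v)
    (hx : x ∈ Submodule.span ℂ {v}) : g x = α • x := by
  obtain ⟨t, rfl⟩ := Submodule.mem_span_singleton.mp hx
  rw [map_smul, h, smul_comm]

theorem mem_gradingDiag_lineGrading {v : ι → L} {g : L ≃ₗ⁅ℂ⁆ L} :
    g ∈ gradingDiag (lineGrading v) ↔ ∀ i, ∃ α : ℂ, g (v i) = α • v i := by
  constructor
  · intro h i
    obtain ⟨α, hα⟩ := h _ ⟨i, rfl⟩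
    exact ⟨α, hα _ (Submodule.mem_span_singleton_self _)⟩
  · rintro h _ ⟨i, rfl⟩
    obtain ⟨α, hα⟩ := h i
    exact ⟨α, fun x hx => smul_of_mem_span_singleton hα hx⟩

theorem isSeparated_lineGrading {v : ι → L} (h0 : ∀ i, v i ≠ 0)
    (ht : Submodule.span ℂ (Set.range v) = ⊤)
    (hs : ∀ i j, i ≠ j → ∃ g ∈ gradingDiag (lineGrading v), ∃ α β : ℂ, α ≠ β ∧
      g (v i) = α • v i ∧ g (v j) = β • v j) : IsSeparated (lineGrading v) := by
  refine ⟨?_, ?_, ?_⟩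
  · rintro _ ⟨i, rfl⟩ h
    exact h0 i (Submodule.span_singleton_eq_bot.mp h)
  · rw [← ht, lineGrading, sSup_range, Submodule.span_range_eq_iSup]
  · rintro _ ⟨i, rfl⟩ _ ⟨j, rfl⟩ hij
    obtain ⟨g, hg, α, β, hαβ, hα, hβ⟩ := hs i j fun h => hij (by rw [h])
    exact ⟨g, hg, α, β, hαβ, fun x hx => smul_of_mem_span_singleton hα hx,
      fun x hx => smul_of_mem_span_singleton hβ hx⟩

theorem mapGrading_lineGrading (e : L ≃ₗ⁅ℂ⁆ L') (v : ι → L) :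
    mapGrading e (lineGrading v) = lineGrading fun i => e (v i) := by
  rw [mapGrading, lineGrading, ← Set.range_comp]
  refine congrArg Set.range (funext fun i => ?_)
  simp [Submodule.map_span]

theorem finrank_of_mem_lineGrading {v : ι → L} (h0 : ∀ i, v i ≠ 0) {A : Submodule ℂ L}
    (hA : A ∈ lineGrading v) : Module.finrank ℂ A = 1 := by
  obtain ⟨i, rfl⟩ := hA
  exact finrank_span_singleton (h0 i)

theorem span_injective_of_separates {v : ι → L} (h0 : ∀ i, v i ≠ 0)
    (hs : ∀ i j, i ≠ j → ∃ g ∈ gradingDiag (lineGrading v), ∃ α β : ℂ, α ≠ β ∧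
      g (v i) = α • v i ∧ g (v j) = β • v j) :
    Function.Injective fun i => Submodule.span ℂ {v i} := by
  intro i j hij
  by_contra hne
  obtain ⟨g, -, α, β, hαβ, hα, hβ⟩ := hs i j hne
  have h1 : v j ∈ Submodule.span ℂ {v i} := by
    rw [show Submodule.span ℂ {v i} = Submodule.span ℂ {v j} from hij]
    exact Submodule.mem_span_singleton_self (v j)
  exact hαβ (smul_left_injective ℂ (h0 j) ((smul_of_mem_span_singleton hα h1).symm.trans hβ))

theorem ncard_lineGrading [Fintype ι] {v : ι → L}
    (h : Function.Injective fun i => Submodule.span ℂ {v i}) :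
    (lineGrading v).ncard = Fintype.card ι := by
  rw [lineGrading, ← Set.image_univ, Set.ncard_image_of_injective _ h, Set.ncard_univ,
    Nat.card_eq_fintype_card]

/-- Preserving a line already means acting on it by a scalar. -/
theorem IsSeparated.isMADGroup_lineGrading {v : ι → L} (h : IsSeparated (lineGrading v)) :
    IsMADGroup (gradingDiag (lineGrading v)) := by
  refine h.isMADGroup fun g hg => mem_gradingDiag_lineGrading.mpr fun i => ?_
  obtain ⟨α, hα⟩ := Submodule.mem_span_singleton.mp
    (hg _ ⟨i, rfl⟩ _ (Submodule.mem_span_singleton_self (v i)))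
  exact ⟨α, hα.symm⟩

end LineGradings

/-! ### Closing a commuting set under products and inverses. -/

section Closure

variable {K L : Type*} [Field K] [LieRing L] [LieAlgebra K L]

/-- A commuting set of diagonalizable automorphisms is contained in one closed under products and
inverses. -/
theorem IsCommDiag.exists_closed_superset [FiniteDimensional K L] {G : Set (L ≃ₗ⁅K⁆ L)}
    (hG : IsCommDiag G) : ∃ H : Set (L ≃ₗ⁅K⁆ L), G ⊆ H ∧ IsCommDiag H ∧
      (∀ f ∈ H, ∀ g ∈ H, f.trans g ∈ H) ∧ ∀ f ∈ H, f.symm ∈ H := by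
  -- The diagonalizable part of the bicommutant of `G`.
  let H : Set (L ≃ₗ⁅K⁆ L) := {f | IsDiagonalizableAut f ∧
    ∀ h : L ≃ₗ⁅K⁆ L, (∀ g ∈ G, CommuteAut h g) → CommuteAut h f}
  have hGH : G ⊆ H := fun g hg => ⟨hG.1 g hg, fun h hh => hh g hg⟩
  have hH : IsCommDiag H := by
    refine ⟨fun f hf => hf.1, fun f hf g hg => hg.2 f fun k hk x => ?_⟩
    exact (hf.2 k (fun l hl => hG.2 k hk l hl) x).symm
  refine ⟨H, hGH, hH, fun f hf g hg => ⟨hH.trans hf hg, fun h hh x => ?_⟩,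
    fun f hf => ⟨hf.1.symm, fun h hh x => ?_⟩⟩
  · simp only [LieEquiv.trans_apply]
    rw [hg.2 h hh, hf.2 h hh]
  · apply f.injective
    change f (h (f.symm x)) = f (f.symm (h x))
    rw [← hf.2 h hh, LieEquiv.apply_symm_apply, LieEquiv.apply_symm_apply]

end Closure

/-! ### Automorphisms of `sl(2, ℂ) ⊕ sl(2, ℂ)`. -/

section Aut

/-- The automorphism `(x, y) ↦ (p x, q y)`. -/
def prodAut (p q : Sl2C ≃ₗ⁅ℂ⁆ Sl2C) : (Sl2C × Sl2C) ≃ₗ⁅ℂ⁆ (Sl2C × Sl2C) where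
  toFun x := (p x.1, q x.2)
  map_add' x y := by simp
  map_smul' t x := by simp
  map_lie' {x y} := Prod.ext (LieEquiv.map_lie p x.1 y.1) (LieEquiv.map_lie q x.2 y.2)
  invFun x := (p.symm x.1, q.symm x.2)
  left_inv x := by simp
  right_inv x := Prod.ext (p.apply_symm_apply x.1) (q.apply_symm_apply x.2)

/-- The automorphism `(x, y) ↦ (p y, q x)`. -/
def swapAut (p q : Sl2C ≃ₗ⁅ℂ⁆ Sl2C) : (Sl2C × Sl2C) ≃ₗ⁅ℂ⁆ (Sl2C × Sl2C) where
  toFun x := (p x.2, q x.1)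
  map_add' x y := by simp
  map_smul' t x := by simp
  map_lie' {x y} := Prod.ext (LieEquiv.map_lie p x.2 y.2) (LieEquiv.map_lie q x.1 y.1)
  invFun x := (q.symm x.2, p.symm x.1)
  left_inv x := by simp
  right_inv x := Prod.ext (p.apply_symm_apply x.1) (q.apply_symm_apply x.2)

theorem prodAut_apply (p q : Sl2C ≃ₗ⁅ℂ⁆ Sl2C) (x y : Sl2C) : prodAut p q (x, y) = (p x, q y) := rfl

theorem swapAut_apply (p q : Sl2C ≃ₗ⁅ℂ⁆ Sl2C) (x y : Sl2C) : swapAut p q (x, y) = (p y, q x) := rfl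

theorem lie_eq_zero_of_surjective {p q : Sl2C → Sl2C} (hp : Function.Surjective p)
    (h : ∀ x y, ⁅p x, q y⁆ = 0) (y : Sl2C) : q y = 0 :=
  sl2_center fun z => by
    obtain ⟨x, rfl⟩ := hp z
    exact h x y

/-- Every automorphism of `sl(2, ℂ) ⊕ sl(2, ℂ)` preserves or swaps the two summands. -/
theorem exists_eq_prodAut_or_swapAut (θ : (Sl2C × Sl2C) ≃ₗ⁅ℂ⁆ (Sl2C × Sl2C)) :
    (∃ p q, θ = prodAut p q) ∨ ∃ p q, θ = swapAut p q := by
  let i₁ : Sl2C →ₗ⁅ℂ⁆ Sl2C × Sl2C :=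
    { LinearMap.inl ℂ Sl2C Sl2C with
      map_lie' := fun {x y} => Prod.ext rfl (lie_self (0 : Sl2C)).symm }
  let i₂ : Sl2C →ₗ⁅ℂ⁆ Sl2C × Sl2C :=
    { LinearMap.inr ℂ Sl2C Sl2C with
      map_lie' := fun {x y} => Prod.ext (lie_self (0 : Sl2C)).symm rfl }
  let p₁ : Sl2C × Sl2C →ₗ⁅ℂ⁆ Sl2C := { LinearMap.fst ℂ Sl2C Sl2C with map_lie' := rfl }
  let p₂ : Sl2C × Sl2C →ₗ⁅ℂ⁆ Sl2C := { LinearMap.snd ℂ Sl2C Sl2C with map_lie' := rfl }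
  let T : (Sl2C × Sl2C) →ₗ⁅ℂ⁆ (Sl2C × Sl2C) := θ
  -- The four matrix entries of `θ` are endomorphisms of `sl(2, ℂ)`, each zero or bijective. The
  -- images of the two ideals commute and the centre is trivial, so a bijective entry forces the
  -- other entry of its row to vanish.
  let t₁₁ := p₁.comp (T.comp i₁)
  let t₂₁ := p₂.comp (T.comp i₁)
  let t₁₂ := p₁.comp (T.comp i₂)
  let t₂₂ := p₂.comp (T.comp i₂)
  have h1 : ∀ x, θ (x, 0) = (t₁₁ x, t₂₁ x) := fun x => rfl
  have h2 : ∀ x, θ (0, x) = (t₁₂ x, t₂₂ x) := fun x => rfl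
  have h3 : ∀ x y, θ (x, y) = (t₁₁ x + t₁₂ y, t₂₁ x + t₂₂ y) := fun x y => by
    have : (x, y) = (x, 0) + (0, y) := by simp
    rw [this, map_add, h1, h2]; rfl
  have hc : ∀ x y, ⁅θ (x, 0), θ (0, y)⁆ = 0 := fun x y => by
    rw [← LieEquiv.map_lie]
    have : ⁅((x, 0) : Sl2C × Sl2C), ((0, y) : Sl2C × Sl2C)⁆ = 0 :=
      Prod.ext (lie_zero x) (zero_lie y)
    rw [this, map_zero]
  have hc1 : ∀ x y, ⁅t₁₁ x, t₁₂ y⁆ = 0 := fun x y => congrArg Prod.fst (hc x y)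
  have hc2 : ∀ x y, ⁅t₂₁ x, t₂₂ y⁆ = 0 := fun x y => congrArg Prod.snd (hc x y)
  have hne : sl2Mk 1 0 0 ≠ 0 := by simp [sl2Mk_eq_zero]
  have hz1 : (∀ x, t₁₁ x = 0) → (∀ x, t₂₁ x = 0) → False := fun h h' => by
    have := h1 (sl2Mk 1 0 0)
    rw [h, h'] at this
    exact hne (congrArg Prod.fst (θ.injective (this.trans (map_zero θ).symm)))
  have hz2 : (∀ x, t₁₂ x = 0) → (∀ x, t₂₂ x = 0) → False := fun h h' => by
    have := h2 (sl2Mk 1 0 0)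
    rw [h, h'] at this
    exact hne (congrArg Prod.snd (θ.injective (this.trans (map_zero θ).symm)))
  rcases sl2_hom_eq_zero_or_injective t₁₁ with h | h
  · right
    obtain ⟨q, hq⟩ := exists_lieEquiv_of_injective t₂₁
      ((sl2_hom_eq_zero_or_injective t₂₁).resolve_left (hz1 h))
    have h22 := lie_eq_zero_of_surjective (fun z => by
      obtain ⟨x, hx⟩ := q.surjective z
      exact ⟨x, (hq x).symm.trans hx⟩) hc2
    obtain ⟨p, hp⟩ := exists_lieEquiv_of_injective t₁₂
      ((sl2_hom_eq_zero_or_injective t₁₂).resolve_left fun h' => hz2 h' h22)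
    refine ⟨p, q, LieEquiv.ext fun ⟨x, y⟩ => ?_⟩
    rw [h3, swapAut_apply, h, h22, hp, hq, zero_add, add_zero]
  · left
    obtain ⟨p, hp⟩ := exists_lieEquiv_of_injective t₁₁ h
    have h12 := lie_eq_zero_of_surjective (fun z => by
      obtain ⟨x, hx⟩ := p.surjective z
      exact ⟨x, (hp x).symm.trans hx⟩) hc1
    obtain ⟨q, hq⟩ := exists_lieEquiv_of_injective t₂₂
      ((sl2_hom_eq_zero_or_injective t₂₂).resolve_left (hz2 h12))
    have h21 := lie_eq_zero_of_surjective (fun z => by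
      obtain ⟨x, hx⟩ := q.surjective z
      exact ⟨x, (hq x).symm.trans hx⟩) (q := t₂₁) fun y x => by rw [← lie_skew, hc2, neg_zero]
    refine ⟨p, q, LieEquiv.ext fun ⟨x, y⟩ => ?_⟩
    rw [h3, prodAut_apply, h12, h21, hp, hq, zero_add, add_zero]

theorem isDiagonalizableAut_fst {p q : Sl2C ≃ₗ⁅ℂ⁆ Sl2C} (h : IsDiagonalizableAut (prodAut p q)) :
    IsDiagonalizableAut p := by
  refine eq_top_iff.mpr fun x _ => ?_
  refine h.induction (p := fun z => z.1 ∈ ⨆ μ : ℂ, Module.End.eigenspace (p : Sl2C →ₗ[ℂ] Sl2C) μ)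
    (fun μ z hz => ?_) (zero_mem _) (fun _ _ hx hy => add_mem hx hy) (x, 0)
  exact Submodule.mem_iSup_of_mem μ (Module.End.mem_eigenspace_iff.mpr (congrArg Prod.fst hz))

theorem isDiagonalizableAut_snd {p q : Sl2C ≃ₗ⁅ℂ⁆ Sl2C} (h : IsDiagonalizableAut (prodAut p q)) :
    IsDiagonalizableAut q := by
  refine eq_top_iff.mpr fun x _ => ?_
  refine h.induction (p := fun z => z.2 ∈ ⨆ μ : ℂ, Module.End.eigenspace (q : Sl2C →ₗ[ℂ] Sl2C) μ)
    (fun μ z hz => ?_) (zero_mem _) (fun _ _ hx hy => add_mem hx hy) (0, x)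
  exact Submodule.mem_iSup_of_mem μ (Module.End.mem_eigenspace_iff.mpr (congrArg Prod.snd hz))

/-- The automorphisms `(x, y) ↦ (q x, q y)` and `(x, y) ↦ (a (q y), q x)` with `q ∈ Q`. -/
def twistedSet (a : Sl2C ≃ₗ⁅ℂ⁆ Sl2C) (Q : Set (Sl2C ≃ₗ⁅ℂ⁆ Sl2C)) :
    Set ((Sl2C × Sl2C) ≃ₗ⁅ℂ⁆ (Sl2C × Sl2C)) :=
  {g | ∃ q ∈ Q, g = prodAut q q ∨ g = swapAut (q.trans a) q}

theorem conjAut_twistedSet (c a : Sl2C ≃ₗ⁅ℂ⁆ Sl2C) (Q : Set (Sl2C ≃ₗ⁅ℂ⁆ Sl2C)) :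
    conjAut (prodAut c c) (twistedSet a Q) ⊆
      twistedSet ((c.symm.trans a).trans c) (conjAut c Q) := by
  rintro _ ⟨_, ⟨q, hq, rfl | rfl⟩, rfl⟩
  · exact ⟨_, ⟨q, hq, rfl⟩, Or.inl rfl⟩
  · refine ⟨_, ⟨q, hq, rfl⟩, Or.inr (LieEquiv.ext fun ⟨x, y⟩ => ?_)⟩
    refine Prod.ext ?_ rfl
    change c (a (q (c.symm y))) = c (a (c.symm (c (q (c.symm y)))))
    rw [LieEquiv.symm_apply_apply]

theorem twistedSet_mono (a : Sl2C ≃ₗ⁅ℂ⁆ Sl2C) {Q R : Set (Sl2C ≃ₗ⁅ℂ⁆ Sl2C)} (h : Q ⊆ R) :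
    twistedSet a Q ⊆ twistedSet a R := fun _ ⟨q, hq, hg⟩ => ⟨q, h hq, hg⟩

/-- Commuting with the swap `s : (x, y) ↦ (a y, x)` forces `(p, q)` to have `p = q`, and a swapping
element to be `s` times some `(q, q)` with `q` commuting with `a`. Passing to a set closed under
products and inverses keeps all these `q` in one commuting diagonalizable set; it contains `a`
because `s² = (a, a)`. -/
theorem subset_twistedSet {H : Set ((Sl2C × Sl2C) ≃ₗ⁅ℂ⁆ (Sl2C × Sl2C))} (hH : IsCommDiag H)
    {a : Sl2C ≃ₗ⁅ℂ⁆ Sl2C} (ha : swapAut a LieEquiv.refl ∈ H) :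
    ∃ Q : Set (Sl2C ≃ₗ⁅ℂ⁆ Sl2C), IsCommDiag Q ∧ a ∈ Q ∧ H ⊆ twistedSet a Q := by
  obtain ⟨H', hHH', hH', hmul, hinv⟩ := hH.exists_closed_superset
  refine ⟨{q | prodAut q q ∈ H'}, ⟨fun q hq => isDiagonalizableAut_fst (hH'.1 _ hq),
    fun p hp q hq x => congrArg Prod.fst (hH'.2 _ hp _ hq (x, 0))⟩,
    hmul _ (hHH' ha) _ (hHH' ha), fun g hg => ?_⟩
  have hcomm : ∀ g ∈ H, CommuteAut (swapAut a LieEquiv.refl) g := fun g hg => hH.2 _ ha _ hg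
  rcases exists_eq_prodAut_or_swapAut g with ⟨p, q, rfl⟩ | ⟨p, q, rfl⟩
  · have : p = q := LieEquiv.ext fun x => (congrArg Prod.snd (hcomm _ hg (x, 0)))
    subst this
    exact ⟨p, hHH' hg, Or.inl rfl⟩
  · have h1 : ∀ x, a (q x) = p x := fun x => congrArg Prod.fst (hcomm _ hg (x, 0))
    have h2 : ∀ x, p x = q (a x) := fun x => congrArg Prod.snd (hcomm _ hg (0, x))
    have hp : p = q.trans a := LieEquiv.ext fun x => (h1 x).symm
    refine ⟨q, ?_, Or.inr (by rw [hp])⟩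
    have h3 := hmul _ (hinv _ (hHH' ha)) _ (hHH' hg)
    have h4 : prodAut q q = (swapAut a LieEquiv.refl).symm.trans (swapAut p q) :=
      LieEquiv.ext fun ⟨x, y⟩ => by
        refine Prod.ext ?_ rfl
        change q x = p (a.symm x)
        rw [h2, LieEquiv.apply_symm_apply]
    change prodAut q q ∈ H'
    rw [h4]
    exact h3

end Aut

/-! ### The diagonal groups of the Cartan and Pauli bases, and the vectors spanning the gradings. -/

section Families

theorem exists_torus {t : ℂ} (ht : t ≠ 0) : ∃ g : Sl2C ≃ₗ⁅ℂ⁆ Sl2C,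
    ∀ r s u, g (sl2Mk r s u) = sl2Mk r (t * s) (t⁻¹ * u) := by
  obtain ⟨g, hg⟩ := exists_lieEquiv_of_triple (h := sl2Mk 1 0 0) (e := sl2Mk 0 t 0)
    (f := sl2Mk 0 0 t⁻¹) (by simp [sl2Mk_eq_zero]) (by simp [sl2Mk_lie, ht])
    (by simp [sl2Mk_lie, sl2Mk_smul])
    (by simp [sl2Mk_lie, sl2Mk_smul, sl2Mk_neg])
  exact ⟨g, fun r s u => by rw [hg]; simp [sl2Mk_smul, sl2Mk_add, mul_comm]⟩

theorem exists_weyl : ∃ g : Sl2C ≃ₗ⁅ℂ⁆ Sl2C, ∀ r s u, g (sl2Mk r s u) = sl2Mk (-r) u s := by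
  obtain ⟨g, hg⟩ := exists_lieEquiv_of_triple (h := sl2Mk (-1) 0 0) (e := sl2Mk 0 0 1)
    (f := sl2Mk 0 1 0) (by simp [sl2Mk_eq_zero]) (by simp [sl2Mk_lie])
    (by simp [sl2Mk_lie, sl2Mk_smul])
    (by simp [sl2Mk_lie, sl2Mk_smul, sl2Mk_neg])
  exact ⟨g, fun r s u => by rw [hg]; simp [sl2Mk_smul, sl2Mk_add]⟩

/-- The automorphism of order three that permutes the lines of the Pauli grading cyclically. -/
theorem exists_pauli_rotation : ∃ g : Sl2C ≃ₗ⁅ℂ⁆ Sl2C, ∀ k, ∃ t : ℂ, t ≠ 0 ∧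
    g (pauliVec k) = t • pauliVec (k + 1) := by
  have hI : Complex.I * Complex.I = -1 := Complex.I_mul_I
  -- Here `e + f` is `-i` times the third Pauli vector and `e - f` is `i` times the first, so the
  -- Pauli lines move in a cycle.
  obtain ⟨g, hg⟩ := exists_lieEquiv_of_triple (h := sl2Mk 0 1 1)
    (e := sl2Mk (Complex.I / 2) (-Complex.I / 2) (Complex.I / 2))
    (f := sl2Mk (-Complex.I / 2) (-Complex.I / 2) (Complex.I / 2)) (by simp [sl2Mk_eq_zero])
    (by
      rw [sl2Mk_lie, sl2Mk_inj]
      refine ⟨by ring, by linear_combination -hI, by linear_combination -hI⟩)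
    (by
      rw [sl2Mk_lie, sl2Mk_smul, sl2Mk_inj]
      refine ⟨by ring, by ring, by ring⟩)
    (by
      rw [sl2Mk_lie, sl2Mk_smul, sl2Mk_inj]
      refine ⟨by ring, by ring, by ring⟩)
  refine ⟨g, fun k => ?_⟩
  fin_cases k
  · refine ⟨1, one_ne_zero, ?_⟩
    change g (sl2Mk 1 0 0) = 1 • sl2Mk 0 1 1
    rw [hg]; simp
  · refine ⟨-Complex.I, by simp, ?_⟩
    change g (sl2Mk 0 1 1) = -Complex.I • sl2Mk 0 1 (-1)
    rw [hg]
    simp only [sl2Mk_smul, sl2Mk_add, sl2Mk_inj]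
    refine ⟨by ring, by ring, by ring⟩
  · refine ⟨Complex.I, by simp, ?_⟩
    change g (sl2Mk 0 1 (-1)) = Complex.I • sl2Mk 1 0 0
    rw [hg]
    simp only [sl2Mk_smul, sl2Mk_add, sl2Mk_inj]
    refine ⟨by ring, by ring, by ring⟩

/-- The diagonal automorphisms tell the vectors of `b` apart. -/
def DiagSeparates (b : Fin 3 → Sl2C) : Prop :=
  ∀ k l, k ≠ l → ∃ q ∈ diagAut b, ∃ α β : ℂ, α ≠ β ∧ q (b k) = α • b k ∧ q (b l) = β • b l

theorem diagSeparates_cartanVec : DiagSeparates cartanVec := by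
  obtain ⟨g, hg⟩ := exists_torus (t := 2) two_ne_zero
  have h : ∀ k, g (cartanVec k) = (![1, 2, 2⁻¹] : Fin 3 → ℂ) k • cartanVec k := by
    intro k
    fin_cases k <;> simp [cartanVec, hg, sl2Mk_smul]
  intro k l hkl
  refine ⟨g, fun k => ⟨_, h k⟩, _, _, ?_, h k, h l⟩
  fin_cases k <;> fin_cases l <;> simp at hkl ⊢ <;> norm_num

theorem exists_diagAut_pauliVec :
    ∃ g₀ g₁ : Sl2C ≃ₗ⁅ℂ⁆ Sl2C, (∀ k, g₀ (pauliVec k) = (![1, -1, -1] : Fin 3 → ℂ) k • pauliVec k) ∧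
      ∀ k, g₁ (pauliVec k) = (![-1, 1, -1] : Fin 3 → ℂ) k • pauliVec k := by
  obtain ⟨g, hg⟩ := exists_torus (t := -1) (by norm_num)
  obtain ⟨g', hg'⟩ := exists_weyl
  refine ⟨g, g', fun k => ?_, fun k => ?_⟩ <;> fin_cases k <;>
    simp [pauliVec, hg, hg', sl2Mk_neg]

theorem diagSeparates_pauliVec : DiagSeparates pauliVec := by
  obtain ⟨g, g', hg, hg'⟩ := exists_diagAut_pauliVec
  intro k l hkl
  by_cases h : (![1, -1, -1] : Fin 3 → ℂ) k = (![1, -1, -1] : Fin 3 → ℂ) l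
  · refine ⟨g', fun k => ⟨_, hg' k⟩, _, _, ?_, hg' k, hg' l⟩
    fin_cases k <;> fin_cases l <;> simp at hkl h ⊢ <;>
      first | (norm_num at h; done) | norm_num
  · exact ⟨g, fun k => ⟨_, hg k⟩, _, _, h, hg k, hg l⟩

/-- No Pauli vector is fixed by the whole Klein four-group. The diagonal vector of the Cartan basis,
by contrast, is fixed by the whole torus, and this is what prevents two Cartan gradings from
composing to a group grading. -/
theorem exists_ne_one_pauliVec (l : Fin 3) :
    ∃ q ∈ diagAut pauliVec, ∃ β : ℂ, 1 ≠ β ∧ q (pauliVec l) = β • pauliVec l := by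
  obtain ⟨g, g', hg, hg'⟩ := exists_diagAut_pauliVec
  by_cases h : l = 0
  · refine ⟨g', fun k => ⟨_, hg' k⟩, _, ?_, hg' l⟩
    subst h; norm_num
  · refine ⟨g, fun k => ⟨_, hg k⟩, _, ?_, hg l⟩
    fin_cases l <;> simp at h ⊢ <;> norm_num

theorem cartanVec_ne_zero (k : Fin 3) : cartanVec k ≠ 0 := by
  fin_cases k <;> simp [cartanVec, sl2Mk_eq_zero]

theorem pauliVec_ne_zero (k : Fin 3) : pauliVec k ≠ 0 := by
  fin_cases k <;> simp [pauliVec, sl2Mk_eq_zero]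

theorem span_cartanVec : Submodule.span ℂ (Set.range cartanVec) = ⊤ := by
  refine eq_top_iff.mpr fun x _ => ?_
  have h : ∀ k, cartanVec k ∈ Submodule.span ℂ (Set.range cartanVec) :=
    fun k => Submodule.subset_span ⟨k, rfl⟩
  obtain ⟨a, b, c, rfl⟩ := exists_eq_sl2Mk x
  have := add_mem (add_mem (Submodule.smul_mem _ a (h 0)) (Submodule.smul_mem _ b (h 1)))
    (Submodule.smul_mem _ c (h 2))
  simpa [cartanVec, sl2Mk_smul, sl2Mk_add] using this

theorem span_pauliVec : Submodule.span ℂ (Set.range pauliVec) = ⊤ := by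
  refine eq_top_iff.mpr fun x _ => ?_
  have h : ∀ k, pauliVec k ∈ Submodule.span ℂ (Set.range pauliVec) :=
    fun k => Submodule.subset_span ⟨k, rfl⟩
  obtain ⟨a, b, c, rfl⟩ := exists_eq_sl2Mk x
  have := add_mem (add_mem (Submodule.smul_mem _ a (h 0))
    (Submodule.smul_mem _ ((b + c) / 2) (h 1))) (Submodule.smul_mem _ ((b - c) / 2) (h 2))
  have h2 : (b + c) / 2 + (b - c) / 2 = b := by ring
  have h3 : (b + c) / 2 + -((b - c) / 2) = c := by ring
  simpa [pauliVec, sl2Mk_smul, sl2Mk_add, h2, h3] using this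

/-- The vectors `(b k, 0)` and `(0, b' k)`. -/
def composedVec (b b' : Fin 3 → Sl2C) : Fin 3 ⊕ Fin 3 → Sl2C × Sl2C :=
  Sum.elim (fun k => (b k, 0)) fun k => (0, b' k)

/-- The vectors `(± μ k • b k, b k)`. -/
noncomputable def twistedVec (b : Fin 3 → Sl2C) (μ : Fin 3 → ℂ) : Fin 3 × Bool → Sl2C × Sl2C :=
  fun i => (((if i.2 then 1 else -1) * μ i.1) • b i.1, b i.1)

/-- The root vectors of the Cartan subalgebra of pairs of diagonal matrices. -/
def rootVec : Fin 4 → Sl2C × Sl2C :=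
  ![(sl2Mk 0 1 0, 0), (sl2Mk 0 0 1, 0), (0, sl2Mk 0 1 0), (0, sl2Mk 0 0 1)]

/-- The Cartan subalgebra of pairs of diagonal matrices. -/
noncomputable def cartanPlane : Submodule ℂ (Sl2C × Sl2C) :=
  Submodule.span ℂ {(sl2Mk 1 0 0, 0), (0, sl2Mk 1 0 0)}

/-- The root space decomposition of `sl(2, ℂ) ⊕ sl(2, ℂ)`. -/
noncomputable def rootGrading : Set (Submodule ℂ (Sl2C × Sl2C)) :=
  insert cartanPlane (lineGrading rootVec)

theorem eq_top_of_forall_mem {b b' : Fin 3 → Sl2C} (hb : Submodule.span ℂ (Set.range b) = ⊤)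
    (hb' : Submodule.span ℂ (Set.range b') = ⊤) {W : Submodule ℂ (Sl2C × Sl2C)}
    (h : ∀ k, (b k, (0 : Sl2C)) ∈ W) (h' : ∀ k, ((0 : Sl2C), b' k) ∈ W) : W = ⊤ := by
  have h1 : Submodule.span ℂ (Set.range b) ≤ W.comap (LinearMap.inl ℂ Sl2C Sl2C) := by
    rw [Submodule.span_le]
    rintro _ ⟨k, rfl⟩
    exact h k
  have h2 : Submodule.span ℂ (Set.range b') ≤ W.comap (LinearMap.inr ℂ Sl2C Sl2C) := by
    rw [Submodule.span_le]
    rintro _ ⟨k, rfl⟩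
    exact h' k
  rw [hb] at h1
  rw [hb'] at h2
  refine eq_top_iff.mpr fun x _ => ?_
  have h3 : (x.1, (0 : Sl2C)) + ((0 : Sl2C), x.2) ∈ W := W.add_mem (h1 (show x.1 ∈ (⊤ : Submodule ℂ Sl2C) from trivial))
    (h2 (show x.2 ∈ (⊤ : Submodule ℂ Sl2C) from trivial))
  have h4 : x = (x.1, 0) + (0, x.2) := by simp
  rw [h4]
  exact h3

theorem composedVec_ne_zero {b b' : Fin 3 → Sl2C} (hb : ∀ k, b k ≠ 0) (hb' : ∀ k, b' k ≠ 0)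
    (i : Fin 3 ⊕ Fin 3) : composedVec b b' i ≠ 0 := by
  rcases i with k | k
  · exact fun h => hb k (congrArg Prod.fst h)
  · exact fun h => hb' k (congrArg Prod.snd h)

theorem span_composedVec {b b' : Fin 3 → Sl2C} (hb : Submodule.span ℂ (Set.range b) = ⊤)
    (hb' : Submodule.span ℂ (Set.range b') = ⊤) :
    Submodule.span ℂ (Set.range (composedVec b b')) = ⊤ :=
  eq_top_of_forall_mem hb hb' (fun k => Submodule.subset_span ⟨Sum.inl k, rfl⟩)
    fun k => Submodule.subset_span ⟨Sum.inr k, rfl⟩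

theorem prodAut_mem_gradingDiag {b b' : Fin 3 → Sl2C} {p q : Sl2C ≃ₗ⁅ℂ⁆ Sl2C}
    (hp : p ∈ diagAut b) (hq : q ∈ diagAut b') :
    prodAut p q ∈ gradingDiag (lineGrading (composedVec b b')) := by
  rw [mem_gradingDiag_lineGrading]
  rintro (k | k)
  · obtain ⟨α, hα⟩ := hp k
    exact ⟨α, by simp [composedVec, prodAut_apply, hα]⟩
  · obtain ⟨α, hα⟩ := hq k
    exact ⟨α, by simp [composedVec, prodAut_apply, hα]⟩

theorem refl_mem_diagAut (b : Fin 3 → Sl2C) : LieEquiv.refl ∈ diagAut b :=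
  fun k => ⟨1, (one_smul ℂ (b k)).symm⟩

/-- Vectors of the same summand are separated by acting on that summand alone. Vectors of different
summands are separated by some `(1, q)` that moves the one in the second summand. -/
theorem composedVec_separates {b b' : Fin 3 → Sl2C} (hs : DiagSeparates b) (hs' : DiagSeparates b')
    (hm : ∀ l, ∃ q ∈ diagAut b', ∃ β : ℂ, 1 ≠ β ∧ q (b' l) = β • b' l) (i j : Fin 3 ⊕ Fin 3)
    (hij : i ≠ j) : ∃ g ∈ gradingDiag (lineGrading (composedVec b b')), ∃ α β : ℂ, α ≠ β ∧
      g (composedVec b b' i) = α • composedVec b b' i ∧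
      g (composedVec b b' j) = β • composedVec b b' j := by
  rcases i with k | k <;> rcases j with l | l
  · obtain ⟨q, hq, α, β, hαβ, hα, hβ⟩ := hs k l fun h => hij (by rw [h])
    exact ⟨_, prodAut_mem_gradingDiag hq (refl_mem_diagAut b'), α, β, hαβ,
      by simp [composedVec, prodAut_apply, hα], by simp [composedVec, prodAut_apply, hβ]⟩
  · obtain ⟨q, hq, β, hne, hβ⟩ := hm l
    exact ⟨_, prodAut_mem_gradingDiag (refl_mem_diagAut b) hq, 1, β, hne,
      by simp [composedVec, prodAut_apply], by simp [composedVec, prodAut_apply, hβ]⟩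
  · obtain ⟨q, hq, β, hne, hβ⟩ := hm k
    exact ⟨_, prodAut_mem_gradingDiag (refl_mem_diagAut b) hq, β, 1, hne.symm,
      by simp [composedVec, prodAut_apply, hβ], by simp [composedVec, prodAut_apply]⟩
  · obtain ⟨q, hq, α, β, hαβ, hα, hβ⟩ := hs' k l fun h => hij (by rw [h])
    exact ⟨_, prodAut_mem_gradingDiag (refl_mem_diagAut b) hq, α, β, hαβ,
      by simp [composedVec, prodAut_apply, hα], by simp [composedVec, prodAut_apply, hβ]⟩

theorem twistedVec_ne_zero {b : Fin 3 → Sl2C} (hb : ∀ k, b k ≠ 0) (μ : Fin 3 → ℂ)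
    (i : Fin 3 × Bool) : twistedVec b μ i ≠ 0 :=
  fun h => hb i.1 (congrArg Prod.snd h)

theorem span_twistedVec {b : Fin 3 → Sl2C} (hb : Submodule.span ℂ (Set.range b) = ⊤)
    {μ : Fin 3 → ℂ} (hμ : ∀ k, μ k ≠ 0) :
    Submodule.span ℂ (Set.range (twistedVec b μ)) = ⊤ := by
  have h : ∀ i, twistedVec b μ i ∈ Submodule.span ℂ (Set.range (twistedVec b μ)) :=
    fun i => Submodule.subset_span ⟨i, rfl⟩
  refine eq_top_of_forall_mem hb hb (fun k => ?_) fun k => ?_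
  · have := Submodule.smul_mem _ (2 * μ k)⁻¹ (sub_mem (h (k, true)) (h (k, false)))
    convert! this using 1
    refine Prod.ext ?_ ?_
    · simp only [twistedVec, if_true, Bool.false_eq_true, if_false, Prod.smul_fst, Prod.fst_sub,
        ← sub_smul, smul_smul]
      have : (2 * μ k)⁻¹ * (1 * μ k - -1 * μ k) = 1 := by
        have := hμ k
        field_simp
        norm_num
      rw [this, one_smul]
    · simp [twistedVec]
  · have := Submodule.smul_mem _ (2 : ℂ)⁻¹ (add_mem (h (k, true)) (h (k, false)))
    convert! this using 1
    refine Prod.ext ?_ ?_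
    · simp [twistedVec]
    · simp only [twistedVec, Prod.smul_snd, Prod.snd_add]
      module

/-- The swap sends `(±μ b, b)` to `(μ² α b, ±μ α b)`, which is `±μ α` times the original vector.
This is why `μ` has to be a square root of the eigenvalue of `a`. -/
theorem twistedSet_apply {b : Fin 3 → Sl2C} {μ : Fin 3 → ℂ} {a q : Sl2C ≃ₗ⁅ℂ⁆ Sl2C}
    {k : Fin 3} {α : ℂ} (ha : a (b k) = (μ k * μ k) • b k) (hq : q (b k) = α • b k) (s : Bool) :
    prodAut q q (twistedVec b μ (k, s)) = α • twistedVec b μ (k, s) ∧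
      swapAut (q.trans a) q (twistedVec b μ (k, s)) =
        ((if s then 1 else -1) * μ k * α) • twistedVec b μ (k, s) := by
  have hs : (if s then 1 else -1 : ℂ) * (if s then 1 else -1) = 1 := by
    cases s <;> simp
  refine ⟨Prod.ext ?_ ?_, Prod.ext ?_ ?_⟩
  · simp only [twistedVec, prodAut_apply, map_smul, hq, Prod.smul_fst]
    rw [smul_comm]
  · simp [twistedVec, prodAut_apply, hq]
  · simp only [twistedVec, swapAut_apply, LieEquiv.trans_apply, map_smul, hq, ha, Prod.smul_fst,
      smul_smul]
    congr 1
    linear_combination (-μ k * μ k * α) * hs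
  · simp only [twistedVec, swapAut_apply, map_smul, hq, Prod.smul_snd, smul_smul]

theorem twistedSet_subset_gradingDiag {b : Fin 3 → Sl2C} {μ : Fin 3 → ℂ} {a : Sl2C ≃ₗ⁅ℂ⁆ Sl2C}
    (ha : ∀ k, a (b k) = (μ k * μ k) • b k) :
    twistedSet a (diagAut b) ⊆ gradingDiag (lineGrading (twistedVec b μ)) := by
  rintro g ⟨q, hq, hg⟩
  rw [mem_gradingDiag_lineGrading]
  rintro ⟨k, s⟩
  obtain ⟨α, hα⟩ := hq k
  rcases hg with rfl | rfl
  · exact ⟨_, (twistedSet_apply (ha k) hα s).1⟩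
  · exact ⟨_, (twistedSet_apply (ha k) hα s).2⟩

/-- The swap with `q = 1` has eigenvalues `±μ k` on the two vectors over the same `k`; different `k`
are separated by `(q, q)`. -/
theorem twistedVec_separates {b : Fin 3 → Sl2C} (hs : DiagSeparates b) {μ : Fin 3 → ℂ}
    (hμ : ∀ k, μ k ≠ 0) {a : Sl2C ≃ₗ⁅ℂ⁆ Sl2C} (ha : ∀ k, a (b k) = (μ k * μ k) • b k)
    (i j : Fin 3 × Bool) (hij : i ≠ j) :
    ∃ g ∈ gradingDiag (lineGrading (twistedVec b μ)), ∃ α β : ℂ, α ≠ β ∧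
      g (twistedVec b μ i) = α • twistedVec b μ i ∧
      g (twistedVec b μ j) = β • twistedVec b μ j := by
  obtain ⟨k, s⟩ := i
  obtain ⟨l, t⟩ := j
  have hsub := twistedSet_subset_gradingDiag ha
  by_cases hkl : k = l
  · subst hkl
    have h1 : (LieEquiv.refl : Sl2C ≃ₗ⁅ℂ⁆ Sl2C) (b k) = (1 : ℂ) • b k := (one_smul ℂ _).symm
    refine ⟨_, hsub ⟨LieEquiv.refl, refl_mem_diagAut b, Or.inr rfl⟩, _, _, ?_,
      (twistedSet_apply (ha k) h1 s).2, (twistedSet_apply (ha k) h1 t).2⟩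
    have := hμ k
    have hst : s ≠ t := fun h => hij (by rw [h])
    have h2 : μ k ≠ -μ k := fun h => this (by linear_combination h / 2)
    cases s <;> cases t <;> simp [h2, h2.symm] at hst ⊢
  · obtain ⟨q, hq, α, β, hαβ, hα, hβ⟩ := hs k l hkl
    exact ⟨_, hsub ⟨q, hq, Or.inl rfl⟩, α, β, hαβ, (twistedSet_apply (ha k) hα s).1,
      (twistedSet_apply (ha l) hβ t).1⟩

theorem diagAut_cartanVec_apply {g : Sl2C ≃ₗ⁅ℂ⁆ Sl2C} (hg : g ∈ diagAut cartanVec) :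
    ∃ t : ℂ, t ≠ 0 ∧ ∀ r s u, g (sl2Mk r s u) = sl2Mk r (t * s) (t⁻¹ * u) := by
  obtain ⟨α, hα⟩ := hg 0
  obtain ⟨β, hβ⟩ := hg 1
  obtain ⟨γ, hγ⟩ := hg 2
  have hβ0 := eigenvalue_ne_zero (cartanVec_ne_zero 1) hβ
  simp only [cartanVec, Matrix.cons_val_zero, Matrix.cons_val_one, Matrix.cons_val] at hα hβ hγ
  have h1 : ⁅sl2Mk 1 0 0, sl2Mk 0 1 0⁆ = (2 : ℂ) • sl2Mk 0 1 0 := by simp [sl2Mk_lie, sl2Mk_smul]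
  have h2 : ⁅sl2Mk 0 1 0, sl2Mk 0 0 1⁆ = sl2Mk 1 0 0 := by simp [sl2Mk_lie]
  replace h1 := congrArg g h1
  replace h2 := congrArg g h2
  rw [LieEquiv.map_lie, map_smul, hα, hβ] at h1
  rw [LieEquiv.map_lie, hβ, hγ, hα] at h2
  simp [sl2Mk_smul, sl2Mk_lie, sl2Mk_inj] at h1 h2
  have hα1 : α = 1 := by
    apply mul_right_cancel₀ hβ0
    linear_combination h1
  have hγ1 : γ = β⁻¹ := by
    rw [hα1] at h2
    exact (eq_inv_of_mul_eq_one_right h2)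
  refine ⟨β, hβ0, fun r s u => ?_⟩
  rw [sl2Mk_eq_sum, map_add, map_add, map_smul, map_smul, map_smul, hα, hβ, hγ, hα1, hγ1]
  simp [sl2Mk_smul, sl2Mk_add, mul_comm]

/-- The brackets among Pauli vectors force the three scalars to be signs, the third being the
product of the first two. So only the identity and three involutions occur. -/
theorem diagAut_pauliVec_apply {g : Sl2C ≃ₗ⁅ℂ⁆ Sl2C} (hg : g ∈ diagAut pauliVec) :
    (∀ k, g (pauliVec k) = pauliVec k) ∨
      ∃ l, ∀ k, g (pauliVec k) = (if k = l then (1 : ℂ) else -1) • pauliVec k := by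
  choose ε hε using hg
  have h0 : ∀ k, ε k ≠ 0 := fun k => eigenvalue_ne_zero (pauliVec_ne_zero k) (hε k)
  have hb0 : pauliVec 0 = sl2Mk 1 0 0 := rfl
  have hb1 : pauliVec 1 = sl2Mk 0 1 1 := rfl
  have hb2 : pauliVec 2 = sl2Mk 0 1 (-1) := rfl
  have h1 : ⁅pauliVec 0, pauliVec 1⁆ = (2 : ℂ) • pauliVec 2 := by
    simp [hb0, hb1, hb2, sl2Mk_lie, sl2Mk_smul]
  have h2 : ⁅pauliVec 0, pauliVec 2⁆ = (2 : ℂ) • pauliVec 1 := by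
    simp [hb0, hb1, hb2, sl2Mk_lie, sl2Mk_smul]
  replace h1 := congrArg g h1
  replace h2 := congrArg g h2
  rw [LieEquiv.map_lie, map_smul, hε, hε, hε] at h1
  rw [LieEquiv.map_lie, map_smul, hε, hε, hε] at h2
  simp [hb0, hb1, hb2, sl2Mk_smul, sl2Mk_lie, sl2Mk_inj] at h1 h2
  have e1 : ε 0 * ε 1 = ε 2 := by linear_combination h1
  have e2 : ε 0 * ε 2 = ε 1 := by linear_combination h2
  have e0 : ε 0 * ε 0 = 1 := by
    apply mul_right_cancel₀ (h0 1)
    linear_combination ε 0 * e1 + e2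
  have h3 : ⁅pauliVec 1, pauliVec 2⁆ = (-2 : ℂ) • pauliVec 0 := by
    simp [hb0, hb1, hb2, sl2Mk_lie, sl2Mk_neg, sl2Mk_smul]; norm_num
  replace h3 := congrArg g h3
  rw [LieEquiv.map_lie, map_smul, hε, hε, hε] at h3
  simp only [hb0, hb1, hb2, sl2Mk_smul, sl2Mk_lie, sl2Mk_inj] at h3
  have e3 : ε 1 * ε 1 = 1 := by
    apply mul_right_cancel₀ (h0 0)
    linear_combination ε 1 * e1 - h3.1 / 2
  have hext : ∀ l : Fin 3, ε 0 = (if 0 = l then 1 else -1) → ε 1 = (if 1 = l then 1 else -1) →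
      ε 2 = (if 2 = l then 1 else -1) →
      ∀ k, g (pauliVec k) = (if k = l then (1 : ℂ) else -1) • pauliVec k := by
    intro l h0 h1 h2 k
    rw [hε]
    congr 1
    fin_cases k
    exacts [h0, h1, h2]
  rcases mul_self_eq_one_iff.mp e0 with e0 | e0 <;> rcases mul_self_eq_one_iff.mp e3 with e3 | e3
  · left
    intro k
    rw [hε]
    have : ε k = 1 := by
      fin_cases k
      exacts [e0, e3, by simpa [e0, e3] using e1.symm]
    rw [this, one_smul]
  · exact Or.inr ⟨0, hext 0 (by simpa) (by simpa) (by simp [← e1, e0, e3])⟩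
  · exact Or.inr ⟨1, hext 1 (by simpa) (by simpa) (by simp [← e1, e0, e3])⟩
  · exact Or.inr ⟨2, hext 2 (by simpa) (by simpa) (by simp [← e1, e0, e3])⟩

end Families

/-! ### The root space decomposition. -/

section RootGrading

/-- The weights of the root space decomposition under the automorphism with parameters `2` and
`3`. -/
theorem exists_aut_rootGrading : ∃ g : (Sl2C × Sl2C) ≃ₗ⁅ℂ⁆ (Sl2C × Sl2C),
    (∀ x ∈ cartanPlane, g x = (1 : ℂ) • x) ∧
      ∀ i, g (rootVec i) = (![2, 2⁻¹, 3, 3⁻¹] : Fin 4 → ℂ) i • rootVec i := by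
  -- The parameters 2 and 3, their inverses and 1 are distinct, so a single automorphism separates
  -- all five members.
  obtain ⟨p, hp⟩ := exists_torus (t := 2) two_ne_zero
  obtain ⟨q, hq⟩ := exists_torus (t := 3) three_ne_zero
  refine ⟨prodAut p q, fun x hx => ?_, fun i => ?_⟩
  · obtain ⟨s, t, rfl⟩ := Submodule.mem_span_pair.mp hx
    simp [prodAut_apply, hp, hq]
  · fin_cases i <;> simp [rootVec, prodAut_apply, hp, hq, sl2Mk_smul]

theorem rootVec_ne_zero (i : Fin 4) : rootVec i ≠ 0 := by
  fin_cases i <;> simp [rootVec, sl2Mk_eq_zero]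

theorem cartanPlane_ne_bot : cartanPlane ≠ ⊥ := by
  intro h
  have : (sl2Mk 1 0 0, (0 : Sl2C)) ∈ cartanPlane := Submodule.subset_span (by simp)
  rw [h, Submodule.mem_bot] at this
  simp [sl2Mk_eq_zero] at this

theorem mem_rootGrading {A : Submodule ℂ (Sl2C × Sl2C)} :
    A ∈ rootGrading ↔ A = cartanPlane ∨ ∃ i, Submodule.span ℂ {rootVec i} = A := Iff.rfl

theorem rootGrading_weights : ∃ g ∈ gradingDiag rootGrading,
    (∀ x ∈ cartanPlane, g x = (1 : ℂ) • x) ∧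
      ∀ i, g (rootVec i) = (![2, 2⁻¹, 3, 3⁻¹] : Fin 4 → ℂ) i • rootVec i := by
  obtain ⟨g, h1, h2⟩ := exists_aut_rootGrading
  refine ⟨g, ?_, h1, h2⟩
  intro A hA
  rcases mem_rootGrading.mp hA with rfl | ⟨i, rfl⟩
  · exact ⟨1, h1⟩
  · exact ⟨_, fun x hx => smul_of_mem_span_singleton (h2 i) hx⟩

theorem rootWeights_ne_one (i : Fin 4) : (![2, 2⁻¹, 3, 3⁻¹] : Fin 4 → ℂ) i ≠ 1 := by
  fin_cases i <;> norm_num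

theorem rootWeights_injective : Function.Injective (![2, 2⁻¹, 3, 3⁻¹] : Fin 4 → ℂ) := by
  intro i j h
  fin_cases i <;> fin_cases j <;> first | rfl | (norm_num at h)

theorem sSup_rootGrading : sSup rootGrading = ⊤ := by
  have h1 : cartanPlane ≤ sSup rootGrading := le_sSup (Or.inl rfl)
  have h2 : ∀ i, rootVec i ∈ sSup rootGrading := fun i =>
    (le_sSup (Or.inr ⟨i, rfl⟩) : Submodule.span ℂ {rootVec i} ≤ _)
      (Submodule.mem_span_singleton_self _)
  refine eq_top_of_forall_mem span_cartanVec span_cartanVec (fun k => ?_) fun k => ?_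
  · fin_cases k
    exacts [h1 (Submodule.subset_span (Or.inl rfl)), h2 0, h2 1]
  · fin_cases k
    exacts [h1 (Submodule.subset_span (Or.inr rfl)), h2 2, h2 3]

theorem isSeparated_rootGrading : IsSeparated rootGrading := by
  obtain ⟨g, hg, h1, h2⟩ := rootGrading_weights
  refine ⟨fun A hA => ?_, sSup_rootGrading, fun A hA B hB hAB => ?_⟩
  · rcases hA with rfl | ⟨i, rfl⟩
    · exact cartanPlane_ne_bot
    · exact fun h => rootVec_ne_zero i (Submodule.span_singleton_eq_bot.mp h)
  · rcases hA with rfl | ⟨i, rfl⟩ <;> rcases hB with rfl | ⟨j, rfl⟩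
    · exact absurd rfl hAB
    · exact ⟨g, hg, _, _, (rootWeights_ne_one j).symm, h1,
        fun x hx => smul_of_mem_span_singleton (h2 j) hx⟩
    · exact ⟨g, hg, _, _, rootWeights_ne_one i,
        fun x hx => smul_of_mem_span_singleton (h2 i) hx, h1⟩
    · refine ⟨g, hg, _, _, rootWeights_injective.ne fun h => hAB (by rw [h]),
        fun x hx => smul_of_mem_span_singleton (h2 i) hx,
        fun x hx => smul_of_mem_span_singleton (h2 j) hx⟩

theorem rootVec_lie : ⁅rootVec 0, rootVec 1⁆ = (sl2Mk 1 0 0, 0) ∧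
    ⁅rootVec 2, rootVec 3⁆ = (0, sl2Mk 1 0 0) := by
  simp [rootVec, sl2Mk_lie]

/-- An automorphism acting as scalars on the root vectors fixes the Cartan subalgebra pointwise. -/
theorem fix_cartanPlane {g : (Sl2C × Sl2C) ≃ₗ⁅ℂ⁆ (Sl2C × Sl2C)} {α : Fin 4 → ℂ}
    (h : ∀ i, g (rootVec i) = α i • rootVec i) (x : Sl2C × Sl2C) (hx : x ∈ cartanPlane) :
    g x = x := by
  have h0 : ∀ i, α i ≠ 0 := fun i => eigenvalue_ne_zero (rootVec_ne_zero i) (h i)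
  have e1 : g (sl2Mk 1 0 0, 0) = (α 0 * α 1) • (sl2Mk 1 0 0, 0) := by
    rw [← rootVec_lie.1, LieEquiv.map_lie, h, h, smul_lie, lie_smul, smul_smul]
  have e2 : g (0, sl2Mk 1 0 0) = (α 2 * α 3) • (0, sl2Mk 1 0 0) := by
    rw [← rootVec_lie.2, LieEquiv.map_lie, h, h, smul_lie, lie_smul, smul_smul]
  have f1 : ⁅((sl2Mk 1 0 0, 0) : Sl2C × Sl2C), rootVec 0⁆ = (2 : ℂ) • rootVec 0 := by
    simp [rootVec, sl2Mk_lie, sl2Mk_smul]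
  have f2 : ⁅((0, sl2Mk 1 0 0) : Sl2C × Sl2C), rootVec 2⁆ = (2 : ℂ) • rootVec 2 := by
    simp [rootVec, sl2Mk_lie, sl2Mk_smul]
  -- Applying `g` to `⁅z, x⁆ = 2 x`, with both `z` and `x` eigenvectors, cancels the scalar of `x`
  -- and forces that of `z` to be 1.
  have key : ∀ (z : Sl2C × Sl2C) (c : ℂ) (i : Fin 4), g z = c • z →
      ⁅z, rootVec i⁆ = (2 : ℂ) • rootVec i → c = 1 := by
    intro z c i hz hzi
    have h1 := congrArg g hzi
    rw [LieEquiv.map_lie, hz, h, smul_lie, lie_smul, hzi, map_smul, h, smul_smul, smul_smul,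
      smul_smul] at h1
    have h2 := smul_left_injective ℂ (rootVec_ne_zero i) h1
    apply mul_right_cancel₀ (h0 i)
    linear_combination h2 / 2
  rw [key _ _ 0 e1 f1, one_smul] at e1
  rw [key _ _ 2 e2 f2, one_smul] at e2
  obtain ⟨s, t, rfl⟩ := Submodule.mem_span_pair.mp hx
  rw [map_add, map_smul, map_smul, e1, e2]

theorem mem_gradingDiag_rootGrading {g : (Sl2C × Sl2C) ≃ₗ⁅ℂ⁆ (Sl2C × Sl2C)}
    (h : ∀ i, ∃ α : ℂ, g (rootVec i) = α • rootVec i) : g ∈ gradingDiag rootGrading := by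
  choose α hα using h
  rintro A (rfl | ⟨i, rfl⟩)
  · exact ⟨1, fun x hx => by rw [fix_cartanPlane hα x hx, one_smul]⟩
  · exact ⟨α i, fun x hx => smul_of_mem_span_singleton (hα i) hx⟩

theorem isMADGroup_rootGrading : IsMADGroup (gradingDiag rootGrading) := by
  refine isSeparated_rootGrading.isMADGroup fun g hg => mem_gradingDiag_rootGrading fun i => ?_
  obtain ⟨α, hα⟩ := Submodule.mem_span_singleton.mp
    (hg _ (Or.inr ⟨i, rfl⟩) _ (Submodule.mem_span_singleton_self (rootVec i)))
  exact ⟨α, hα.symm⟩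

theorem prodAut_mem_gradingDiag_rootGrading {p q : Sl2C ≃ₗ⁅ℂ⁆ Sl2C}
    (hp : p ∈ diagAut cartanVec) (hq : q ∈ diagAut cartanVec) :
    prodAut p q ∈ gradingDiag rootGrading := by
  refine mem_gradingDiag_rootGrading fun i => ?_
  obtain ⟨t, -, ht⟩ := diagAut_cartanVec_apply hp
  obtain ⟨s, -, hs⟩ := diagAut_cartanVec_apply hq
  refine ⟨(![t, t⁻¹, s, s⁻¹] : Fin 4 → ℂ) i, ?_⟩
  fin_cases i <;> simp [rootVec, prodAut_apply, ht, hs, sl2Mk_smul]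

theorem rootVec_mem {Q : Set (Submodule ℂ (Sl2C × Sl2C))} (hne : ∀ B ∈ Q, B ≠ ⊥)
    (hQ : Refines Q rootGrading) (i : Fin 4) : Submodule.span ℂ {rootVec i} ∈ Q := by
  obtain ⟨S, hS, hSi⟩ := hQ _ (Or.inr ⟨i, rfl⟩)
  obtain ⟨B, hB⟩ : S.Nonempty := by
    rw [Set.nonempty_iff_ne_empty]
    rintro rfl
    rw [sSup_empty] at hSi
    exact rootVec_ne_zero i (Submodule.span_singleton_eq_bot.mp hSi.symm)
  have h1 : B ≤ Submodule.span ℂ {rootVec i} := (le_sSup hB).trans hSi.le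
  have h2 : IsAtom (Submodule.span ℂ {rootVec i}) := nonzero_span_atom _ (rootVec_ne_zero i)
  rcases h2.le_iff.mp h1 with h | h
  · exact absurd h (hne _ (hS hB))
  · rw [← h]; exact hS hB

/-- A group refinement keeps the four root lines, so its diagonal group fixes the Cartan plane
pointwise. That group must still separate the pieces of the plane, so there is only one piece. -/
theorem isFineGroupGrading_rootGrading : IsFineGroupGrading rootGrading := by
  refine ⟨isSeparated_rootGrading.isGroupGrading, fun Q hQ hQP => ?_⟩
  have hsep := hQ.isSeparated
  have hroot := rootVec_mem hsep.1 hQP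
  obtain ⟨S, hS, hSc⟩ := hQP _ (Or.inl rfl)
  have hfix : ∀ g ∈ gradingDiag Q, ∀ x ∈ cartanPlane, g x = x := by
    intro g hg
    have : ∀ i, ∃ α : ℂ, g (rootVec i) = α • rootVec i := fun i => by
      obtain ⟨α, hα⟩ := hg _ (hroot i)
      exact ⟨α, hα _ (Submodule.mem_span_singleton_self _)⟩
    choose α hα using this
    exact fix_cartanPlane hα
  have hsub : ∀ A ∈ S, ∀ B ∈ S, A = B := by
    intro A hA B hB
    by_contra hAB
    obtain ⟨g, hg, α, β, hαβ, hα, hβ⟩ := hsep.3 A (hS hA) B (hS hB) hAB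
    have hle : ∀ C ∈ S, C ≤ cartanPlane := fun C hC => hSc ▸ le_sSup hC
    apply hαβ
    rw [scalar_unique (hsep.1 A (hS hA)) hα (β := 1)
        (fun x hx => by rw [hfix g hg x (hle A hA hx), one_smul]),
      scalar_unique (hsep.1 B (hS hB)) hβ (β := 1)
        (fun x hx => by rw [hfix g hg x (hle B hB hx), one_smul])]
  obtain ⟨A, hA⟩ : S.Nonempty := by
    rw [Set.nonempty_iff_ne_empty]
    rintro rfl
    rw [sSup_empty] at hSc
    exact cartanPlane_ne_bot hSc.symm
  have hSA : S = {A} := Set.eq_singleton_iff_unique_mem.mpr ⟨hA, fun B hB => hsub B hB A hA⟩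
  rw [hSA, sSup_singleton] at hSc
  refine eq_of_subset_of_sSupIndep hQ.1.indep hQ.1.ne_bot sSup_rootGrading ?_
  rintro B (rfl | ⟨i, rfl⟩)
  · exact hSc ▸ hS hA
  · exact hroot i

end RootGrading

/-! ### Conjugating commuting diagonalizable sets into the six diagonal groups. -/

section Classification

/-- The projections of `H` to the two factors are commuting diagonalizable sets, and the factors can
be conjugated independently. -/
theorem exists_conjAut_subset_prod {H : Set ((Sl2C × Sl2C) ≃ₗ⁅ℂ⁆ (Sl2C × Sl2C))}
    (hH : IsCommDiag H) (hp : ∀ g ∈ H, ∃ p q, g = prodAut p q) :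
    ∃ c d : Sl2C ≃ₗ⁅ℂ⁆ Sl2C, ∃ b ∈ ({cartanVec, pauliVec} : Set (Fin 3 → Sl2C)),
      ∃ b' ∈ ({cartanVec, pauliVec} : Set (Fin 3 → Sl2C)),
      ∀ g ∈ conjAut (prodAut c d) H, ∃ p ∈ diagAut b, ∃ q ∈ diagAut b', g = prodAut p q := by
  have h1 : IsCommDiag {p | ∃ q, prodAut p q ∈ H} := by
    refine ⟨?_, ?_⟩
    · rintro p ⟨q, hq⟩
      exact isDiagonalizableAut_fst (hH.1 _ hq)
    · rintro p ⟨q, hq⟩ p' ⟨q', hq'⟩ x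
      exact congrArg Prod.fst (hH.2 _ hq _ hq' (x, 0))
  have h2 : IsCommDiag {q | ∃ p, prodAut p q ∈ H} := by
    refine ⟨?_, ?_⟩
    · rintro q ⟨p, hp⟩
      exact isDiagonalizableAut_snd (hH.1 _ hp)
    · rintro q ⟨p, hp⟩ q' ⟨p', hp'⟩ x
      exact congrArg Prod.snd (hH.2 _ hp _ hp' (0, x))
  have key : ∀ {R : Set (Sl2C ≃ₗ⁅ℂ⁆ Sl2C)}, IsCommDiag R → ∃ c,
      ∃ b ∈ ({cartanVec, pauliVec} : Set (Fin 3 → Sl2C)), conjAut c R ⊆ diagAut b := by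
    intro R hR
    obtain ⟨c, hc | hc⟩ := exists_conjAut_subset hR
    · exact ⟨c, _, Or.inl rfl, hc⟩
    · exact ⟨c, _, Or.inr rfl, hc⟩
  obtain ⟨c, b, hb, hc⟩ := key h1
  obtain ⟨d, b', hb', hd⟩ := key h2
  refine ⟨c, d, b, hb, b', hb', ?_⟩
  rintro _ ⟨g, hg, rfl⟩
  obtain ⟨p, q, rfl⟩ := hp g hg
  exact ⟨_, hc ⟨p, ⟨q, hg⟩, rfl⟩, _, hd ⟨q, ⟨p, hg⟩, rfl⟩, rfl⟩

/-- The six gradings of `sl(2, ℂ) ⊕ sl(2, ℂ)`. -/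
noncomputable def sixGradings : Fin 6 → Set (Submodule ℂ (Sl2C × Sl2C)) :=
  ![rootGrading, lineGrading (composedVec cartanVec pauliVec),
    lineGrading (composedVec pauliVec pauliVec), lineGrading (twistedVec cartanVec 1),
    lineGrading (twistedVec pauliVec 1),
    -- The squares 1, -1, -1 are the eigenvalues of the involution fixing the first Pauli vector.
    lineGrading (twistedVec pauliVec ![1, Complex.I, Complex.I])]

/-- The torus is divisible: with `a = d²`, conjugation by `(d⁻¹, 1)` turns `(x, y) ↦ (a (q y), q x)`
into the same map with 1 in place of `a` and `q d` in place of `q`. -/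
theorem conj_torus_twistedSet {a : Sl2C ≃ₗ⁅ℂ⁆ Sl2C} (ha : a ∈ diagAut cartanVec) :
    ∃ d : Sl2C ≃ₗ⁅ℂ⁆ Sl2C, conjAut (prodAut d LieEquiv.refl) (twistedSet a (diagAut cartanVec)) ⊆
      twistedSet LieEquiv.refl (diagAut cartanVec) := by
  obtain ⟨t, ht0, ht⟩ := diagAut_cartanVec_apply ha
  obtain ⟨s, rfl⟩ := IsAlgClosed.exists_eq_mul_self t
  have hs0 : s ≠ 0 := by rintro rfl; simp at ht0
  obtain ⟨d, hd⟩ := exists_torus hs0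
  have hds : ∀ r u w, d.symm (sl2Mk r u w) = sl2Mk r (s⁻¹ * u) (s * w) := by
    intro r u w
    apply d.injective
    change d (d.symm _) = d _
    rw [LieEquiv.apply_symm_apply, hd, ← mul_assoc, ← mul_assoc, mul_inv_cancel₀ hs0,
      inv_mul_cancel₀ hs0, one_mul, one_mul]
  refine ⟨d.symm, ?_⟩
  rintro _ ⟨_, ⟨q, hq, rfl | rfl⟩, rfl⟩
  · refine ⟨q, hq, Or.inl (LieEquiv.ext fun ⟨x, y⟩ => Prod.ext ?_ rfl)⟩
    change d.symm (q (d x)) = q x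
    obtain ⟨u, hu0, hu⟩ := diagAut_cartanVec_apply hq
    obtain ⟨x₁, x₂, x₃, rfl⟩ := exists_eq_sl2Mk x
    rw [hd, hu, hds, hu, sl2Mk_inj]
    refine ⟨rfl, ?_, ?_⟩ <;> field_simp
  · obtain ⟨u, hu0, hu⟩ := diagAut_cartanVec_apply hq
    have hqd : ∀ k, ∃ α : ℂ, q (d (cartanVec k)) = α • cartanVec k := by
      intro k
      refine ⟨(![1, u * s, u⁻¹ * s⁻¹] : Fin 3 → ℂ) k, ?_⟩
      fin_cases k <;> simp [cartanVec, hd, hu, sl2Mk_smul]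
    refine ⟨d.trans q, hqd, Or.inr (LieEquiv.ext fun ⟨x, y⟩ => Prod.ext ?_ rfl)⟩
    change d.symm (a (q y)) = q (d y)
    obtain ⟨x₁, x₂, x₃, rfl⟩ := exists_eq_sl2Mk y
    rw [hd, hu, ht, hu, hds, sl2Mk_inj]
    refine ⟨rfl, ?_, ?_⟩ <;> field_simp

theorem conjAut_rotation {g : Sl2C ≃ₗ⁅ℂ⁆ Sl2C}
    (hg : ∀ k, ∃ t : ℂ, t ≠ 0 ∧ g (pauliVec k) = t • pauliVec (k + 1)) {q : Sl2C ≃ₗ⁅ℂ⁆ Sl2C}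
    {k : Fin 3} {α : ℂ} (hq : q (pauliVec k) = α • pauliVec k) :
    ((g.symm.trans q).trans g) (pauliVec (k + 1)) = α • pauliVec (k + 1) := by
  obtain ⟨t, ht, hgk⟩ := hg k
  have : g.symm (pauliVec (k + 1)) = t⁻¹ • pauliVec k := by
    apply g.injective
    change g (g.symm _) = g _
    rw [LieEquiv.apply_symm_apply, map_smul, hgk, smul_smul, inv_mul_cancel₀ ht, one_smul]
  change g (q (g.symm _)) = _
  rw [this, map_smul, hq, map_smul, map_smul, hgk, smul_comm, smul_smul t⁻¹, inv_mul_cancel₀ ht,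
    one_smul]

theorem conjAut_rotation_subset {g : Sl2C ≃ₗ⁅ℂ⁆ Sl2C}
    (hg : ∀ k, ∃ t : ℂ, t ≠ 0 ∧ g (pauliVec k) = t • pauliVec (k + 1)) :
    conjAut g (diagAut pauliVec) ⊆ diagAut pauliVec := by
  rintro _ ⟨q, hq, rfl⟩ k
  obtain ⟨α, hα⟩ := hq (k - 1)
  refine ⟨α, ?_⟩
  have := conjAut_rotation hg hα
  rwa [sub_add_cancel] at this

/-- Each conjugation by the rotation moves the fixed index `l` of the involution one step on, so
after at most three steps it is 0, the index used in the sixth grading. -/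
theorem conj_pauli_twistedSet {a : Sl2C ≃ₗ⁅ℂ⁆ Sl2C} {l : Fin 3}
    (ha : ∀ k, a (pauliVec k) = (if k = l then (1 : ℂ) else -1) • pauliVec k) :
    ∃ e, conjAut e (twistedSet a (diagAut pauliVec)) ⊆ gradingDiag (sixGradings 5) := by
  obtain ⟨g, hg⟩ := exists_pauli_rotation
  have hstep : ∀ {l : Fin 3} {a : Sl2C ≃ₗ⁅ℂ⁆ Sl2C},
      (∀ k, a (pauliVec k) = (if k = l then (1 : ℂ) else -1) • pauliVec k) →
      ∃ a' : Sl2C ≃ₗ⁅ℂ⁆ Sl2C,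
        (∀ k, a' (pauliVec k) = (if k = l + 1 then (1 : ℂ) else -1) • pauliVec k) ∧
        conjAut (prodAut g g) (twistedSet a (diagAut pauliVec)) ⊆
          twistedSet a' (diagAut pauliVec) := by
    intro l a ha
    refine ⟨(g.symm.trans a).trans g, fun k => ?_, (conjAut_twistedSet g a _).trans
      (twistedSet_mono _ (conjAut_rotation_subset hg))⟩
    have := conjAut_rotation hg (ha (k - 1))
    rw [sub_add_cancel] at this
    rw [this]
    simp only [sub_eq_iff_eq_add]
  have h0 : ∀ {a : Sl2C ≃ₗ⁅ℂ⁆ Sl2C},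
      (∀ k, a (pauliVec k) = (if k = 0 then (1 : ℂ) else -1) • pauliVec k) →
      twistedSet a (diagAut pauliVec) ⊆ gradingDiag (sixGradings 5) := by
    intro a ha
    refine twistedSet_subset_gradingDiag fun k => ?_
    rw [ha]
    congr 1
    fin_cases k <;> simp
  obtain ⟨a₁, h₁, hs₁⟩ := hstep ha
  obtain ⟨a₂, h₂, hs₂⟩ := hstep h₁
  obtain ⟨a₃, h₃, hs₃⟩ := hstep h₂
  fin_cases l
  · refine ⟨((prodAut g g).trans (prodAut g g)).trans (prodAut g g), ?_⟩
    rw [conjAut_trans, conjAut_trans]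
    exact (conjAut_mono _ ((conjAut_mono _ hs₁).trans hs₂)).trans (hs₃.trans (h0 h₃))
  · refine ⟨(prodAut g g).trans (prodAut g g), ?_⟩
    rw [conjAut_trans]
    exact (conjAut_mono _ hs₁).trans (hs₂.trans (h0 h₂))
  · exact ⟨prodAut g g, hs₁.trans (h0 h₁)⟩

theorem exists_conjAut_subset_twistedSet {b : Fin 3 → Sl2C} {c a : Sl2C ≃ₗ⁅ℂ⁆ Sl2C}
    {Q : Set (Sl2C ≃ₗ⁅ℂ⁆ Sl2C)} (ha : a ∈ Q) (hc : conjAut c Q ⊆ diagAut b) :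
    ∃ a' ∈ diagAut b, conjAut (prodAut c c) (twistedSet a Q) ⊆ twistedSet a' (diagAut b) :=
  ⟨_, hc ⟨a, ha, rfl⟩, (conjAut_twistedSet c a Q).trans (twistedSet_mono _ hc)⟩

/-- Up to conjugacy, a commuting set of diagonalizable automorphisms of `sl(2, ℂ) ⊕ sl(2, ℂ)` acts
diagonally on one of the six gradings. -/
theorem exists_conjAut_subset_sixGradings {H : Set ((Sl2C × Sl2C) ≃ₗ⁅ℂ⁆ (Sl2C × Sl2C))}
    (hH : IsCommDiag H) : ∃ i e, conjAut e H ⊆ gradingDiag (sixGradings i) := by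
  by_cases hp : ∀ g ∈ H, ∃ p q, g = prodAut p q
  · obtain ⟨c, d, b, hb, b', hb', hcd⟩ := exists_conjAut_subset_prod hH hp
    rcases hb with rfl | rfl <;> rcases hb' with rfl | rfl
    -- Two Cartan factors lead to the root grading: the torus acts trivially on the whole Cartan
    -- plane.
    · refine ⟨0, prodAut c d, fun g hg => ?_⟩
      obtain ⟨p, hp, q, hq, rfl⟩ := hcd g hg
      exact prodAut_mem_gradingDiag_rootGrading hp hq
    · refine ⟨1, prodAut c d, fun g hg => ?_⟩
      obtain ⟨p, hp, q, hq, rfl⟩ := hcd g hg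
      exact prodAut_mem_gradingDiag hp hq
    · refine ⟨1, (prodAut c d).trans (swapAut LieEquiv.refl LieEquiv.refl), ?_⟩
      rw [conjAut_trans]
      rintro _ ⟨g, hg, rfl⟩
      obtain ⟨p, hp, q, hq, rfl⟩ := hcd g hg
      exact prodAut_mem_gradingDiag hq hp
    · refine ⟨2, prodAut c d, fun g hg => ?_⟩
      obtain ⟨p, hp, q, hq, rfl⟩ := hcd g hg
      exact prodAut_mem_gradingDiag hp hq
  · push Not at hp
    obtain ⟨g, hg, hgp⟩ := hp
    obtain ⟨p, q, h⟩ | ⟨p, q, rfl⟩ := exists_eq_prodAut_or_swapAut g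
    · exact absurd h (hgp p q)
    -- Conjugation by `(q, 1)` turns `(x, y) ↦ (p y, q x)` into `(x, y) ↦ (q (p y), x)`.
    have hH' := hH.conjAut (prodAut q LieEquiv.refl)
    have ha : swapAut (p.trans q) LieEquiv.refl ∈ conjAut (prodAut q LieEquiv.refl) H := by
      refine ⟨_, hg, LieEquiv.ext fun ⟨x, y⟩ => Prod.ext rfl ?_⟩
      change q (q.symm x) = x
      exact q.apply_symm_apply x
    obtain ⟨Q, hQ, haQ, hHQ⟩ := subset_twistedSet hH' ha
    suffices h : ∃ i e, conjAut e (twistedSet (p.trans q) Q) ⊆ gradingDiag (sixGradings i) by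
      obtain ⟨i, e, he⟩ := h
      refine ⟨i, (prodAut q LieEquiv.refl).trans e, ?_⟩
      rw [conjAut_trans]
      exact (conjAut_mono e hHQ).trans he
    obtain ⟨c, hc | hc⟩ := exists_conjAut_subset hQ
    · obtain ⟨a', ha', hc'⟩ := exists_conjAut_subset_twistedSet haQ hc
      obtain ⟨d, hd⟩ := conj_torus_twistedSet ha'
      refine ⟨3, (prodAut c c).trans (prodAut d LieEquiv.refl), ?_⟩
      rw [conjAut_trans]
      exact (conjAut_mono _ hc').trans (hd.trans (twistedSet_subset_gradingDiag fun k => by simp))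
    · obtain ⟨a', ha', hc'⟩ := exists_conjAut_subset_twistedSet haQ hc
      rcases diagAut_pauliVec_apply ha' with h | ⟨l, h⟩
      · exact ⟨4, _, hc'.trans (twistedSet_subset_gradingDiag fun k => by simp [h])⟩
      · obtain ⟨e, he⟩ := conj_pauli_twistedSet h
        refine ⟨5, (prodAut c c).trans e, ?_⟩
        rw [conjAut_trans]
        exact (conjAut_mono _ hc').trans he

end Classification

/-! ### The isomorphism of `sl(2, ℂ) ⊕ sl(2, ℂ)` with `o(4, ℂ)`. -/

section Isomorphism

/-- The skew-symmetric `4 × 4` matrices in coordinates. -/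
def so4Mk (p₁ p₂ p₃ q₁ q₂ q₃ : ℂ) : O4C :=
  ⟨!![0, q₁, q₂, q₃; -q₁, 0, -p₃, p₂; -q₂, p₃, 0, -p₁; -q₃, -p₂, p₁, 0], by
    rw [LieAlgebra.Orthogonal.mem_so]
    ext i j
    fin_cases i <;> fin_cases j <;> simp⟩

theorem so4_bracket (x y : O4C) : ⁅x, y⁆.val = x.val * y.val - y.val * x.val := rfl

/-- In vector notation the bracket is `(p × p' + q × q', p × q' + q × p')`. So `p + q` and `p - q`
each bracket by the cross product, and `o(4, ℂ)` splits into two commuting ideals. -/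
theorem so4Mk_lie (p₁ p₂ p₃ q₁ q₂ q₃ p₁' p₂' p₃' q₁' q₂' q₃' : ℂ) :
    ⁅so4Mk p₁ p₂ p₃ q₁ q₂ q₃, so4Mk p₁' p₂' p₃' q₁' q₂' q₃'⁆ =
      so4Mk (p₂ * p₃' - p₃ * p₂' + (q₂ * q₃' - q₃ * q₂'))
        (p₃ * p₁' - p₁ * p₃' + (q₃ * q₁' - q₁ * q₃'))
        (p₁ * p₂' - p₂ * p₁' + (q₁ * q₂' - q₂ * q₁'))
        (p₂ * q₃' - p₃ * q₂' + (q₂ * p₃' - q₃ * p₂'))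
        (p₃ * q₁' - p₁ * q₃' + (q₃ * p₁' - q₁ * p₃'))
        (p₁ * q₂' - p₂ * q₁' + (q₁ * p₂' - q₂ * p₁')) := by
  apply Subtype.ext
  rw [so4_bracket]
  ext i j
  fin_cases i <;> fin_cases j <;> simp [so4Mk] <;> ring

theorem so4Mk_add (p₁ p₂ p₃ q₁ q₂ q₃ p₁' p₂' p₃' q₁' q₂' q₃' : ℂ) :
    so4Mk p₁ p₂ p₃ q₁ q₂ q₃ + so4Mk p₁' p₂' p₃' q₁' q₂' q₃' =
      so4Mk (p₁ + p₁') (p₂ + p₂') (p₃ + p₃') (q₁ + q₁') (q₂ + q₂') (q₃ + q₃') := by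
  apply Subtype.ext
  ext i j
  fin_cases i <;> fin_cases j <;> simp [so4Mk] <;> ring

theorem so4Mk_smul (t p₁ p₂ p₃ q₁ q₂ q₃ : ℂ) :
    t • so4Mk p₁ p₂ p₃ q₁ q₂ q₃ =
      so4Mk (t * p₁) (t * p₂) (t * p₃) (t * q₁) (t * q₂) (t * q₃) := by
  apply Subtype.ext
  ext i j
  fin_cases i <;> fin_cases j <;> simp [so4Mk]

theorem so4Mk_inj {p₁ p₂ p₃ q₁ q₂ q₃ p₁' p₂' p₃' q₁' q₂' q₃' : ℂ}
    (h : so4Mk p₁ p₂ p₃ q₁ q₂ q₃ = so4Mk p₁' p₂' p₃' q₁' q₂' q₃') :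
    p₁ = p₁' ∧ p₂ = p₂' ∧ p₃ = p₃' ∧ q₁ = q₁' ∧ q₂ = q₂' ∧ q₃ = q₃' := by
  have h' : ∀ i j, (so4Mk p₁ p₂ p₃ q₁ q₂ q₃).1 i j = (so4Mk p₁' p₂' p₃' q₁' q₂' q₃').1 i j :=
    fun i j => by rw [h]
  have h1 := h' 3 2
  have h2 := h' 1 3
  have h3 := h' 2 1
  have h4 := h' 0 1
  have h5 := h' 0 2
  have h6 := h' 0 3
  simp [so4Mk] at h1 h2 h3 h4 h5 h6
  exact ⟨h1, h2, h3, h4, h5, h6⟩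

theorem exists_eq_so4Mk (x : O4C) :
    ∃ p₁ p₂ p₃ q₁ q₂ q₃, x = so4Mk p₁ p₂ p₃ q₁ q₂ q₃ := by
  have h := (LieAlgebra.Orthogonal.mem_so (Fin 4) ℂ x.1).mp x.2
  have h' : ∀ i j, x.1 j i = -x.1 i j := fun i j => congrFun (congrFun h i) j
  have hd : ∀ i, x.1 i i = 0 := fun i => by linear_combination h' i i / 2
  refine ⟨x.1 3 2, x.1 1 3, x.1 2 1, x.1 0 1, x.1 0 2, x.1 0 3, Subtype.ext ?_⟩
  ext i j
  fin_cases i <;> fin_cases j <;> simp [so4Mk, hd] <;> exact h' _ _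

/-- The isomorphism from `sl(2, ℂ) ⊕ sl(2, ℂ)` to `o(4, ℂ)`, in coordinates. -/
noncomputable def so4OfSl2 (x : Sl2C × Sl2C) : O4C :=
  -- Here `p + q` depends on the first factor only and `p - q` on the second only. Each has the form
  -- `(i (b + c), c - b, 2 i a)`, which identifies the bracket of `sl(2, ℂ)` with the cross product.
  so4Mk (Complex.I * (x.1.1 0 1 + x.1.1 1 0 + (x.2.1 0 1 + x.2.1 1 0)) / 2)
    (-(x.1.1 0 1 - x.1.1 1 0 + (x.2.1 0 1 - x.2.1 1 0)) / 2)
    (Complex.I * (x.1.1 0 0 + x.2.1 0 0))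
    (Complex.I * (x.1.1 0 1 + x.1.1 1 0 - (x.2.1 0 1 + x.2.1 1 0)) / 2)
    (-(x.1.1 0 1 - x.1.1 1 0 - (x.2.1 0 1 - x.2.1 1 0)) / 2)
    (Complex.I * (x.1.1 0 0 - x.2.1 0 0))

theorem so4OfSl2_mk (a b c a' b' c' : ℂ) : so4OfSl2 (sl2Mk a b c, sl2Mk a' b' c') =
    so4Mk (Complex.I * (b + c + (b' + c')) / 2) (-(b - c + (b' - c')) / 2) (Complex.I * (a + a'))
      (Complex.I * (b + c - (b' + c')) / 2) (-(b - c - (b' - c')) / 2) (Complex.I * (a - a')) := by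
  simp [so4OfSl2, sl2Mk]

/-- The homomorphism from `sl(2, ℂ) ⊕ sl(2, ℂ)` to `o(4, ℂ)`. -/
noncomputable def so4Hom : Sl2C × Sl2C →ₗ⁅ℂ⁆ O4C where
  toFun := so4OfSl2
  map_add' := by
    rintro ⟨x, y⟩ ⟨x', y'⟩
    obtain ⟨a, b, c, rfl⟩ := exists_eq_sl2Mk x
    obtain ⟨d, e, f, rfl⟩ := exists_eq_sl2Mk y
    obtain ⟨a', b', c', rfl⟩ := exists_eq_sl2Mk x'
    obtain ⟨d', e', f', rfl⟩ := exists_eq_sl2Mk y'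
    rw [Prod.mk_add_mk, sl2Mk_add, sl2Mk_add, so4OfSl2_mk, so4OfSl2_mk, so4OfSl2_mk, so4Mk_add]
    congr 1 <;> ring
  map_smul' := by
    rintro t ⟨x, y⟩
    obtain ⟨a, b, c, rfl⟩ := exists_eq_sl2Mk x
    obtain ⟨d, e, f, rfl⟩ := exists_eq_sl2Mk y
    rw [Prod.smul_mk, sl2Mk_smul, sl2Mk_smul, so4OfSl2_mk, so4OfSl2_mk, RingHom.id_apply,
      so4Mk_smul]
    congr 1 <;> ring
  map_lie' := by
    rintro ⟨x, y⟩ ⟨x', y'⟩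
    obtain ⟨a, b, c, rfl⟩ := exists_eq_sl2Mk x
    obtain ⟨d, e, f, rfl⟩ := exists_eq_sl2Mk y
    obtain ⟨a', b', c', rfl⟩ := exists_eq_sl2Mk x'
    obtain ⟨d', e', f', rfl⟩ := exists_eq_sl2Mk y'
    change so4OfSl2 (⁅sl2Mk a b c, sl2Mk a' b' c'⁆, ⁅sl2Mk d e f, sl2Mk d' e' f'⁆) = _
    rw [sl2Mk_lie, sl2Mk_lie, so4OfSl2_mk, so4OfSl2_mk, so4OfSl2_mk, so4Mk_lie]
    have hI : Complex.I * Complex.I = -1 := Complex.I_mul_I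
    congr 1
    · ring
    · linear_combination (-(a * (b' + c') - a' * (b + c)) - (d * (e' + f') - d' * (e + f))) * hI
    · ring
    · ring
    · linear_combination (-(a * (b' + c') - a' * (b + c)) + (d * (e' + f') - d' * (e + f))) * hI
    · ring

theorem so4Hom_bijective : Function.Bijective so4Hom := by
  have hI : Complex.I * Complex.I = -1 := Complex.I_mul_I
  constructor
  · rintro ⟨x, y⟩ ⟨x', y'⟩ h
    obtain ⟨a, b, c, rfl⟩ := exists_eq_sl2Mk x
    obtain ⟨d, e, f, rfl⟩ := exists_eq_sl2Mk y
    obtain ⟨a', b', c', rfl⟩ := exists_eq_sl2Mk x'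
    obtain ⟨d', e', f', rfl⟩ := exists_eq_sl2Mk y'
    change so4OfSl2 _ = so4OfSl2 _ at h
    rw [so4OfSl2_mk, so4OfSl2_mk] at h
    obtain ⟨h1, h2, h3, h4, h5, h6⟩ := so4Mk_inj h
    have h1' := mul_left_cancel₀ Complex.I_ne_zero (by linear_combination 2 * h1 :
      Complex.I * (b + c + (e + f)) = Complex.I * (b' + c' + (e' + f')))
    have h3' := mul_left_cancel₀ Complex.I_ne_zero h3
    have h4' := mul_left_cancel₀ Complex.I_ne_zero (by linear_combination 2 * h4 :
      Complex.I * (b + c - (e + f)) = Complex.I * (b' + c' - (e' + f')))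
    have h6' := mul_left_cancel₀ Complex.I_ne_zero h6
    rw [Prod.mk.injEq, sl2Mk_inj, sl2Mk_inj]
    refine ⟨⟨?_, ?_, ?_⟩, ?_, ?_, ?_⟩
    · linear_combination (h3' + h6') / 2
    · linear_combination (h1' + h4') / 4 - (h2 + h5) / 2
    · linear_combination (h1' + h4') / 4 + (h2 + h5) / 2
    · linear_combination (h3' - h6') / 2
    · linear_combination (h1' - h4') / 4 - (h2 - h5) / 2
    · linear_combination (h1' - h4') / 4 + (h2 - h5) / 2
  · intro x
    obtain ⟨p₁, p₂, p₃, q₁, q₂, q₃, rfl⟩ := exists_eq_so4Mk x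
    refine ⟨(sl2Mk (-Complex.I * (p₃ + q₃) / 2) ((-Complex.I * (p₁ + q₁) - (p₂ + q₂)) / 2)
      ((-Complex.I * (p₁ + q₁) + (p₂ + q₂)) / 2),
      sl2Mk (-Complex.I * (p₃ - q₃) / 2) ((-Complex.I * (p₁ - q₁) - (p₂ - q₂)) / 2)
      ((-Complex.I * (p₁ - q₁) + (p₂ - q₂)) / 2)), ?_⟩
    change so4OfSl2 _ = _
    rw [so4OfSl2_mk]
    congr 1
    · linear_combination -p₁ * hI
    · ring
    · linear_combination -p₃ * hI
    · linear_combination -q₁ * hI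
    · ring
    · linear_combination -q₃ * hI

/-- The isomorphism from `sl(2, ℂ) ⊕ sl(2, ℂ)` to `o(4, ℂ)`. -/
noncomputable def so4Equiv : (Sl2C × Sl2C) ≃ₗ⁅ℂ⁆ O4C := LieEquiv.ofBijective so4Hom so4Hom_bijective

end Isomorphism

/-! ### The first grading as the root space decomposition of a Cartan subalgebra. -/

section CartanGrading

variable {L : Type} [LieRing L] [LieAlgebra ℂ L]

theorem mem_cartanPlane {x : Sl2C × Sl2C} :
    x ∈ cartanPlane ↔ ∃ s t, x = (sl2Mk s 0 0, sl2Mk t 0 0) := by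
  rw [cartanPlane, Submodule.mem_span_pair]
  constructor
  · rintro ⟨s, t, rfl⟩
    exact ⟨s, t, by simp [sl2Mk_smul]⟩
  · rintro ⟨s, t, rfl⟩
    exact ⟨s, t, by simp [sl2Mk_smul]⟩

theorem cartanPlane_lie {x y : Sl2C × Sl2C} (hx : x ∈ cartanPlane) (hy : y ∈ cartanPlane) :
    ⁅x, y⁆ = 0 := by
  obtain ⟨s, t, rfl⟩ := mem_cartanPlane.mp hx
  obtain ⟨s', t', rfl⟩ := mem_cartanPlane.mp hy
  simp [sl2Mk_lie, sl2Mk_zero]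

/-- The Cartan subalgebra of a Lie algebra isomorphic to `sl(2, ℂ) ⊕ sl(2, ℂ)`. -/
noncomputable def cartanSubalgebra (e : (Sl2C × Sl2C) ≃ₗ⁅ℂ⁆ L) : LieSubalgebra ℂ L :=
  { cartanPlane.map (e : (Sl2C × Sl2C) →ₗ[ℂ] L) with
    lie_mem' := by
      rintro _ _ ⟨x, hx, rfl⟩ ⟨y, hy, rfl⟩
      refine ⟨0, zero_mem _, ?_⟩
      change e 0 = ⁅e x, e y⁆
      rw [← LieEquiv.map_lie, cartanPlane_lie hx hy] }

theorem mem_cartanSubalgebra {e : (Sl2C × Sl2C) ≃ₗ⁅ℂ⁆ L} {x : Sl2C × Sl2C} :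
    e x ∈ cartanSubalgebra e ↔ x ∈ cartanPlane := by
  constructor
  · rintro ⟨y, hy, h⟩
    exact e.injective h ▸ hy
  · exact fun h => ⟨x, h, rfl⟩

theorem isCartanSubalgebra_cartanSubalgebra (e : (Sl2C × Sl2C) ≃ₗ⁅ℂ⁆ L) :
    (cartanSubalgebra e).IsCartanSubalgebra := by
  have : IsLieAbelian (cartanSubalgebra e) := by
    refine ⟨fun x y => Subtype.ext ?_⟩
    obtain ⟨_, x, hx, rfl⟩ := x
    obtain ⟨_, y, hy, rfl⟩ := y
    change ⁅e x, e y⁆ = 0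
    rw [← LieEquiv.map_lie, cartanPlane_lie hx hy, map_zero]
  refine ⟨inferInstance, le_antisymm (fun z hz => ?_) (LieSubalgebra.le_normalizer _)⟩
  obtain ⟨⟨x, y⟩, rfl⟩ : ∃ w, z = e w := ⟨e.symm z, (e.apply_symm_apply z).symm⟩
  rw [LieSubalgebra.mem_normalizer_iff] at hz
  obtain ⟨a, b, c, rfl⟩ := exists_eq_sl2Mk x
  obtain ⟨a', b', c', rfl⟩ := exists_eq_sl2Mk y
  -- One regular element detects the normalizer: bracketing with it doubles the off-diagonal entries
  -- up to sign, so these must vanish.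
  have h := hz (e (sl2Mk 1 0 0, sl2Mk 1 0 0)) (mem_cartanSubalgebra.mpr
    (mem_cartanPlane.mpr ⟨1, 1, rfl⟩))
  rw [← LieEquiv.map_lie, mem_cartanSubalgebra, mem_cartanPlane] at h
  obtain ⟨s, t, h⟩ := h
  simp [sl2Mk_lie, sl2Mk_inj] at h
  rw [mem_cartanSubalgebra, mem_cartanPlane]
  exact ⟨a, a', by simp [h]⟩

/-- Every member lies in a weight space with an explicit weight. Root spaces are independent, so
distinctness of the weights suffices to identify them with the members. -/
theorem isCartanGrading_mapGrading (e : (Sl2C × Sl2C) ≃ₗ⁅ℂ⁆ L) :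
    IsCartanGrading (mapGrading e rootGrading) := by
  have hC := isCartanSubalgebra_cartanSubalgebra e
  have hsep := isSeparated_rootGrading.mapGrading e
  refine ⟨cartanSubalgebra e, hC, ?_⟩
  have hroot : ∀ (i : Fin 4) (s t : ℂ), ⁅((sl2Mk s 0 0, sl2Mk t 0 0) : Sl2C × Sl2C), rootVec i⁆ =
      (![2 * s, -2 * s, 2 * t, -2 * t] : Fin 4 → ℂ) i • rootVec i := by
    intro i s t
    fin_cases i <;> simp [rootVec, sl2Mk_lie, sl2Mk_smul, sl2Mk_neg]
  have hχ : ∀ A ∈ mapGrading e rootGrading, ∃ χ : cartanSubalgebra e → ℂ,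
      ∀ x ∈ A, ∀ y : cartanSubalgebra e, ⁅y.1, x⁆ = χ y • x := by
    rintro _ ⟨A, rfl | ⟨i, rfl⟩, rfl⟩
    · refine ⟨0, ?_⟩
      rintro _ ⟨x, hx, rfl⟩ ⟨_, y, hy, rfl⟩
      change ⁅e y, e x⁆ = (0 : ℂ) • e x
      rw [← LieEquiv.map_lie, cartanPlane_lie hy hx, map_zero, zero_smul]
    · have : ∀ y : cartanSubalgebra e, ∃ c : ℂ, ⁅y.1, e (rootVec i)⁆ = c • e (rootVec i) := by
        rintro ⟨_, y, hy, rfl⟩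
        obtain ⟨s, t, rfl⟩ := mem_cartanPlane.mp hy
        refine ⟨(![2 * s, -2 * s, 2 * t, -2 * t] : Fin 4 → ℂ) i, ?_⟩
        change ⁅e _, e _⁆ = _
        rw [← LieEquiv.map_lie, hroot, map_smul]
      choose χ hχ using this
      refine ⟨χ, ?_⟩
      rintro _ ⟨x, hx, rfl⟩ y
      obtain ⟨t, rfl⟩ := Submodule.mem_span_singleton.mp hx
      change ⁅y.1, e (t • rootVec i)⁆ = χ y • e (t • rootVec i)
      rw [map_smul, lie_smul, hχ, smul_comm]
  choose! c hc using hχ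
  refine (Submodule.setOf_ne_bot_eq_of_iSupIndep (c := c) (B := fun χ =>
    (LieAlgebra.rootSpace (cartanSubalgebra e) χ).toSubmodule)
    (LieSubmodule.iSupIndep_toSubmodule.mpr (LieModule.iSupIndep_genWeightSpace _ _ _))
    hsep.1 hsep.2 (fun A hA x hx => ?_) ?_).symm
  · refine LieModule.weightSpace_le_genWeightSpace L (c A) ?_
    rw [LieModule.mem_weightSpace]
    exact fun y => hc A hA x hx y
  -- On this element the five weights take the distinct values 0, 2, -2, 6, -6.
  · let y : cartanSubalgebra e := ⟨e (sl2Mk 1 0 0, sl2Mk 3 0 0), mem_cartanSubalgebra.mpr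
      (mem_cartanPlane.mpr ⟨1, 3, rfl⟩)⟩
    have hy0 : c (cartanPlane.map (e : (Sl2C × Sl2C) →ₗ[ℂ] L)) y = 0 := by
      have hm : e (sl2Mk 1 0 0, 0) ∈ cartanPlane.map (e : (Sl2C × Sl2C) →ₗ[ℂ] L) :=
        ⟨_, mem_cartanPlane.mpr ⟨1, 0, by rw [sl2Mk_zero]⟩, rfl⟩
      have h := hc _ ⟨_, Or.inl rfl, rfl⟩ _ hm y
      rw [← LieEquiv.map_lie, cartanPlane_lie (mem_cartanPlane.mpr ⟨1, 3, rfl⟩)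
        (mem_cartanPlane.mpr ⟨1, 0, by rw [sl2Mk_zero]⟩), map_zero] at h
      refine (smul_eq_zero.mp h.symm).resolve_right fun h => ?_
      have := e.injective (h.trans (map_zero e).symm)
      simp [sl2Mk_eq_zero] at this
    have hyi : ∀ i, c ((Submodule.span ℂ {rootVec i}).map (e : (Sl2C × Sl2C) →ₗ[ℂ] L)) y =
        (![2, -2, 6, -6] : Fin 4 → ℂ) i := by
      intro i
      have h := hc _ ⟨_, Or.inr ⟨i, rfl⟩, rfl⟩ _
        ⟨rootVec i, Submodule.mem_span_singleton_self _, rfl⟩ y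
      change ⁅e _, e _⁆ = _ • e _ at h
      rw [← LieEquiv.map_lie, hroot, map_smul] at h
      have h0 : e (rootVec i) ≠ 0 := fun h => rootVec_ne_zero i (e.injective (h.trans (map_zero e).symm))
      rw [← smul_left_injective ℂ h0 h]
      fin_cases i <;> norm_num
    rintro _ ⟨A, hA | ⟨i, hA⟩, rfl⟩ _ ⟨B, hB | ⟨j, hB⟩, rfl⟩ h <;> subst hA <;> subst hB
    · rfl
    · have := congrFun h y
      beta_reduce at this
      rw [hy0, hyi] at this
      fin_cases j <;> norm_num at this
    · have := congrFun h y
      beta_reduce at this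
      rw [hy0, hyi] at this
      fin_cases i <;> norm_num at this
    · have := congrFun h y
      beta_reduce at this
      rw [hyi, hyi] at this
      fin_cases i <;> fin_cases j <;> first | rfl | (norm_num at this)

end CartanGrading

/-! ### Gradings composed of two gradings of `sl(2, ℂ)`. -/

section Composition

theorem sl2Line_eq (a b c : ℂ) : sl2Line !![a, b; c, -a] = Submodule.span ℂ {sl2Mk a b c} := by
  rw [sl2Line]
  congr 1
  ext X
  exact ⟨fun h => Subtype.ext h, fun h => congrArg Subtype.val h⟩

theorem sl2Cartan_eq : sl2Cartan = lineGrading cartanVec := by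
  have h1 := sl2Line_eq 1 0 0
  have h2 := sl2Line_eq 0 1 0
  have h3 := sl2Line_eq 0 0 1
  rw [neg_zero] at h2 h3
  rw [sl2Cartan, h1, h2, h3]
  ext A
  simp only [lineGrading, Set.mem_insert_iff, Set.mem_singleton_iff, Set.mem_range,
    Fin.exists_fin_succ, cartanVec]
  simp [eq_comm]

theorem sl2Pauli_eq : sl2Pauli = lineGrading pauliVec := by
  have h1 := sl2Line_eq 1 0 0
  have h2 := sl2Line_eq 0 1 1
  have h3 := sl2Line_eq 0 1 (-1)
  rw [neg_zero] at h2 h3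
  rw [sl2Pauli, h1, h2, h3]
  ext A
  simp only [lineGrading, Set.mem_insert_iff, Set.mem_singleton_iff, Set.mem_range,
    Fin.exists_fin_succ, pauliVec]
  simp [eq_comm]

theorem isComposedOf_mapGrading (φ : (Sl2C × Sl2C) ≃ₗ⁅ℂ⁆ O4C) (b b' : Fin 3 → Sl2C) :
    IsComposedOf (mapGrading φ (lineGrading (composedVec b b'))) (lineGrading b)
      (lineGrading b') := by
  refine ⟨φ, ?_⟩
  have h : ∀ x : Sl2C, (Submodule.span ℂ {x}).prod (⊥ : Submodule ℂ Sl2C) =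
      Submodule.span ℂ {(x, (0 : Sl2C))} := by
    intro x
    ext ⟨u, v⟩
    simp only [Submodule.mem_prod, Submodule.mem_span_singleton, Submodule.mem_bot, Prod.smul_mk,
      smul_zero, Prod.mk.injEq]
    exact ⟨fun ⟨⟨t, ht⟩, hv⟩ => ⟨t, ht, hv.symm⟩, fun ⟨t, ht, hv⟩ => ⟨⟨t, ht⟩, hv.symm⟩⟩
  have h' : ∀ x : Sl2C, (⊥ : Submodule ℂ Sl2C).prod (Submodule.span ℂ {x}) =
      Submodule.span ℂ {((0 : Sl2C), x)} := by
    intro x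
    ext ⟨u, v⟩
    simp only [Submodule.mem_prod, Submodule.mem_span_singleton, Submodule.mem_bot, Prod.smul_mk,
      smul_zero, Prod.mk.injEq]
    exact ⟨fun ⟨hu, t, ht⟩ => ⟨t, hu.symm, ht⟩, fun ⟨t, hu, ht⟩ => ⟨hu.symm, t, ht⟩⟩
  rw [mapGrading, lineGrading, lineGrading, lineGrading, ← Set.range_comp, ← Set.range_comp,
    ← Set.range_comp, Sum.range_eq]
  refine congrArg₂ (· ∪ ·) (congrArg Set.range (funext fun k => ?_))
    (congrArg Set.range (funext fun k => ?_))
  · exact (congrArg _ (h (b k))).symm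
  · exact (congrArg _ (h' (b' k))).symm

end Composition

/-! ### Invariants telling the six gradings apart. -/

section Invariants

theorem sl2Mk_diag_ne_zero : sl2Mk 1 0 0 ≠ 0 := by simp [sl2Mk_eq_zero]

/-- Some member contains a nonzero vector of one of the two simple ideals. -/
def HasIdealVector (P : Set (Submodule ℂ (Sl2C × Sl2C))) : Prop :=
  ∃ A ∈ P, ∃ x ∈ A, x ≠ 0 ∧ (x.1 = 0 ∨ x.2 = 0)

theorem apply_fst_or_snd (θ : (Sl2C × Sl2C) ≃ₗ⁅ℂ⁆ (Sl2C × Sl2C)) {x : Sl2C × Sl2C}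
    (h : x.1 = 0 ∨ x.2 = 0) : (θ x).1 = 0 ∨ (θ x).2 = 0 := by
  obtain ⟨x, y⟩ := x
  rcases exists_eq_prodAut_or_swapAut θ with ⟨p, q, rfl⟩ | ⟨p, q, rfl⟩
  · rw [prodAut_apply]
    exact h.imp (fun h => by simp_all) (fun h => by simp_all)
  · rw [swapAut_apply]
    exact h.symm.imp (fun h => by simp_all) (fun h => by simp_all)

theorem HasIdealVector.map (θ : (Sl2C × Sl2C) ≃ₗ⁅ℂ⁆ (Sl2C × Sl2C))
    {P : Set (Submodule ℂ (Sl2C × Sl2C))} (h : HasIdealVector P) :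
    HasIdealVector (mapGrading θ P) := by
  obtain ⟨A, hA, x, hx, hx0, h⟩ := h
  exact ⟨_, ⟨A, hA, rfl⟩, θ x, ⟨x, hx, rfl⟩,
    fun h0 => hx0 (θ.injective (h0.trans (map_zero θ).symm)), apply_fst_or_snd θ h⟩

theorem hasIdealVector_composedVec {b b' : Fin 3 → Sl2C} (hb : b 0 ≠ 0) :
    HasIdealVector (lineGrading (composedVec b b')) :=
  ⟨_, ⟨Sum.inl 0, rfl⟩, _, Submodule.mem_span_singleton_self _,
    fun h => hb (congrArg Prod.fst h), Or.inr rfl⟩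

theorem not_hasIdealVector_twistedVec {b : Fin 3 → Sl2C} (hb : ∀ k, b k ≠ 0) {μ : Fin 3 → ℂ}
    (hμ : ∀ k, μ k ≠ 0) : ¬ HasIdealVector (lineGrading (twistedVec b μ)) := by
  rintro ⟨_, ⟨⟨k, s⟩, rfl⟩, x, hx, hx0, h⟩
  obtain ⟨t, rfl⟩ := Submodule.mem_span_singleton.mp hx
  have ht : t ≠ 0 := by rintro rfl; simp at hx0
  rcases h with h | h
  · cases s <;> simp [twistedVec, ht, hb, hμ] at h
  · simp [twistedVec, ht, hb] at h

/-- The composing isomorphism differs from `e` by an automorphism of `sl(2, ℂ) ⊕ sl(2, ℂ)`, and such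
automorphisms send vectors of a simple ideal to vectors of a simple ideal. -/
theorem hasIdealVector_of_isComposedOf (e : (Sl2C × Sl2C) ≃ₗ⁅ℂ⁆ O4C)
    {P : Set (Submodule ℂ (Sl2C × Sl2C))} {P₁ P₂ : Set (Submodule ℂ Sl2C)} (h₁ : sSup P₁ = ⊤)
    (h : IsComposedOf (mapGrading e P) P₁ P₂) : HasIdealVector P := by
  obtain ⟨φ, hφ⟩ := h
  obtain ⟨A, hA, hA0⟩ : ∃ A ∈ P₁, A ≠ ⊥ := by
    by_contra! hne
    rw [sSup_eq_bot.mpr hne] at h₁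
    exact sl2Mk_diag_ne_zero ((Submodule.mem_bot ℂ).mp (h₁ ▸ Submodule.mem_top))
  obtain ⟨a, ha, ha0⟩ := A.ne_bot_iff.mp hA0
  have hmem := hφ.superset (Or.inl ⟨A, hA, rfl⟩)
  obtain ⟨B, hB, hBA⟩ := hmem
  have h1 : φ (a, 0) ∈ B.map (e : (Sl2C × Sl2C) →ₗ[ℂ] O4C) := by
    rw [show B.map (e : (Sl2C × Sl2C) →ₗ[ℂ] O4C) = _ from hBA]
    exact ⟨(a, 0), ⟨ha, Submodule.zero_mem _⟩, rfl⟩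
  obtain ⟨x, hx, hxa⟩ := h1
  have h2 : (φ.trans e.symm) (a, 0) = x := by
    change e.symm (φ (a, 0)) = x
    rw [← hxa]
    exact e.symm_apply_apply x
  refine ⟨B, hB, x, hx, fun h0 => ha0 ?_, h2 ▸ apply_fst_or_snd _ (Or.inr rfl)⟩
  exact congrArg Prod.fst ((φ.trans e.symm).injective ((h2.trans h0).trans (map_zero _).symm))

/-- The diagonal group of `P` has exponent dividing `n`. -/
def HasDiagExponent (n : ℕ) (P : Set (Submodule ℂ (Sl2C × Sl2C))) : Prop :=
  ∀ g ∈ gradingDiag P, ∀ x, (⇑g)^[n] x = x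

theorem iterate_eigenvector {g : (Sl2C × Sl2C) ≃ₗ⁅ℂ⁆ (Sl2C × Sl2C)} {α : ℂ} {x : Sl2C × Sl2C}
    (h : g x = α • x) (n : ℕ) : (⇑g)^[n] x = α ^ n • x := by
  induction n with
  | zero => simp
  | succ n ih => rw [Function.iterate_succ_apply', ih, map_smul, h, smul_smul, pow_succ]

theorem HasDiagExponent.map {n : ℕ} (θ : (Sl2C × Sl2C) ≃ₗ⁅ℂ⁆ (Sl2C × Sl2C))
    {P : Set (Submodule ℂ (Sl2C × Sl2C))} (h : HasDiagExponent n P) :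
    HasDiagExponent n (mapGrading θ P) := by
  intro g hg x
  rw [gradingDiag_mapGrading] at hg
  obtain ⟨g, hg, rfl⟩ := hg
  have hs : Function.Semiconj (⇑θ) ⇑g ⇑((θ.symm.trans g).trans θ) := fun y => by
    change θ (g y) = θ (g (θ.symm (θ y)))
    rw [LieEquiv.symm_apply_apply]
  have := (hs.iterate_right n).eq (θ.symm x)
  rw [h g hg, LieEquiv.apply_symm_apply] at this
  exact this.symm

theorem not_hasDiagExponent {n : ℕ} {P : Set (Submodule ℂ (Sl2C × Sl2C))}
    {g : (Sl2C × Sl2C) ≃ₗ⁅ℂ⁆ (Sl2C × Sl2C)} (hg : g ∈ gradingDiag P) {α : ℂ} {x : Sl2C × Sl2C}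
    (hx : x ≠ 0) (h : g x = α • x) (hα : α ^ n ≠ 1) : ¬ HasDiagExponent n P := by
  intro hP
  have := hP g hg x
  rw [iterate_eigenvector h] at this
  exact hα (smul_left_injective ℂ hx (this.trans (one_smul ℂ x).symm))

/-- If `n` brackets with `v i` return `v j` up to a nonzero factor, applying `g` to this relation
shows that the scalar of `g` on `v i` has `n`-th power 1. The diagonal group need not be computed.
-/
theorem hasDiagExponent_lineGrading {ι : Type} {v : ι → Sl2C × Sl2C} (n : ℕ) (hv : ∀ i, v i ≠ 0)
    (ht : Submodule.span ℂ (Set.range v) = ⊤)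
    (h : ∀ i, ∃ j, ∃ c : ℂ, c ≠ 0 ∧ (fun x => ⁅v i, x⁆)^[n] (v j) = c • v j) :
    HasDiagExponent n (lineGrading v) := by
  intro g hg x
  rw [mem_gradingDiag_lineGrading] at hg
  have key : ∀ i, (⇑g)^[n] (v i) = v i := by
    intro i
    obtain ⟨α, hα⟩ := hg i
    obtain ⟨j, c, hc, hj⟩ := h i
    obtain ⟨β, hβ⟩ := hg j
    have h1 : ∀ m, g ((fun x => ⁅v i, x⁆)^[m] (v j)) =
        (α ^ m * β) • (fun x => ⁅v i, x⁆)^[m] (v j) := by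
      intro m
      induction m with
      | zero => simp [hβ]
      | succ m ih =>
        rw [Function.iterate_succ_apply', LieEquiv.map_lie, ih, hα, smul_lie, lie_smul, smul_smul,
          pow_succ']
        ring_nf
    have h2 := h1 n
    rw [hj, map_smul, hβ, smul_smul, smul_smul] at h2
    have h3 : c * β = α ^ n * β * c := smul_left_injective ℂ (hv j) h2
    have hβ0 : β ≠ 0 := eigenvalue_ne_zero (hv j) hβ
    have h4 : α ^ n = 1 := by
      apply mul_right_cancel₀ (mul_ne_zero hβ0 hc)
      linear_combination -h3
    rw [iterate_eigenvector hα, h4, one_smul]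
  have hx : x ∈ Submodule.span ℂ (Set.range v) := ht ▸ Submodule.mem_top
  induction hx using Submodule.span_induction with
  | mem x hx => obtain ⟨i, rfl⟩ := hx; exact key i
  | zero => exact iterate_map_zero g n
  | add x y _ _ hx hy => rw [iterate_map_add, hx, hy]
  | smul t x _ hx =>
    have hs : Function.Semiconj (t • ·) (⇑g) (⇑g) := fun y => (map_smul g t y).symm
    rw [← (hs.iterate_right n).eq x, hx]

theorem pauliVec_lie_lie (k : Fin 3) :
    ∃ c : ℂ, c ≠ 0 ∧ ⁅pauliVec k, ⁅pauliVec k, pauliVec (k + 1)⁆⁆ = c • pauliVec (k + 1) := by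
  refine ⟨(![4, 4, -4] : Fin 3 → ℂ) k, by fin_cases k <;> simp, ?_⟩
  fin_cases k <;> simp [pauliVec, sl2Mk_lie, sl2Mk_smul, sl2Mk_inj, sl2Mk_neg] <;> norm_num

/-- The double bracket scales the two components by `μ² c` and `c`. These agree for `μ = 1`, giving
exponent 2; for `μ = i` they differ in sign, and only the fourfold bracket gives a common scalar. -/
theorem twistedVec_lie_lie {μ : Fin 3 → ℂ} (i : Fin 3 × Bool) :
    ∃ c : ℂ, c ≠ 0 ∧ ∀ s t : ℂ, ⁅twistedVec pauliVec μ i, ⁅twistedVec pauliVec μ i,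
      ((s • pauliVec (i.1 + 1), t • pauliVec (i.1 + 1)) : Sl2C × Sl2C)⁆⁆ =
      ((μ i.1 ^ 2 * c * s) • pauliVec (i.1 + 1), (c * t) • pauliVec (i.1 + 1)) := by
  obtain ⟨k, b⟩ := i
  obtain ⟨c, hc, h⟩ := pauliVec_lie_lie k
  refine ⟨c, hc, fun s t => Prod.ext ?_ ?_⟩
  · change ⁅((if b then 1 else -1 : ℂ) * μ k) • pauliVec k,
      ⁅((if b then 1 else -1 : ℂ) * μ k) • pauliVec k, s • pauliVec (k + 1)⁆⁆ = _
    rw [smul_lie, smul_lie, lie_smul, lie_smul, lie_smul, h, smul_smul, smul_smul, smul_smul]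
    cases b <;> simp <;> ring_nf
  · change ⁅pauliVec k, ⁅pauliVec k, t • pauliVec (k + 1)⁆⁆ = _
    rw [lie_smul, lie_smul, h, smul_smul, mul_comm]

theorem hasDiagExponent_twistedVec_one :
    HasDiagExponent 2 (lineGrading (twistedVec pauliVec 1)) := by
  refine hasDiagExponent_lineGrading 2 (twistedVec_ne_zero pauliVec_ne_zero _)
    (span_twistedVec span_pauliVec fun _ => one_ne_zero) fun i => ?_
  obtain ⟨c, hc, h⟩ := twistedVec_lie_lie (μ := 1) i
  refine ⟨(i.1 + 1, true), c, hc, ?_⟩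
  have := h 1 1
  simp only [one_smul, Pi.one_apply, one_pow, one_mul, mul_one] at this
  simpa [twistedVec] using this

theorem hasDiagExponent_twistedVec_I :
    HasDiagExponent 4 (lineGrading (twistedVec pauliVec ![1, Complex.I, Complex.I])) := by
  have hμ : ∀ k, (![1, Complex.I, Complex.I] : Fin 3 → ℂ) k ^ 4 = 1 := by
    intro k; fin_cases k <;> simp
  refine hasDiagExponent_lineGrading 4 (twistedVec_ne_zero pauliVec_ne_zero _)
    (span_twistedVec span_pauliVec fun k h => by simpa [h] using hμ k) fun i => ?_
  obtain ⟨c, hc, h⟩ := twistedVec_lie_lie (μ := ![1, Complex.I, Complex.I]) i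
  refine ⟨(i.1 + 1, true), c ^ 2, pow_ne_zero 2 hc, ?_⟩
  have h1 : twistedVec pauliVec ![1, Complex.I, Complex.I] (i.1 + 1, true) =
      ((![1, Complex.I, Complex.I] : Fin 3 → ℂ) (i.1 + 1) • pauliVec (i.1 + 1),
        (1 : ℂ) • pauliVec (i.1 + 1)) := by simp [twistedVec]
  change ⁅_, ⁅_, ⁅_, ⁅_, _⁆⁆⁆⁆ = _
  rw [h1, h, h, Prod.smul_mk, smul_smul, smul_smul]
  refine Prod.ext (congrArg (· • _) ?_) (congrArg (· • _) ?_)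
  · linear_combination (c ^ 2 * (![1, Complex.I, Complex.I] : Fin 3 → ℂ) (i.1 + 1)) * hμ i.1
  · ring

theorem hasDiagExponent_composedVec_pauli :
    HasDiagExponent 2 (lineGrading (composedVec pauliVec pauliVec)) := by
  refine hasDiagExponent_lineGrading 2 (composedVec_ne_zero pauliVec_ne_zero pauliVec_ne_zero)
    (span_composedVec span_pauliVec span_pauliVec) ?_
  rintro (k | k) <;> obtain ⟨c, hc, h⟩ := pauliVec_lie_lie k
  · refine ⟨Sum.inl (k + 1), c, hc, Prod.ext h ?_⟩
    simp [composedVec]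
  · refine ⟨Sum.inr (k + 1), c, hc, Prod.ext ?_ h⟩
    simp [composedVec]

theorem not_hasDiagExponent_composedVec :
    ¬ HasDiagExponent 2 (lineGrading (composedVec cartanVec pauliVec)) := by
  obtain ⟨p, hp⟩ := exists_torus (t := 2) two_ne_zero
  have hp' : p ∈ diagAut cartanVec := fun k =>
    ⟨(![1, 2, 2⁻¹] : Fin 3 → ℂ) k, by fin_cases k <;> simp [cartanVec, hp, sl2Mk_smul]⟩
  refine not_hasDiagExponent (prodAut_mem_gradingDiag hp' (refl_mem_diagAut _)) (α := 2)
    (x := (sl2Mk 0 1 0, 0)) (by simp [sl2Mk_eq_zero]) ?_ (by norm_num)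
  simp [prodAut_apply, hp, sl2Mk_smul]

theorem not_hasDiagExponent_twistedVec_cartan {n : ℕ} (hn : n ≠ 0) :
    ¬ HasDiagExponent n (lineGrading (twistedVec cartanVec 1)) := by
  obtain ⟨p, hp⟩ := exists_torus (t := 2) two_ne_zero
  have hp' : p ∈ diagAut cartanVec := fun k =>
    ⟨(![1, 2, 2⁻¹] : Fin 3 → ℂ) k, by fin_cases k <;> simp [cartanVec, hp, sl2Mk_smul]⟩
  refine not_hasDiagExponent (twistedSet_subset_gradingDiag (a := LieEquiv.refl)
    (fun k => by simp) ⟨p, hp', Or.inl rfl⟩) (α := 2)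
    (x := (sl2Mk 0 1 0, 0)) (by simp [sl2Mk_eq_zero]) ?_ ?_
  · simp [prodAut_apply, hp, sl2Mk_smul]
  · exact_mod_cast (Nat.one_lt_two_pow hn).ne'

theorem exists_diagAut_I : ∃ a : Sl2C ≃ₗ⁅ℂ⁆ Sl2C, ∀ k, a (pauliVec k) =
    ((![1, Complex.I, Complex.I] : Fin 3 → ℂ) k * (![1, Complex.I, Complex.I] : Fin 3 → ℂ) k) •
      pauliVec k := by
  obtain ⟨a, -, ha, -⟩ := exists_diagAut_pauliVec
  refine ⟨a, fun k => (ha k).trans ?_⟩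
  fin_cases k <;> simp

theorem not_hasDiagExponent_twistedVec_I :
    ¬ HasDiagExponent 2 (lineGrading (twistedVec pauliVec ![1, Complex.I, Complex.I])) := by
  obtain ⟨a, ha⟩ := exists_diagAut_I
  have h1 : (LieEquiv.refl : Sl2C ≃ₗ⁅ℂ⁆ Sl2C) (pauliVec 1) = (1 : ℂ) • pauliVec 1 :=
    (one_smul ℂ _).symm
  -- The swap itself has eigenvalue `i` on the chosen vector, and `i² ≠ 1`.
  refine not_hasDiagExponent (twistedSet_subset_gradingDiag ha
    ⟨LieEquiv.refl, refl_mem_diagAut _, Or.inr rfl⟩)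
    (twistedVec_ne_zero pauliVec_ne_zero _ _) (twistedSet_apply (ha 1) h1 true).2 ?_
  norm_num [Complex.I_sq]

end Invariants

/-! ### The six gradings: dimensions, pairwise inequivalence, and the refinement of the first. -/

section SixGradings

theorem vecI_ne_zero (k : Fin 3) : (![1, Complex.I, Complex.I] : Fin 3 → ℂ) k ≠ 0 := by
  fin_cases k <;> simp

theorem sixGradings_eq_lineGrading {i : Fin 6} (hi : i ≠ 0) :
    ∃ (ι : Type) (_ : Fintype ι) (v : ι → Sl2C × Sl2C), sixGradings i = lineGrading v ∧
      Fintype.card ι = 6 ∧ (∀ j, v j ≠ 0) ∧ Submodule.span ℂ (Set.range v) = ⊤ ∧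
      ∀ j k, j ≠ k → ∃ g ∈ gradingDiag (lineGrading v), ∃ α β : ℂ, α ≠ β ∧
        g (v j) = α • v j ∧ g (v k) = β • v k := by
  obtain ⟨a, ha⟩ := exists_diagAut_I
  fin_cases i
  · exact absurd rfl hi
  · exact ⟨_, inferInstance, _, rfl, rfl, composedVec_ne_zero cartanVec_ne_zero pauliVec_ne_zero,
      span_composedVec span_cartanVec span_pauliVec, composedVec_separates diagSeparates_cartanVec
        diagSeparates_pauliVec exists_ne_one_pauliVec⟩
  · exact ⟨_, inferInstance, _, rfl, rfl, composedVec_ne_zero pauliVec_ne_zero pauliVec_ne_zero,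
      span_composedVec span_pauliVec span_pauliVec, composedVec_separates diagSeparates_pauliVec
        diagSeparates_pauliVec exists_ne_one_pauliVec⟩
  · exact ⟨_, inferInstance, _, rfl, rfl, twistedVec_ne_zero cartanVec_ne_zero _,
      span_twistedVec span_cartanVec fun _ => one_ne_zero,
      twistedVec_separates diagSeparates_cartanVec (fun _ => one_ne_zero) (a := LieEquiv.refl)
        fun k => by simp⟩
  · exact ⟨_, inferInstance, _, rfl, rfl, twistedVec_ne_zero pauliVec_ne_zero _,
      span_twistedVec span_pauliVec fun _ => one_ne_zero,
      twistedVec_separates diagSeparates_pauliVec (fun _ => one_ne_zero) (a := LieEquiv.refl)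
        fun k => by simp⟩
  · exact ⟨_, inferInstance, _, rfl, rfl, twistedVec_ne_zero pauliVec_ne_zero _,
      span_twistedVec span_pauliVec vecI_ne_zero,
      twistedVec_separates diagSeparates_pauliVec vecI_ne_zero ha⟩

theorem isSeparated_sixGradings (i : Fin 6) : IsSeparated (sixGradings i) := by
  by_cases hi : i = 0
  · subst hi; exact isSeparated_rootGrading
  · obtain ⟨ι, _, v, hv, -, h0, ht, hs⟩ := sixGradings_eq_lineGrading hi
    rw [hv]
    exact isSeparated_lineGrading h0 ht hs

theorem isMADGroup_sixGradings (i : Fin 6) : IsMADGroup (gradingDiag (sixGradings i)) := by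
  have hsep := isSeparated_sixGradings i
  by_cases hi : i = 0
  · subst hi; exact isMADGroup_rootGrading
  · obtain ⟨ι, _, v, hv, -⟩ := sixGradings_eq_lineGrading hi
    rw [hv] at hsep ⊢
    exact hsep.isMADGroup_lineGrading

theorem finrank_of_mem_sixGradings {i : Fin 6} (hi : i ≠ 0) {A : Submodule ℂ (Sl2C × Sl2C)}
    (hA : A ∈ sixGradings i) : Module.finrank ℂ A = 1 := by
  obtain ⟨ι, _, v, hv, -, h0, -⟩ := sixGradings_eq_lineGrading hi
  rw [hv] at hA
  exact finrank_of_mem_lineGrading h0 hA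

theorem ncard_sixGradings {i : Fin 6} (hi : i ≠ 0) : (sixGradings i).ncard = 6 := by
  obtain ⟨ι, _, v, hv, hc, h0, ht, hs⟩ := sixGradings_eq_lineGrading hi
  rw [hv, ncard_lineGrading (span_injective_of_separates h0 hs), hc]

theorem finrank_cartanPlane : Module.finrank ℂ cartanPlane = 2 := by
  have h : LinearIndependent ℂ ![((sl2Mk 1 0 0, 0) : Sl2C × Sl2C), (0, sl2Mk 1 0 0)] := by
    rw [LinearIndependent.pair_iff]
    intro s t h
    simpa [sl2Mk_smul, sl2Mk_eq_zero] using h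
  have := finrank_span_eq_card h
  rw [Matrix.range_cons, Matrix.range_cons, Matrix.range_empty, Set.union_empty,
    Set.singleton_union, Fintype.card_fin] at this
  exact this

theorem rootVec_span_injective : Function.Injective fun i => Submodule.span ℂ {rootVec i} := by
  obtain ⟨g, hg, h1, h2⟩ := rootGrading_weights
  refine span_injective_of_separates rootVec_ne_zero fun i j hij => ?_
  exact ⟨g, mem_gradingDiag_lineGrading.mpr fun i => ⟨_, h2 i⟩, _, _,
    rootWeights_injective.ne hij, h2 i, h2 j⟩

theorem cartanPlane_notMem : cartanPlane ∉ lineGrading rootVec := fun h => by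
  have := finrank_of_mem_lineGrading rootVec_ne_zero h
  rw [finrank_cartanPlane] at this
  norm_num at this

theorem ncard_rootGrading : rootGrading.ncard = 5 := by
  rw [rootGrading, Set.ncard_insert_of_notMem cartanPlane_notMem (Set.finite_range _),
    ncard_lineGrading rootVec_span_injective, Fintype.card_fin]

theorem sep_two_rootGrading : {A ∈ rootGrading | Module.finrank ℂ A = 2} = {cartanPlane} := by
  ext A
  constructor
  · rintro ⟨h | h, hA⟩
    · exact h
    · rw [finrank_of_mem_lineGrading rootVec_ne_zero h] at hA
      norm_num at hA
  · rintro rfl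
    exact ⟨Or.inl rfl, finrank_cartanPlane⟩

theorem sep_one_rootGrading :
    {A ∈ rootGrading | Module.finrank ℂ A = 1} = lineGrading rootVec := by
  ext A
  constructor
  · rintro ⟨h | h, hA⟩
    · rw [h, finrank_cartanPlane] at hA
      norm_num at hA
    · exact h
  · exact fun h => ⟨Or.inr h, finrank_of_mem_lineGrading rootVec_ne_zero h⟩

variable {L L' : Type} [LieRing L] [LieAlgebra ℂ L] [LieRing L'] [LieAlgebra ℂ L']

theorem mapGrading_injective (e : L ≃ₗ⁅ℂ⁆ L') :
    Function.Injective fun A : Submodule ℂ L => A.map (e : L →ₗ[ℂ] L') :=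
  Submodule.map_injective_of_injective e.injective

theorem ncard_mapGrading (e : L ≃ₗ⁅ℂ⁆ L') (P : Set (Submodule ℂ L)) :
    (mapGrading e P).ncard = P.ncard :=
  Set.ncard_image_of_injective _ (mapGrading_injective e)

theorem finrank_map (e : L ≃ₗ⁅ℂ⁆ L') (A : Submodule ℂ L) :
    Module.finrank ℂ (A.map (e : L →ₗ[ℂ] L')) = Module.finrank ℂ A :=
  LinearEquiv.finrank_map_eq e.toLinearEquiv A

theorem sep_mapGrading (e : L ≃ₗ⁅ℂ⁆ L') (P : Set (Submodule ℂ L)) (n : ℕ) :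
    {A ∈ mapGrading e P | Module.finrank ℂ A = n} =
      mapGrading e {A ∈ P | Module.finrank ℂ A = n} := by
  ext B
  constructor
  · rintro ⟨⟨A, hA, rfl⟩, hB⟩
    exact ⟨A, ⟨hA, (finrank_map e A).symm.trans hB⟩, rfl⟩
  · rintro ⟨A, ⟨hA, hn⟩, rfl⟩
    exact ⟨⟨A, hA, rfl⟩, (finrank_map e A).trans hn⟩

theorem IsMADGroup.conjAut (e : L ≃ₗ⁅ℂ⁆ L') {G : Set (L ≃ₗ⁅ℂ⁆ L)} (hG : IsMADGroup G) :
    IsMADGroup (conjAut e G) := by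
  have h := hG.isCommDiag.conjAut e
  refine ⟨h.1, h.2, fun g hg hc => ?_⟩
  refine ⟨(e.trans g).trans e.symm, hG.maximal _ (isDiagonalizableAut_conj e.symm hg) ?_, ?_⟩
  · intro f hf x
    have := hc _ ⟨f, hf, rfl⟩ (e x)
    simp only [LieEquiv.trans_apply, LieEquiv.symm_apply_apply] at this ⊢
    rw [this, LieEquiv.symm_apply_apply]
  · ext x
    simp

theorem mapGrading_trans {L'' : Type} [LieRing L''] [LieAlgebra ℂ L''] (e : L ≃ₗ⁅ℂ⁆ L')
    (e' : L' ≃ₗ⁅ℂ⁆ L'') (P : Set (Submodule ℂ L)) :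
    mapGrading (e.trans e') P = mapGrading e' (mapGrading e P) := by
  simp only [mapGrading, Set.image_image]
  refine congrArg (· '' P) (funext fun A => ?_)
  exact Submodule.map_comp (e : L →ₗ[ℂ] L') (e' : L' →ₗ[ℂ] L'') A

/-- Only grading 0 has five members. Of the others, 1 and 2 contain ideal vectors, and 2 has
diagonal exponent 2 while 1 does not. The gradings 3, 4 and 5 contain none: 4 has exponent 2, 5 has
exponent 4 but not 2, and 3 has neither. -/
theorem sixGradings_eq_of_map {i j : Fin 6} {θ : (Sl2C × Sl2C) ≃ₗ⁅ℂ⁆ (Sl2C × Sl2C)}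
    (h : sixGradings j = mapGrading θ (sixGradings i)) : i = j := by
  have h' : sixGradings i = mapGrading θ.symm (sixGradings j) := by rw [h, mapGrading_symm]
  have hinv : ∀ p : Set (Submodule ℂ (Sl2C × Sl2C)) → Prop, (∀ (θ : (Sl2C × Sl2C) ≃ₗ⁅ℂ⁆ _) P,
      p P → p (mapGrading θ P)) → (p (sixGradings i) ↔ p (sixGradings j)) := fun p hp =>
    ⟨fun hi => h ▸ hp θ _ hi, fun hj => h' ▸ hp θ.symm _ hj⟩
  have hcard : ∀ k : Fin 6, (sixGradings k).ncard = 5 ↔ k = 0 := fun k => by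
    constructor
    · intro hk
      by_contra h0
      rw [ncard_sixGradings h0] at hk
      norm_num at hk
    · rintro rfl
      exact ncard_rootGrading
  have a0 := hinv (fun P => P.ncard = 5) fun θ P hP => (ncard_mapGrading θ P).trans hP
  simp only [hcard] at a0
  have a1 := hinv HasIdealVector fun θ P hP => hP.map θ
  have a2 := hinv (HasDiagExponent 2) fun θ P hP => hP.map θ
  have a3 := hinv (HasDiagExponent 4) fun θ P hP => hP.map θ
  have i1 : HasIdealVector (sixGradings 1) := hasIdealVector_composedVec (cartanVec_ne_zero 0)
  have i2 : HasIdealVector (sixGradings 2) := hasIdealVector_composedVec (pauliVec_ne_zero 0)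
  have i3 : ¬ HasIdealVector (sixGradings 3) :=
    not_hasIdealVector_twistedVec cartanVec_ne_zero fun _ => one_ne_zero
  have i4 : ¬ HasIdealVector (sixGradings 4) :=
    not_hasIdealVector_twistedVec pauliVec_ne_zero fun _ => one_ne_zero
  have i5 : ¬ HasIdealVector (sixGradings 5) :=
    not_hasIdealVector_twistedVec pauliVec_ne_zero vecI_ne_zero
  have j1 : ¬ HasDiagExponent 2 (sixGradings 1) := not_hasDiagExponent_composedVec
  have j2 : HasDiagExponent 2 (sixGradings 2) := hasDiagExponent_composedVec_pauli
  have j3 : ¬ HasDiagExponent 2 (sixGradings 3) := not_hasDiagExponent_twistedVec_cartan two_ne_zero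
  have j4 : HasDiagExponent 2 (sixGradings 4) := hasDiagExponent_twistedVec_one
  have j5 : ¬ HasDiagExponent 2 (sixGradings 5) := not_hasDiagExponent_twistedVec_I
  have k3 : ¬ HasDiagExponent 4 (sixGradings 3) := not_hasDiagExponent_twistedVec_cartan four_ne_zero
  have k5 : HasDiagExponent 4 (sixGradings 5) := hasDiagExponent_twistedVec_I
  clear h h' hinv
  fin_cases i <;> fin_cases j <;> first | rfl | (exfalso; revert a0 a1 a2 a3; simp_all)

theorem linearIndependent_composedVec_cartan :
    LinearIndependent ℂ (composedVec cartanVec cartanVec) := by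
  rw [Fintype.linearIndependent_iff]
  intro c hc
  rw [Fintype.sum_sum_type, Fin.sum_univ_three, Fin.sum_univ_three] at hc
  simp [composedVec, cartanVec, sl2Mk_smul, sl2Mk_add, sl2Mk_eq_zero] at hc
  obtain ⟨⟨h0, h1, h2⟩, h3, h4, h5⟩ := hc
  rintro (k | k) <;> fin_cases k
  exacts [h0, h1, h2, h3, h4, h5]

theorem cartanVec_lie (k l : Fin 3) :
    ∃ m, ∃ c : ℂ, ⁅cartanVec k, cartanVec l⁆ = c • cartanVec m := by
  refine ⟨(![![0, 1, 2], ![1, 1, 0], ![2, 0, 2]] : Fin 3 → Fin 3 → Fin 3) k l,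
    (![![0, 2, -2], ![-2, 0, 1], ![2, -1, 0]] : Fin 3 → Fin 3 → ℂ) k l, ?_⟩
  fin_cases k <;> fin_cases l <;> simp [cartanVec, sl2Mk_lie, sl2Mk_smul, sl2Mk_neg]

theorem composedVec_cartan_lie (i j : Fin 3 ⊕ Fin 3) : ∃ m, ∃ c : ℂ,
    ⁅composedVec cartanVec cartanVec i, composedVec cartanVec cartanVec j⁆ =
      c • composedVec cartanVec cartanVec m := by
  rcases i with k | k <;> rcases j with l | l
  · obtain ⟨m, c, h⟩ := cartanVec_lie k l
    exact ⟨Sum.inl m, c, Prod.ext h (by simp [composedVec])⟩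
  · exact ⟨Sum.inl 0, 0, Prod.ext (by simp [composedVec]) (by simp [composedVec])⟩
  · exact ⟨Sum.inl 0, 0, Prod.ext (by simp [composedVec]) (by simp [composedVec])⟩
  · obtain ⟨m, c, h⟩ := cartanVec_lie k l
    exact ⟨Sum.inr m, c, Prod.ext (by simp [composedVec]) h⟩

theorem isLieGrading_lineGrading {ι : Type} {v : ι → L} (hv : LinearIndependent ℂ v)
    (ht : Submodule.span ℂ (Set.range v) = ⊤)
    (h : ∀ i j, ∃ m, ∃ c : ℂ, ⁅v i, v j⁆ = c • v m) : IsLieGrading (lineGrading v) := by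
  refine ⟨?_, hv.iSupIndep_span_singleton.sSupIndep_range, ?_, ?_⟩
  · rintro _ ⟨i, rfl⟩ h0
    exact hv.ne_zero i (Submodule.span_singleton_eq_bot.mp h0)
  · rw [← ht, lineGrading, sSup_range, Submodule.span_range_eq_iSup]
  · rintro _ ⟨i, rfl⟩ _ ⟨j, rfl⟩
    obtain ⟨m, c, hm⟩ := h i j
    refine ⟨_, ⟨m, rfl⟩, fun a ha b hb => ?_⟩
    obtain ⟨s, rfl⟩ := Submodule.mem_span_singleton.mp ha
    obtain ⟨t, rfl⟩ := Submodule.mem_span_singleton.mp hb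
    rw [smul_lie, lie_smul, hm, smul_smul, smul_smul]
    exact Submodule.smul_mem _ _ (Submodule.mem_span_singleton_self _)

/-- The grading composed of two Cartan gradings of `sl(2, ℂ)`. -/
theorem isLieGrading_mapGrading_cartan (e : (Sl2C × Sl2C) ≃ₗ⁅ℂ⁆ L) :
    IsLieGrading (mapGrading e (lineGrading (composedVec cartanVec cartanVec))) := by
  rw [mapGrading_lineGrading]
  refine isLieGrading_lineGrading (linearIndependent_composedVec_cartan.map' e.toLinearEquiv.toLinearMap
    (LinearMap.ker_eq_bot.mpr e.injective)) ?_ fun i j => ?_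
  · have h := span_composedVec span_cartanVec span_cartanVec
    have h2 := congrArg (Submodule.map (e : (Sl2C × Sl2C) →ₗ[ℂ] L)) h
    rw [Submodule.map_span, ← Set.range_comp, Submodule.map_top] at h2
    exact h2.trans (LinearMap.range_eq_top.mpr e.surjective)
  · obtain ⟨m, c, h⟩ := composedVec_cartan_lie i j
    exact ⟨m, c, by rw [← LieEquiv.map_lie, h, map_smul]⟩

/-- A diagonal automorphism acts by scalars on the root vectors, hence trivially on the Cartan
plane, and cannot separate the two lines into which the plane is split. -/
theorem not_isSeparated_composedVec_cartan :
    ¬ IsSeparated (lineGrading (composedVec cartanVec cartanVec)) := by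
  intro h
  have hc0 : composedVec cartanVec cartanVec (Sum.inl 0) ∈ cartanPlane :=
    Submodule.subset_span (Or.inl rfl)
  have hc1 : composedVec cartanVec cartanVec (Sum.inr 0) ∈ cartanPlane :=
    Submodule.subset_span (Or.inr rfl)
  have hne : Submodule.span ℂ {composedVec cartanVec cartanVec (Sum.inl 0)} ≠
      Submodule.span ℂ {composedVec cartanVec cartanVec (Sum.inr 0)} := by
    intro h0
    have h1 := Submodule.mem_span_singleton_self (R := ℂ)
      (composedVec cartanVec cartanVec (Sum.inl 0))
    rw [h0] at h1
    obtain ⟨t, ht⟩ := Submodule.mem_span_singleton.mp h1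
    have := congrArg Prod.fst ht
    simp [composedVec, cartanVec] at this
    exact sl2Mk_diag_ne_zero this.symm
  obtain ⟨g, hg, α, β, hαβ, hα, hβ⟩ := h.3 _ ⟨Sum.inl 0, rfl⟩ _ ⟨Sum.inr 0, rfl⟩ hne
  rw [mem_gradingDiag_lineGrading] at hg
  have hroot : ∀ i, ∃ γ : ℂ, g (rootVec i) = γ • rootVec i := by
    intro i
    fin_cases i
    exacts [hg (Sum.inl 1), hg (Sum.inl 2), hg (Sum.inr 1), hg (Sum.inr 2)]
  choose γ hγ using hroot
  have h0 := composedVec_ne_zero cartanVec_ne_zero cartanVec_ne_zero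
  have e1 := (hα _ (Submodule.mem_span_singleton_self _)).symm.trans
    ((fix_cartanPlane hγ _ hc0).trans (one_smul ℂ _).symm)
  have e2 := (hβ _ (Submodule.mem_span_singleton_self _)).symm.trans
    ((fix_cartanPlane hγ _ hc1).trans (one_smul ℂ _).symm)
  exact hαβ ((smul_left_injective ℂ (h0 _) e1).trans (smul_left_injective ℂ (h0 _) e2).symm)

theorem refines_rootGrading :
    Refines (lineGrading (composedVec cartanVec cartanVec)) rootGrading := by
  refine refines_of_forall_le isSeparated_rootGrading.isGroupGrading.1.indep ?_ ?_
  · rw [lineGrading, sSup_range, ← Submodule.span_range_eq_iSup,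
      span_composedVec span_cartanVec span_cartanVec]
  · have h1 : ∀ i, Submodule.span ℂ {composedVec cartanVec cartanVec i} ≤ cartanPlane ∨
        ∃ j, rootVec j = composedVec cartanVec cartanVec i := by
      rintro (k | k) <;> fin_cases k
      · exact Or.inl (Submodule.span_mono (Set.singleton_subset_iff.mpr (Or.inl rfl)))
      · exact Or.inr ⟨0, rfl⟩
      · exact Or.inr ⟨1, rfl⟩
      · exact Or.inl (Submodule.span_mono (Set.singleton_subset_iff.mpr (Or.inr rfl)))
      · exact Or.inr ⟨2, rfl⟩
      · exact Or.inr ⟨3, rfl⟩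
    rintro _ ⟨i, rfl⟩
    rcases h1 i with h | ⟨j, hj⟩
    · exact ⟨_, Or.inl rfl, h⟩
    · exact ⟨_, Or.inr ⟨j, rfl⟩, (congrArg (fun x => Submodule.span ℂ {x}) hj).ge⟩

end SixGradings

/-! ### Transport to `o(4, ℂ)` and conclusion. -/

section Main

theorem subset_conjAut_symm {L L' : Type} [LieRing L] [LieAlgebra ℂ L] [LieRing L']
    [LieAlgebra ℂ L'] {e : L ≃ₗ⁅ℂ⁆ L'} {H : Set (L ≃ₗ⁅ℂ⁆ L)} {G : Set (L' ≃ₗ⁅ℂ⁆ L')}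
    (h : conjAut e H ⊆ G) : H ⊆ conjAut e.symm G := by
  have := conjAut_mono e.symm h
  rwa [conjAut_symm] at this

instance : FiniteDimensional ℂ O4C := so4Equiv.toLinearEquiv.finiteDimensional

/-- The six fine group gradings of `o(4, ℂ)`. -/
noncomputable def so4Grading (i : Fin 6) : Set (Submodule ℂ O4C) :=
  mapGrading so4Equiv (sixGradings i)

theorem isSeparated_so4Grading (i : Fin 6) : IsSeparated (so4Grading i) :=
  (isSeparated_sixGradings i).mapGrading so4Equiv

theorem finrank_of_mem_so4Grading {i : Fin 6} (hi : i ≠ 0) {A : Submodule ℂ O4C}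
    (hA : A ∈ so4Grading i) : Module.finrank ℂ A = 1 := by
  obtain ⟨A, hA, rfl⟩ := hA
  exact (finrank_map so4Equiv A).trans (finrank_of_mem_sixGradings hi hA)

theorem isFineGrading_so4Grading {i : Fin 6} (hi : i ≠ 0) : IsFineGrading (so4Grading i) :=
  (isSeparated_so4Grading i).isGroupGrading.1.isFineGrading fun _ =>
    finrank_of_mem_so4Grading hi

theorem isFineGroupGrading_so4Grading (i : Fin 6) : IsFineGroupGrading (so4Grading i) := by
  by_cases hi : i = 0
  · subst hi
    exact isFineGroupGrading_rootGrading.map so4Equiv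
  · exact (isFineGrading_so4Grading hi).isFineGroupGrading
      (isSeparated_so4Grading i).isGroupGrading

theorem isMADGroup_so4Grading (i : Fin 6) : IsMADGroup (gradingDiag (so4Grading i)) := by
  rw [so4Grading, gradingDiag_mapGrading]
  exact (isMADGroup_sixGradings i).conjAut so4Equiv

theorem not_gradingEquivalent_so4Grading {i j : Fin 6} (hij : i ≠ j) :
    ¬ GradingEquivalent (so4Grading i) (so4Grading j) := by
  rintro ⟨h, hh⟩
  refine hij (sixGradings_eq_of_map (θ := (so4Equiv.trans h).trans so4Equiv.symm) ?_)
  rw [mapGrading_trans, mapGrading_trans]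
  have h2 : so4Grading j = mapGrading h (so4Grading i) := hh
  exact (mapGrading_symm so4Equiv _).symm.trans (congrArg _ h2)

/-- Every commuting set of diagonalizable automorphisms of `o(4, ℂ)` is conjugate into the diagonal
group of one of the six gradings. -/
theorem exists_subset_conjAut_so4Grading {H : Set (O4C ≃ₗ⁅ℂ⁆ O4C)} (hH : IsCommDiag H) :
    ∃ (i : Fin 6) (h : O4C ≃ₗ⁅ℂ⁆ O4C), H ⊆ conjAut h (gradingDiag (so4Grading i)) := by
  obtain ⟨i, e, he⟩ := exists_conjAut_subset_sixGradings (hH.conjAut so4Equiv.symm)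
  refine ⟨i, (so4Equiv.symm.trans e.symm).trans so4Equiv, ?_⟩
  rw [so4Grading, gradingDiag_mapGrading, conjAut_trans, conjAut_trans, conjAut_symm]
  exact subset_conjAut_symm (e := so4Equiv.symm) (subset_conjAut_symm he)

theorem exists_conjugateAutSets_of_isMADGroup {H : Set (O4C ≃ₗ⁅ℂ⁆ O4C)} (hH : IsMADGroup H) :
    ∃ i, ConjugateAutSets (gradingDiag (so4Grading i)) H := by
  obtain ⟨i, h, hi⟩ := exists_subset_conjAut_so4Grading hH.isCommDiag
  exact ⟨i, h, hH.eq_of_subset ((isMADGroup_so4Grading i).conjAut h).isCommDiag hi⟩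

theorem exists_gradingEquivalent_of_isFineGroupGrading {P : Set (Submodule ℂ O4C)}
    (hP : IsFineGroupGrading P) : ∃ i, GradingEquivalent (so4Grading i) P := by
  obtain ⟨i, h, hi⟩ := exists_subset_conjAut_so4Grading (isCommDiag_gradingDiag hP.1.1.sSup_eq_top)
  rw [← gradingDiag_mapGrading] at hi
  exact ⟨i, h, (hP.eq_of_gradingDiag_subset ((isSeparated_so4Grading i).mapGrading h) hi).symm⟩

/-- Taking `Gr` recovers each grading from its diagonal group, so conjugate groups would give
equivalent gradings. -/
theorem not_conjugateAutSets_so4Grading {i j : Fin 6} (hij : i ≠ j) :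
    ¬ ConjugateAutSets (gradingDiag (so4Grading i)) (gradingDiag (so4Grading j)) := by
  rintro ⟨h, hh⟩
  refine not_gradingEquivalent_so4Grading hij ⟨h, ?_⟩
  have h2 : gradingDiag (so4Grading j) = gradingDiag (mapGrading h (so4Grading i)) :=
    (gradingDiag_mapGrading h _).symm ▸ hh
  rw [← (isSeparated_so4Grading j).autGrading_gradingDiag, h2,
    ((isSeparated_so4Grading i).mapGrading h).autGrading_gradingDiag]
  rfl

theorem isComposedOf_of_eq {b b' : Fin 3 → Sl2C} {i : Fin 6}
    (h : sixGradings i = lineGrading (composedVec b b')) :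
    IsComposedOf (so4Grading i) (lineGrading b) (lineGrading b') := by
  rw [so4Grading, h]
  exact isComposedOf_mapGrading so4Equiv b b'

theorem not_hasIdealVector_sixGradings {i : Fin 6} (hi : 3 ≤ i) :
    ¬ HasIdealVector (sixGradings i) := by
  fin_cases i
  · simp at hi
  · simp [Fin.le_def] at hi
  · simp [Fin.le_def] at hi
  · exact not_hasIdealVector_twistedVec cartanVec_ne_zero fun _ => one_ne_zero
  · exact not_hasIdealVector_twistedVec pauliVec_ne_zero fun _ => one_ne_zero
  · exact not_hasIdealVector_twistedVec pauliVec_ne_zero vecI_ne_zero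

/-- The refinement of the Cartan grading by the grading composed of two Cartan gradings. -/
theorem exists_fine_refinement : ∃ P : Set (Submodule ℂ O4C), IsFineGrading P ∧
    ¬ IsGroupGrading P ∧ Refines P (so4Grading 0) ∧ IsComposedOf P sl2Cartan sl2Cartan := by
  have h := isLieGrading_mapGrading_cartan so4Equiv
  refine ⟨_, h.isFineGrading fun A hA => ?_, fun hG => ?_, refines_rootGrading.map so4Equiv, ?_⟩
  · obtain ⟨A, hA, rfl⟩ := hA
    exact (finrank_map so4Equiv A).trans (finrank_of_mem_lineGrading
      (composedVec_ne_zero cartanVec_ne_zero cartanVec_ne_zero) hA)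
  · have := hG.isSeparated.mapGrading so4Equiv.symm
    rw [mapGrading_symm] at this
    exact not_isSeparated_composedVec_cartan this
  · rw [sl2Cartan_eq]
    exact isComposedOf_mapGrading so4Equiv cartanVec cartanVec

end Main

theorem mainTheorem8 :
    ∃ (G : Fin 6 → Set (O4C ≃ₗ⁅ℂ⁆ O4C)) (Γ : Fin 6 → Set (Submodule ℂ O4C)),
      -- exactly six MAD-groups up to conjugacy
      (∀ i, IsMADGroup (G i)) ∧
      (∀ i j, i ≠ j → ¬ ConjugateAutSets (G i) (G j)) ∧
      (∀ H : Set (O4C ≃ₗ⁅ℂ⁆ O4C), IsMADGroup H → ∃ i, ConjugateAutSets (G i) H) ∧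
      -- exactly six fine group gradings up to equivalence
      (∀ i, IsFineGroupGrading (Γ i)) ∧
      (∀ i j, i ≠ j → ¬ GradingEquivalent (Γ i) (Γ j)) ∧
      (∀ P : Set (Submodule ℂ O4C), IsFineGroupGrading P → ∃ i, GradingEquivalent (Γ i) P) ∧
      -- which correspond to each other
      (∀ i, autGrading (G i) = Γ i ∧ gradingDiag (Γ i) = G i) ∧
      -- the dimensions of the grading subspaces
      ((Γ 0).ncard = 5 ∧
        {A ∈ Γ 0 | Module.finrank ℂ A = 2}.ncard = 1 ∧
        {A ∈ Γ 0 | Module.finrank ℂ A = 1}.ncard = 4) ∧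
      (∀ i, i ≠ 0 → (Γ i).ncard = 6 ∧ ∀ A ∈ Γ i, Module.finrank ℂ A = 1) ∧
      -- the first one is the Cartan grading; it is the only one that is not a fine grading,
      -- and has the fine non-group refinement composed of two Cartan gradings of `sl(2, ℂ)`
      IsCartanGrading (Γ 0) ∧
      ¬ IsFineGrading (Γ 0) ∧
      (∃ P : Set (Submodule ℂ O4C), IsFineGrading P ∧ ¬ IsGroupGrading P ∧
        Refines P (Γ 0) ∧ IsComposedOf P sl2Cartan sl2Cartan) ∧
      (∀ i, i ≠ 0 → IsFineGrading (Γ i)) ∧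
      -- two of them are composed of fine group gradings of `sl(2, ℂ)`, the last three are not
      IsComposedOf (Γ 1) sl2Cartan sl2Pauli ∧
      IsComposedOf (Γ 2) sl2Pauli sl2Pauli ∧
      (∀ i : Fin 6, 3 ≤ i → ∀ P₁ P₂ : Set (Submodule ℂ Sl2C),
        IsFineGroupGrading P₁ → IsFineGroupGrading P₂ → ¬ IsComposedOf (Γ i) P₁ P₂) := by
  refine ⟨fun i => gradingDiag (so4Grading i), so4Grading, isMADGroup_so4Grading,
    fun i j => not_conjugateAutSets_so4Grading, fun H => exists_conjugateAutSets_of_isMADGroup,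
    isFineGroupGrading_so4Grading, fun i j => not_gradingEquivalent_so4Grading,
    fun P => exists_gradingEquivalent_of_isFineGroupGrading,
    fun i => ⟨(isSeparated_so4Grading i).autGrading_gradingDiag, rfl⟩, ⟨?_, ?_, ?_⟩,
    fun i hi => ⟨(ncard_mapGrading _ _).trans (ncard_sixGradings hi),
      fun A => finrank_of_mem_so4Grading hi⟩,
    isCartanGrading_mapGrading so4Equiv, fun h => ?_, exists_fine_refinement,
    fun i => isFineGrading_so4Grading, ?_, ?_, fun i hi P₁ P₂ h₁ _ h => ?_⟩
  · exact (ncard_mapGrading _ _).trans ncard_rootGrading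
  · rw [so4Grading, sep_mapGrading, ncard_mapGrading]
    exact (congrArg Set.ncard sep_two_rootGrading).trans (Set.ncard_singleton _)
  · rw [so4Grading, sep_mapGrading, ncard_mapGrading]
    refine (congrArg Set.ncard sep_one_rootGrading).trans ?_
    rw [ncard_lineGrading rootVec_span_injective, Fintype.card_fin]
  -- If the Cartan grading were fine it would equal this refinement, which is not a group grading.
  · obtain ⟨P, hP, hG, hr, -⟩ := exists_fine_refinement
    rw [h.2 P hP.1 hr] at hG
    exact hG (isSeparated_so4Grading 0).isGroupGrading
  · rw [sl2Cartan_eq, sl2Pauli_eq]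
    exact isComposedOf_of_eq rfl
  · rw [sl2Pauli_eq]
    exact isComposedOf_of_eq rfl
  · exact not_hasIdealVector_sixGradings hi
      (hasIdealVector_of_isComposedOf so4Equiv h₁.1.1.sSup_eq_top h)
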